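/- Let $\mathbf{G}=(G_{ijkl}(t))_{t>0}$, $i,j,k,l\in\{1,2,3\}$, be a real relaxation modulus with the symmetries $G_{ijkl}=G_{jikl}=G_{ijlk}=G_{klij}$ which is locally integrable and completely monotone (LICM): for every real symmetric $3\times3$ matrix $e$ the function $f(t)=\sum_{ijkl} e_{ij}G_{ijkl}(t)e_{kl}$ is smooth on $]0,\infty[$, satisfies $(-1)^m f^{(m)}(t)\ge 0$ for all $t>0$, $m=0,1,2,\dots$, and is locally integrable on $[0,\infty[$. Let $G^\infty=\lim_{t\to\infty}\mathbf{G}(t)$ be strongly elliptic, that is, $\sum_{klrs} G^\infty_{klrs}n_ln_sa_ka_r>0$ for all non-zero $a,n\in\mathbb{R}^3$, and let $\rho>0$. For a unit vector $n\in\mathbb{R}^3$ and $\operatorname{Re}p>0$ put $Q_n(p)_{ir}=\sum_{js}p\,\tilde G_{ijrs}(p)\,n_jn_s$, where $\tilde G_{ijrs}(p)=\int_0^\infty e^{-pt}G_{ijrs}(t)\,dt$ (the integrals converge absolutely). A function $A$ from $[0,\infty[$ to the real $d\times d$ matrices is called a matrix-valued complete Bernstein function if it has an analytic continuation to $\mathbb{C}\setminus{]-\infty,0]}$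 with $\operatorname{Im}z\,\operatorname{Im}A(z)\ge0$, where $\operatorname{Im}A=(A-A^\dagger)/(2i)$ and $\geq 0$ means positive semi-definite, and if $\lim_{x\to0+}A(x)$ exists, is real and positive semi-definite, and equals $A(0)$. Then for every unit vector $n$: (1) $Q_n$ has an analytic continuation to $\mathbb{C}\setminus{]-\infty,0]}$. There $Q_n(p)$ has an invertible principal square root $Q_n(p)^{1/2}$ (the square root whose eigenvalues lie in the open right half-plane), and $K_n(p)=\rho\,p\,Q_n(p)^{-1/2}$, with $K_n(0)=0$, is analytic on $\mathbb{C}\setminus{]-\infty,0]}$. The restriction of $K_n$ to $[0,\infty[$ is a matrix-valued complete Bernstein function. (2) Consequently there are a real symmetric positive semi-definite matrix $B_n$, a positive Radon measure $\mu_n$ on $]0,\infty[$ with $\int_{]0,\infty[}(1+r)^{-1}\mu_n(dr)<\infty$, and a measurable function $M_n$ on $]0,\infty[$ whose values are, $\mu_n$-almost everywhere, real symmetric positive semi-definite matrices of Frobenius norm at most $1$, such that $$K_n(p)=p\,B_n+p\int_{]0,\infty[}\frac{M_n(r)}{p+r}\,\mu_n(dr)\qquad(p\in\mathbb{C}\setminus{]-\infty,0]}),$$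 and for every $\omega\in\mathbb{R}$ $$K_n(-i\omega)=-i\omega\,C_n(\omega)+A_n(\omega),$$ $$C_n(\omega)=B_n+\int_{]0,\infty[}\frac{r\,M_n(r)}{r^2+\omega^2}\,\mu_n(dr),\qquad A_n(\omega)=\omega^2\int_{]0,\infty[}\frac{M_n(r)}{r^2+\omega^2}\,\mu_n(dr),$$ where the integrals converge absolutely (for $\omega=0$, $A_n(0)$ is understood as $0$), and the dispersion matrix $C_n(\omega)$ and the attenuation matrix $A_n(\omega)$ are real symmetric and positive semi-definite. -/

import Mathlib

open MeasureTheory Filter Topology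
open scoped ComplexOrder

noncomputable section

namespace Viscoelastic

/-- A fourth-rank tensor over `ℝ³`, in components `T i j k l`. -/
abbrev Tensor4 (R : Type*) := Fin 3 → Fin 3 → Fin 3 → Fin 3 → R

/-- A real function is locally integrable completely monotone (LICM) on `]0,∞[`: it is smooth
there, `(-1)^m f^(m) ≥ 0` for all `m`, and it is integrable near `0`. -/
structure IsLICM (f : ℝ → ℝ) : Prop where
  smooth : ContDiffOn ℝ (⊤ : ℕ∞) f (Set.Ioi 0)
  sign : ∀ m : ℕ, ∀ t : ℝ, 0 < t → 0 ≤ (-1 : ℝ) ^ m * iteratedDeriv m f t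
  locInt : LocallyIntegrableOn f (Set.Ici 0)

/-- The tensor is a symmetric operator on symmetric second-rank tensors. -/
structure HasElasticSymmetry (T : Tensor4 ℝ) : Prop where
  minor_left : ∀ i j k l, T i j k l = T j i k l
  minor_right : ∀ i j k l, T i j k l = T i j l k
  major : ∀ i j k l, T i j k l = T k l i j

/-- The quadratic form `⟨e, T e⟩ = e_ij T_ijkl e_kl`. -/
def quadForm (T : Tensor4 ℝ) (e : Matrix (Fin 3) (Fin 3) ℝ) : ℝ :=
  ∑ i, ∑ j, ∑ k, ∑ l, e i j * T i j k l * e k l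

/-- A tensor-valued LICM relaxation modulus `t ↦ G_ijkl(t)`, `t > 0`: a function with values in
the symmetric operators on symmetric second-rank tensors, all whose quadratic forms are LICM. -/
structure IsLICMModulus (G : ℝ → Tensor4 ℝ) : Prop where
  symm : ∀ t, 0 < t → HasElasticSymmetry (G t)
  licm : ∀ e : Matrix (Fin 3) (Fin 3) ℝ, e.IsSymm → IsLICM fun t => quadForm (G t) e

/-- Strong ellipticity: `T_klrs n_l n_s a_k a_r > 0` for non-zero `a` and `n`. -/
def StronglyElliptic (T : Tensor4 ℝ) : Prop :=
  ∀ a n : Fin 3 → ℝ, a ≠ 0 → n ≠ 0 →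
    0 < ∑ k, ∑ l, ∑ r, ∑ s, T k l r s * n l * n s * a k * a r

/-- `Q_ijkl(p) = p · ∫_0^∞ e^{-pt} G_ijkl(t) dt`, for `Re p > 0`. -/
def complexModulus (G : ℝ → Tensor4 ℝ) (p : ℂ) : Tensor4 ℂ := fun i j k l =>
  p * ∫ t in Set.Ioi (0 : ℝ), Complex.exp (-p * t) * (G t i j k l : ℂ)

/-- The contraction `T_ijrs n_j n_s` of a tensor with a direction, a matrix indexed by `i, r`. -/
def contract (n : EuclideanSpace ℝ (Fin 3)) (T : Tensor4 ℂ) : Matrix (Fin 3) (Fin 3) ℂ :=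
  Matrix.of fun i r => ∑ j, ∑ s, T i j r s * (n j : ℂ) * (n s : ℂ)

variable {d : ℕ}

/-- `Im A = (A - A†) / (2i)`. -/
def matIm (A : Matrix (Fin d) (Fin d) ℂ) : Matrix (Fin d) (Fin d) ℂ :=
  (1 / (2 * Complex.I)) • (A - A.conjTranspose)

/-- A matrix-valued function is analytic on the complex plane cut along `]-∞,0]`. -/
def AnalyticOnCutPlane (F : ℂ → Matrix (Fin d) (Fin d) ℂ) : Prop :=
  ∀ i j, AnalyticOnNhd ℂ (fun z => F z i j) Complex.slitPlane

/-- `A`, considered on `[0,∞[`, is a matrix-valued complete Bernstein function: its values are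
real matrices, it has an analytic continuation `F` to the cut plane with `Im z · Im F(z) ≥ 0`,
and it has a real positive semi-definite limit at `0+`, which is its value at `0`. -/
structure IsMvCBF (A : ℝ → Matrix (Fin d) (Fin d) ℂ) : Prop where
  real : ∀ x : ℝ, 0 ≤ x → ∃ R : Matrix (Fin d) (Fin d) ℝ, A x = R.map Complex.ofReal
  continuation : ∃ F : ℂ → Matrix (Fin d) (Fin d) ℂ,
    AnalyticOnCutPlane F ∧ (∀ x : ℝ, 0 < x → F x = A x) ∧
      ∀ z ∈ Complex.slitPlane, ((z.im : ℂ) • matIm (F z)).PosSemidef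
  limit_zero : Tendsto A (𝓝[>] 0) (𝓝 (A 0))
  zero_nonneg : (A 0).PosSemidef

/-- `Y` is the principal square root of `B`: `Y² = B` and all eigenvalues of `Y` lie in the open
right half-plane. (Such a `Y` is unique.) -/
def IsPrincipalSqrt (B Y : Matrix (Fin d) (Fin d) ℂ) : Prop :=
  Y * Y = B ∧ ∀ c ∈ spectrum ℂ Y, 0 < c.re

open Classical in
/-- The principal square root of `B` (and `0` if there is none). -/
def principalSqrt (B : Matrix (Fin d) (Fin d) ℂ) : Matrix (Fin d) (Fin d) ℂ :=
  if h : ∃ Y, IsPrincipalSqrt B Y then h.choose else 0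

/-- `K(p) = ρ p Q(p)^{-1/2}`, the power being the inverse of the principal square root. -/
def waveMatrix (ρ : ℝ) (Q : ℂ → Matrix (Fin d) (Fin d) ℂ) (p : ℂ) : Matrix (Fin d) (Fin d) ℂ :=
  ((ρ : ℂ) * p) • (principalSqrt (Q p))⁻¹

/-- `C(ω) = B + ∫_{]0,∞[} r M(r) / (r² + ω²) μ(dr)`. -/
def dispersionMatrix (B : Matrix (Fin d) (Fin d) ℝ) (μ : Measure ℝ)
    (M : ℝ → Matrix (Fin d) (Fin d) ℝ) (ω : ℝ) : Matrix (Fin d) (Fin d) ℝ :=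
  Matrix.of fun i j => B i j + ∫ r in Set.Ioi (0 : ℝ), r * M r i j / (r ^ 2 + ω ^ 2) ∂μ

/-- `A(ω) = ω² ∫_{]0,∞[} M(r) / (r² + ω²) μ(dr)`. -/
def attenuationMatrix (μ : Measure ℝ)
    (M : ℝ → Matrix (Fin d) (Fin d) ℝ) (ω : ℝ) : Matrix (Fin d) (Fin d) ℝ :=
  Matrix.of fun i j => ω ^ 2 * ∫ r in Set.Ioi (0 : ℝ), M r i j / (r ^ 2 + ω ^ 2) ∂μ

end Viscoelastic

end

/-! The proof rests on one picture of Stieltjes functions: for `Re w > 0` and `r ≥ 0` the number `w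
/ (w² + r) = (w + r / w)⁻¹` has positive real part. Hence a matrix Stieltjes function `S` satisfies
`Re (w S(w²)) ≥ 0`; conversely, an analytic symmetric `S`, real on the positive axis, with this
property is a matrix Stieltjes function.

The Laplace transform of an LICM function is Stieltjes (`IsLICM.exists_laplace_eq`), so `Q_n`
extends to the cut plane as `z` times a Stieltjes function and `z^(-1/2) Q_n(z)` is accretive. Since
`Q_n` is complex symmetric, this needs to be tested on real vectors only. Strictness comes from
`G(t) ≥ G^∞` along rank-one strains and the strong ellipticity of `G^∞`.

An accretive matrix has an accretive square root `P`, and its numerical range lies in the sector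
`|arg| < π/4` (`Accretive.abs_im_lt_re`). On the cut plane `|arg z^(1/4)| < π/4`, so `z^(1/4) P` is
accretive and therefore equals `Q_n^(1/2)`. The same sector estimate applied to `z^(1/2) Q_n^(-1/2)
= z^(1/4) P⁻¹` shows that `S = ρ Q_n^(-1/2)` again satisfies `Re (w S(w²)) ≥ 0`
(`IsSectorial.re_mul_realForm_inv_pos`).

The representation of `S` is a Herglotz theorem: a Cayley transform moves `w S(w²)` to the disc,
Poisson integrals over growing circles are positive functionals, and a weak limit gives the measures
(`IsStieltjesType.exists_measure`). They depend quadratically on the test vector, hence have a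
matrix density with respect to their trace (`exists_matrix_density`). All measures live on `[0,1]`
in the variable `u = 1 / (1 + r)`: compactness keeps the mass at `r = ∞`, which becomes `B`. The
bound `Q_n(x) ≥ δ` for `x > 0` makes `S` bounded there, which excludes an atom at `r = 0` and makes
`1 / r` integrable. Finally `K_n = z S`, and both `Im (z / (z + r)) = r Im z / |z + r|²` and the
dispersion-attenuation splitting are read off under the integral. -/

namespace Viscoelastic

/-! ### Accretive matrices and a Sylvester equation -/

section Accretive

variable {ι : Type*} [Fintype ι]

/-- A complex matrix is (strictly) accretive if its numerical range lies in the open right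
half-plane. -/
def Accretive (A : Matrix ι ι ℂ) : Prop :=
  ∀ v : ι → ℂ, v ≠ 0 → 0 < (star v ⬝ᵥ A.mulVec v).re

variable [DecidableEq ι]

theorem Accretive.re_pos_of_mem_spectrum {A : Matrix ι ι ℂ} (hA : Accretive A) {c : ℂ}
    (hc : c ∈ spectrum ℂ A) : 0 < c.re := by
  rw [← Matrix.spectrum_toLin', ← Module.End.hasEigenvalue_iff_mem_spectrum] at hc
  obtain ⟨v, hv⟩ := hc.exists_hasEigenvector
  have h1 := hA v hv.2
  have h2 : A.mulVec v = c • v := by simpa using hv.apply_eq_smul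
  rw [h2, dotProduct_smul, smul_eq_mul] at h1
  have h3 : star v ⬝ᵥ v = ((∑ i, ‖v i‖ ^ 2 : ℝ) : ℂ) := by
    simp [dotProduct, Complex.conj_mul']
  rw [h3, Complex.re_mul_ofReal] at h1
  exact pos_of_mul_pos_left h1 (by positivity)

theorem Accretive.isUnit {A : Matrix ι ι ℂ} (hA : Accretive A) : IsUnit A := by
  by_contra h
  rw [← spectrum.zero_mem_iff ℂ] at h
  simpa using hA.re_pos_of_mem_spectrum h

/-- The relation `Y X = X (-Z)` passes to polynomials. For the characteristic polynomial of `Y` the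
left side vanishes, while its value at `-Z` is invertible because the imaginary axis separates the
spectra of `Y` and `-Z`. Applied to the difference of two principal square roots this gives
uniqueness. -/
theorem eq_zero_of_mul_add_mul_eq_zero {Y Z X : Matrix ι ι ℂ}
    (hY : ∀ c ∈ spectrum ℂ Y, 0 < c.re) (hZ : ∀ c ∈ spectrum ℂ Z, 0 < c.re)
    (h : Y * X + X * Z = 0) : X = 0 := by
  have h1 : Y * X = X * (-Z) := by
    rw [mul_neg]; exact eq_neg_of_add_eq_zero_left h
  have h2 : ∀ p : Polynomial ℂ, Polynomial.aeval Y p * X = X * Polynomial.aeval (-Z) p := by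
    intro p
    induction p using Polynomial.induction_on' with
    | add p q hp hq => simp [add_mul, mul_add, hp, hq]
    | monomial n a =>
      have h3 : Y ^ n * X = X * (-Z) ^ n := by
        induction n with
        | zero => simp
        | succ n ih => rw [pow_succ, mul_assoc, h1, ← mul_assoc, ih, mul_assoc, ← pow_succ]
      simp only [Polynomial.aeval_monomial]
      rw [mul_assoc, h3, ← mul_assoc, Algebra.commutes, mul_assoc]
  have h4 := h2 Y.charpoly
  rw [Matrix.aeval_self_charpoly, zero_mul] at h4
  have h5 : IsUnit (Polynomial.aeval (-Z) Y.charpoly) := by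
    by_contra h6
    rw [← spectrum.zero_mem_iff ℂ] at h6
    rcases isEmpty_or_nonempty ι with hι | hι
    · exact (spectrum.zero_mem_iff ℂ).1 h6
        (isUnit_iff_exists.2 ⟨0, Subsingleton.elim _ _, Subsingleton.elim _ _⟩)
    rw [spectrum.map_polynomial_aeval_of_nonempty (-Z) _
      (spectrum.nonempty_of_isAlgClosed_of_finiteDimensional ℂ _)] at h6
    obtain ⟨c, hc, hc0⟩ := h6
    have h7 : c ∈ spectrum ℂ Y := Matrix.mem_spectrum_iff_isRoot_charpoly.2 hc0
    have h8 : -c ∈ spectrum ℂ Z := by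
      rw [← spectrum.neg_eq, Set.mem_neg] at hc
      exact hc
    have := hY _ h7
    have := hZ _ h8
    simp at this
    linarith
  obtain ⟨u, hu⟩ := h5
  rw [← hu] at h4
  exact (Units.mul_left_eq_zero u).1 h4.symm

end Accretive

/-! ### Uniqueness of the principal square root -/

section PrincipalSqrt

variable {d : ℕ}

theorem IsPrincipalSqrt.unique {B Y Z : Matrix (Fin d) (Fin d) ℂ}
    (hY : IsPrincipalSqrt B Y) (hZ : IsPrincipalSqrt B Z) : Y = Z := by
  refine sub_eq_zero.1 (eq_zero_of_mul_add_mul_eq_zero hY.2 hZ.2 ?_)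
  rw [mul_sub, sub_mul, hY.1, hZ.1]; abel

theorem IsPrincipalSqrt.principalSqrt_eq {B Y : Matrix (Fin d) (Fin d) ℂ}
    (hY : IsPrincipalSqrt B Y) : principalSqrt B = Y := by
  have h : ∃ Y, IsPrincipalSqrt B Y := ⟨Y, hY⟩
  rw [principalSqrt, dif_pos h]
  exact h.choose_spec.unique hY

end PrincipalSqrt

/-! ### The sector of angle `π/4` for square roots of accretive matrices -/

section Sector

variable {ι : Type*} [Fintype ι]

theorem star_dotProduct_conjTranspose_mulVec (A : Matrix ι ι ℂ) (v : ι → ℂ) :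
    star v ⬝ᵥ A.conjTranspose.mulVec v = star (star v ⬝ᵥ A.mulVec v) := by
  rw [Matrix.star_dotProduct, Matrix.star_mulVec, Matrix.conjTranspose_conjTranspose,
    ← Matrix.dotProduct_mulVec]

theorem Accretive.conjTranspose {A : Matrix ι ι ℂ} (hA : Accretive A) :
    Accretive A.conjTranspose := by
  intro v hv
  rw [star_dotProduct_conjTranspose_mulVec]
  simpa using hA v hv

variable [DecidableEq ι]

/-- The claim is that `B = X + X†` with `X = (1 + i) Y` is positive definite. On a unit eigenvector
`u` with eigenvalue `l` one has `X† u = l u - X u`, so `⟨u, X² u⟩ = l ⟨u, X u⟩ - |X u|²`. Since `X²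
= 2 i Y²`, imaginary parts give `l (Re + Im)⟨u, Y u⟩ > 0`. As `l = 2 (Re - Im)⟨u, Y u⟩` and `Re ⟨u,
Y u⟩ > 0`, the case `l ≤ 0` is impossible. -/
theorem Accretive.im_lt_re {Y : Matrix ι ι ℂ} (hY : Accretive Y) (hYY : Accretive (Y * Y))
    (v : ι → ℂ) (hv : v ≠ 0) : (star v ⬝ᵥ Y.mulVec v).im < (star v ⬝ᵥ Y.mulVec v).re := by
  set X : Matrix ι ι ℂ := (1 + Complex.I) • Y with hX
  set B : Matrix ι ι ℂ := X + X.conjTranspose with hB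
  have hBH : B.IsHermitian := by
    rw [hB, Matrix.IsHermitian, Matrix.conjTranspose_add, Matrix.conjTranspose_conjTranspose,
      add_comm]
  have hquad : ∀ u : ι → ℂ, star u ⬝ᵥ B.mulVec u =
      ((2 * ((star u ⬝ᵥ Y.mulVec u).re - (star u ⬝ᵥ Y.mulVec u).im) : ℝ) : ℂ) := by
    intro u
    rw [hB, Matrix.add_mulVec, dotProduct_add, star_dotProduct_conjTranspose_mulVec, hX,
      Matrix.smul_mulVec, dotProduct_smul]
    apply Complex.ext <;> simp <;> ring
  have hpos : B.PosDef := by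
    rw [hBH.posDef_iff_eigenvalues_pos]
    intro i
    set u : ι → ℂ := ⇑(hBH.eigenvectorBasis i) with hu
    set l : ℝ := hBH.eigenvalues i
    have hBu : B.mulVec u = (l : ℂ) • u := by
      have := hBH.mulVec_eigenvectorBasis i
      simpa using this
    have hu0 : u ≠ 0 := by
      intro h
      have h1 := hBH.eigenvectorBasis.toBasis.ne_zero i
      apply h1
      ext j
      simpa using congrFun h j
    have hn : star u ⬝ᵥ u = 1 := by
      have h1 := hBH.eigenvectorBasis.orthonormal.1 i
      have h2 : inner ℂ (hBH.eigenvectorBasis i) (hBH.eigenvectorBasis i) = (1 : ℂ) := by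
        rw [inner_self_eq_norm_sq_to_K, h1]; simp
      rw [← h2, EuclideanSpace.inner_eq_star_dotProduct, dotProduct_comm]
    have hl : l = 2 * ((star u ⬝ᵥ Y.mulVec u).re - (star u ⬝ᵥ Y.mulVec u).im) := by
      have := hquad u
      rw [hBu, dotProduct_smul, hn] at this
      simpa using congrArg Complex.re this
    have h1 := hY u hu0
    have h2 := hYY u hu0
    have h3 : star u ⬝ᵥ (X * X).mulVec u =
        (l : ℂ) * (star u ⬝ᵥ X.mulVec u) - star (X.mulVec u) ⬝ᵥ X.mulVec u := by
      have h4 : X.conjTranspose.mulVec u = (l : ℂ) • u - X.mulVec u := by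
        rw [← hBu, hB, Matrix.add_mulVec]; abel
      have h5 : star u ⬝ᵥ (X * X).mulVec u = star (X.conjTranspose.mulVec u) ⬝ᵥ X.mulVec u := by
        rw [Matrix.star_mulVec, Matrix.conjTranspose_conjTranspose, ← Matrix.mulVec_mulVec,
          Matrix.dotProduct_mulVec]
      rw [h5, h4, star_sub, sub_dotProduct, star_smul, smul_dotProduct]
      simp
    have h6 : star u ⬝ᵥ (X * X).mulVec u = (2 * Complex.I) * (star u ⬝ᵥ (Y * Y).mulVec u) := by
      rw [hX, smul_mul_smul_comm, Matrix.smul_mulVec, dotProduct_smul, smul_eq_mul]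
      congr 1
      ring_nf
      simp
    have h7 : star (X.mulVec u) ⬝ᵥ X.mulVec u = ((∑ i, ‖X.mulVec u i‖ ^ 2 : ℝ) : ℂ) := by
      simp [dotProduct, Complex.conj_mul']
    rw [h6, h7, hX, Matrix.smul_mulVec, dotProduct_smul] at h3
    have h8 := congrArg Complex.im h3
    rw [Complex.sub_im, Complex.ofReal_im] at h8
    simp at h8
    nlinarith
  have h9 := (hpos.dotProduct_mulVec_pos hv)
  rw [hquad v] at h9
  have h10 := Complex.zero_lt_real.1 h9
  linarith

theorem Accretive.abs_im_lt_re {Y : Matrix ι ι ℂ} (hY : Accretive Y) (hYY : Accretive (Y * Y))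
    (v : ι → ℂ) (hv : v ≠ 0) : |(star v ⬝ᵥ Y.mulVec v).im| < (star v ⬝ᵥ Y.mulVec v).re := by
  rw [abs_lt]
  refine ⟨?_, hY.im_lt_re hYY v hv⟩
  have h := hY.conjTranspose.im_lt_re (by
    rw [← Matrix.conjTranspose_mul]; exact hYY.conjTranspose) v hv
  rw [star_dotProduct_conjTranspose_mulVec] at h
  simp at h
  linarith

/-- The numerical range of `Y` has argument strictly below `π/4` in modulus, so multiplication by a
`c` with `|arg c| ≤ π/4` keeps it in the right half-plane. -/
theorem Accretive.smul_sqrt {Y : Matrix ι ι ℂ} (hY : Accretive Y) (hYY : Accretive (Y * Y))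
    {c : ℂ} (hc : 0 < c.re) (hc' : |c.im| ≤ c.re) : Accretive (c • Y) := by
  intro v hv
  have h := hY.abs_im_lt_re hYY v hv
  rw [Matrix.smul_mulVec, dotProduct_smul, smul_eq_mul, Complex.mul_re, sub_pos]
  calc c.im * (star v ⬝ᵥ Y.mulVec v).im
      ≤ |c.im| * |(star v ⬝ᵥ Y.mulVec v).im| := by rw [← abs_mul]; exact le_abs_self _
    _ ≤ c.re * |(star v ⬝ᵥ Y.mulVec v).im| := by gcongr
    _ < c.re * (star v ⬝ᵥ Y.mulVec v).re := by gcongr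

end Sector

/-! ### Analytic square roots near the identity -/

section BanachAlgebra

/-- With `1 - 2u` as the root, the equation becomes the fixed-point problem `u = T / 4 + u²`, solved
by iteration from `0`. Convergence is uniform in `z`, so the limit stays analytic, and no
commutation with `T` is needed. -/
theorem exists_differentiableOn_sqrt_one_sub {R : Type*} [NormedRing R] [NormedAlgebra ℂ R]
    [CompleteSpace R] {V : Set ℂ} (hV : IsOpen V) {T : ℂ → R} (hT : DifferentiableOn ℂ T V)
    {q : ℝ} (hq0 : 0 ≤ q) (hq : q < 1) (hTq : ∀ z ∈ V, ‖T z‖ ≤ q) :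
    ∃ u : ℂ → R, DifferentiableOn ℂ u V ∧
      ∀ z ∈ V, (1 - (2 : ℂ) • u z) * (1 - (2 : ℂ) • u z) = 1 - T z ∧ ‖(2 : ℂ) • u z‖ < 1 := by
  -- The smaller root of `m = q / 4 + m²`: it bounds every iterate, and `2 m < 1` is the contraction
  -- factor.
  set m : ℝ := (1 - √(1 - q)) / 2 with hm
  have hs0 : 0 < √(1 - q) := Real.sqrt_pos.2 (by linarith)
  have hs2 : √(1 - q) ^ 2 = 1 - q := Real.sq_sqrt (by linarith)
  have hs1 : √(1 - q) ≤ 1 := by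
    nlinarith
  have hm0 : 0 ≤ m := by rw [hm]; linarith
  have hm1 : 2 * m < 1 := by rw [hm]; linarith
  have hmq : q / 4 + m ^ 2 = m := by rw [hm]; nlinarith
  let U : ℕ → ℂ → R := fun k => k.rec (fun _ => 0) (fun _ f z => (1 / 4 : ℂ) • T z + f z * f z)
  have hU0 : ∀ z, U 0 z = 0 := fun z => rfl
  have hUs : ∀ k z, U (k + 1) z = (1 / 4 : ℂ) • T z + U k z * U k z := fun k z => rfl
  have hUd : ∀ k, DifferentiableOn ℂ (U k) V := by
    intro k
    induction k with
    | zero => exact differentiableOn_const _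
    | succ k ih => exact (hT.fun_const_smul (1 / 4 : ℂ)).fun_add (ih.fun_mul ih)
  have hUm : ∀ k, ∀ z ∈ V, ‖U k z‖ ≤ m := by
    intro k z hz
    induction k with
    | zero => simpa [hU0] using hm0
    | succ k ih =>
      rw [hUs, ← hmq]
      refine (norm_add_le _ _).trans (add_le_add ?_ ?_)
      · rw [norm_smul]
        have := hTq z hz
        norm_num
        linarith
      · rw [sq]
        exact (norm_mul_le _ _).trans (by gcongr)
  have hUdiff : ∀ k, ∀ z ∈ V, ‖U (k + 1) z - U k z‖ ≤ m * (2 * m) ^ k := by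
    intro k z hz
    induction k with
    | zero => simpa [hU0] using hUm 1 z hz
    | succ k ih =>
      have h1 : U (k + 1 + 1) z - U (k + 1) z =
          U (k + 1) z * (U (k + 1) z - U k z) + (U (k + 1) z - U k z) * U k z := by
        rw [hUs (k + 1), hUs k]; noncomm_ring
      rw [h1]
      refine (norm_add_le _ _).trans ?_
      have h2 := (norm_mul_le (U (k + 1) z) (U (k + 1) z - U k z))
      have h3 := (norm_mul_le (U (k + 1) z - U k z) (U k z))
      have h4 : ‖U (k + 1) z‖ * ‖U (k + 1) z - U k z‖ ≤ m * (m * (2 * m) ^ k) := by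
        gcongr
        exact hUm (k + 1) z hz
      have h5 : ‖U (k + 1) z - U k z‖ * ‖U k z‖ ≤ (m * (2 * m) ^ k) * m := by
        gcongr
        exact hUm _ z hz
      rw [pow_succ]
      linarith
  have hsum : Summable fun k : ℕ => m * (2 * m) ^ k :=
    (summable_geometric_of_lt_one (by linarith) hm1).mul_left m
  refine ⟨fun z => ∑' k, (U (k + 1) z - U k z), ?_, ?_⟩
  · exact Complex.differentiableOn_tsum_of_summable_norm hsum
      (fun k => (hUd (k + 1)).sub (hUd k)) hV (fun k z hz => hUdiff k z hz)
  · intro z hz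
    have hlim : Tendsto (fun k => U k z) atTop (𝓝 (∑' k, (U (k + 1) z - U k z))) := by
      have h1 : Summable fun k => U (k + 1) z - U k z :=
        Summable.of_norm_bounded hsum (fun k => hUdiff k z hz)
      have h2 := h1.hasSum.tendsto_sum_nat
      simpa [Finset.sum_range_sub (fun k => U k z), hU0] using h2
    set u := ∑' k, (U (k + 1) z - U k z)
    have h1 : (1 / 4 : ℂ) • T z + u * u = u := by
      refine tendsto_nhds_unique ?_ ((tendsto_add_atTop_iff_nat 1).2 hlim)
      simp only [hUs]
      exact tendsto_const_nhds.add (hlim.mul hlim)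
    constructor
    · have h2 : T z = (4 : ℂ) • (u - u * u) := by
        rw [← eq_sub_of_add_eq h1, smul_smul]; norm_num
      rw [h2]
      simp only [mul_sub, sub_mul, one_mul, mul_one, smul_mul_smul_comm, smul_sub]
      norm_num
      have : (4 : ℂ) • u = (2 : ℂ) • u + (2 : ℂ) • u := by rw [← add_smul]; norm_num
      rw [this]; abel
    · have h3 : ‖u‖ ≤ m := le_of_tendsto hlim.norm (Eventually.of_forall fun k => hUm k z hz)
      rw [norm_smul]
      norm_num
      linarith

end BanachAlgebra

/-! ### Local analytic square roots of accretive families -/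

section Accretive

open scoped Matrix.Norms.L2Operator

variable {ι : Type*} [Fintype ι]

theorem Accretive.exists_lower_bound {A : Matrix ι ι ℂ} (hA : Accretive A) :
    ∃ δ > 0, ∀ v : ι → ℂ, δ * ∑ i, ‖v i‖ ^ 2 ≤ (star v ⬝ᵥ A.mulVec v).re := by
  let f : EuclideanSpace ℂ ι → ℝ := fun x => (star x.ofLp ⬝ᵥ A.mulVec x.ofLp).re
  have hf : Continuous f := by
    simp only [f, dotProduct, Matrix.mulVec]
    fun_prop
  have key : ∃ δ > 0, ∀ x ∈ Metric.sphere (0 : EuclideanSpace ℂ ι) 1, δ ≤ f x := by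
    rcases (Metric.sphere (0 : EuclideanSpace ℂ ι) 1).eq_empty_or_nonempty with h | h
    · exact ⟨1, one_pos, by simp [h]⟩
    · obtain ⟨x, hx, hmin⟩ := (isCompact_sphere _ _).exists_isMinOn h hf.continuousOn
      refine ⟨f x, hA _ ?_, fun y hy => hmin hy⟩
      intro h0
      have : x = 0 := by ext i; exact congrFun h0 i
      simp [this] at hx
  obtain ⟨δ, hδ, hmin⟩ := key
  refine ⟨δ, hδ, fun v => ?_⟩
  have h2 : ∑ i, ‖v i‖ ^ 2 = ‖WithLp.toLp 2 v‖ ^ 2 := by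
    rw [EuclideanSpace.norm_sq_eq]
  by_cases hv : v = 0
  · simp [hv]
  set x : EuclideanSpace ℂ ι := WithLp.toLp 2 v with hx
  have hx0 : 0 < ‖x‖ := norm_pos_iff.2 (by
    intro h; apply hv; ext i; exact congrFun (congrArg WithLp.ofLp h) i)
  have h3 := hmin (((‖x‖⁻¹ : ℝ) : ℂ) • x) (by
    simp [norm_smul, hx0.ne'])
  have h4 : f (((‖x‖⁻¹ : ℝ) : ℂ) • x) = ‖x‖⁻¹ ^ 2 * (star v ⬝ᵥ A.mulVec v).re := by
    simp only [f, WithLp.ofLp_smul, hx, Matrix.mulVec_smul, dotProduct_smul, star_smul,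
      smul_dotProduct, smul_eq_mul, Complex.star_def, Complex.conj_ofReal, Complex.re_ofReal_mul]
    ring
  rw [h4] at h3
  rw [h2]
  field_simp at h3
  linarith

theorem Accretive.smul_ofReal {A : Matrix ι ι ℂ} (hA : Accretive A) {c : ℝ} (hc : 0 < c) :
    Accretive ((c : ℂ) • A) := by
  intro v hv
  rw [Matrix.smul_mulVec, dotProduct_smul, smul_eq_mul, Complex.re_ofReal_mul]
  exact mul_pos hc (hA v hv)

variable [DecidableEq ι]

theorem re_star_dotProduct_mulVec_le (A : Matrix ι ι ℂ) (v : ι → ℂ) :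
    (star v ⬝ᵥ A.mulVec v).re ≤ ‖A‖ * ∑ i, ‖v i‖ ^ 2 := by
  have h := Matrix.l2_opNorm_mulVec A (WithLp.toLp 2 v)
  have h1 : star v ⬝ᵥ A.mulVec v = inner ℂ (WithLp.toLp 2 v) (WithLp.toLp 2 (A.mulVec v)) := by
    rw [EuclideanSpace.inner_toLp_toLp, dotProduct_comm]
  have h2 : ∑ i, ‖v i‖ ^ 2 = ‖WithLp.toLp 2 v‖ ^ 2 := by
    rw [EuclideanSpace.norm_sq_eq]
  rw [h1, h2]
  refine (Complex.re_le_norm _).trans ((norm_inner_le_norm _ _).trans ?_)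
  have h3 : ‖WithLp.toLp 2 (A.mulVec v)‖ ≤ ‖A‖ * ‖WithLp.toLp 2 v‖ := h
  nlinarith [norm_nonneg (WithLp.toLp 2 v)]

theorem accretive_one_sub {A : Matrix ι ι ℂ} (hA : ‖A‖ < 1) : Accretive (1 - A) := by
  intro v hv
  have h := re_star_dotProduct_mulVec_le A v
  have h1 : star v ⬝ᵥ v = ((∑ i, ‖v i‖ ^ 2 : ℝ) : ℂ) := by
    simp [dotProduct, Complex.conj_mul']
  have h2 : 0 < ∑ i, ‖v i‖ ^ 2 := by
    obtain ⟨i, hi⟩ := Function.ne_iff.1 hv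
    exact Finset.sum_pos' (fun _ _ => by positivity) ⟨i, Finset.mem_univ _, by
      have : v i ≠ 0 := hi
      positivity⟩
  rw [Matrix.sub_mulVec, dotProduct_sub, Matrix.one_mulVec, h1, Complex.sub_re, Complex.ofReal_re]
  nlinarith

/-- Expanding, `‖x - A x / c‖² ≤ (1 - 2 δ / c + ‖A‖² / c²) ‖x‖²`, where `δ` is the lower bound of
the numerical range. For large `c` this is at most `(1 - δ / c) ‖x‖²`, so a rescaled accretive
matrix is close enough to the identity for the iterative square root. -/
theorem Accretive.exists_norm_lt {A : Matrix ι ι ℂ} (hA : Accretive A) :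
    ∃ c : ℝ, 0 < c ∧ ‖1 - ((c⁻¹ : ℝ) : ℂ) • A‖ < 1 := by
  obtain ⟨δ, hδ, hmin⟩ := hA.exists_lower_bound
  -- Chosen so that `‖A‖² ≤ δ c`; the summand `1` keeps `c` positive even for `A = 0`.
  set c : ℝ := (‖A‖ ^ 2 + 1) / δ with hc
  have hc0 : 0 < c := by positivity
  refine ⟨c, hc0, ?_⟩
  set k : ℝ := 1 - δ / c with hk
  have hk1 : k < 1 := by rw [hk]; have : 0 < δ / c := by positivity
                         linarith
  have hAc : ‖A‖ ^ 2 ≤ δ * c := by rw [hc]; field_simp; linarith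
  have hv : ∀ x : EuclideanSpace ℂ ι,
      ‖Matrix.toEuclideanCLM (𝕜 := ℂ) (1 - ((c⁻¹ : ℝ) : ℂ) • A) x‖ ^ 2 ≤ k * ‖x‖ ^ 2 := by
    intro x
    have h1 := hmin x.ofLp
    have h2 := Matrix.l2_opNorm_mulVec A x
    have h2' : ‖Matrix.toEuclideanCLM (𝕜 := ℂ) A x‖ ≤ ‖A‖ * ‖x‖ := h2
    have h3 : star x.ofLp ⬝ᵥ A.mulVec x.ofLp = inner ℂ x (Matrix.toEuclideanCLM (𝕜 := ℂ) A x) := by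
      rw [EuclideanSpace.inner_eq_star_dotProduct, dotProduct_comm]; simp
    rw [← EuclideanSpace.norm_sq_eq, h3] at h1
    rw [map_sub, map_one, map_smul]
    simp only [sub_apply, smul_apply, one_apply_eq_self]
    rw [@norm_sub_sq ℂ, inner_smul_right, norm_smul, Complex.norm_real,
      Real.norm_of_nonneg (by positivity)]
    set y := Matrix.toEuclideanCLM (𝕜 := ℂ) A x
    have h4 : RCLike.re (((c⁻¹ : ℝ) : ℂ) * inner ℂ x y) = c⁻¹ * (inner ℂ x y).re :=
      Complex.re_ofReal_mul _ _
    rw [h4, hk]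
    have h5 : ‖y‖ ^ 2 ≤ δ * c * ‖x‖ ^ 2 := by
      calc ‖y‖ ^ 2 ≤ (‖A‖ * ‖x‖) ^ 2 := by gcongr
        _ = ‖A‖ ^ 2 * ‖x‖ ^ 2 := by ring
        _ ≤ _ := by gcongr
    have h6 : (c⁻¹ * ‖y‖) ^ 2 ≤ c⁻¹ * (δ * ‖x‖ ^ 2) := by
      calc (c⁻¹ * ‖y‖) ^ 2 = c⁻¹ ^ 2 * ‖y‖ ^ 2 := by ring
        _ ≤ c⁻¹ ^ 2 * (δ * c * ‖x‖ ^ 2) := by gcongr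
        _ = _ := by field_simp
    have h7 : c⁻¹ * (δ * ‖x‖ ^ 2) ≤ c⁻¹ * (inner ℂ x y).re := by gcongr
    rw [div_eq_inv_mul]
    linarith
  have hk0 : √k < 1 := by
    rw [Real.sqrt_lt' one_pos]; linarith
  refine lt_of_le_of_lt ?_ hk0
  rw [Matrix.cstar_norm_def]
  refine ContinuousLinearMap.opNorm_le_bound _ (Real.sqrt_nonneg _) fun x => ?_
  have h := Real.sqrt_le_sqrt (hv x)
  by_cases hk' : 0 ≤ k
  · rwa [Real.sqrt_sq (norm_nonneg _), Real.sqrt_mul hk', Real.sqrt_sq (norm_nonneg _)] at h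
  · have h8 := hv x
    have h9 : k * ‖x‖ ^ 2 ≤ 0 := mul_nonpos_of_nonpos_of_nonneg (by linarith) (by positivity)
    have h10 : ‖Matrix.toEuclideanCLM (𝕜 := ℂ) (1 - ((c⁻¹ : ℝ) : ℂ) • A) x‖ = 0 := by
      have := h8.trans h9
      exact pow_eq_zero_iff (two_ne_zero) |>.1 (le_antisymm this (by positivity))
    rw [h10]; positivity

theorem exists_local_accretive_sqrt {U : Set ℂ} (hU : IsOpen U) {A : ℂ → Matrix ι ι ℂ}
    (hA : DifferentiableOn ℂ A U) {z₀ : ℂ} (hz₀ : z₀ ∈ U) (hacc : Accretive (A z₀)) :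
    ∃ V, IsOpen V ∧ z₀ ∈ V ∧ V ⊆ U ∧ ∃ Y : ℂ → Matrix ι ι ℂ, DifferentiableOn ℂ Y V ∧
      ∀ z ∈ V, Y z * Y z = A z ∧ Accretive (Y z) := by
  obtain ⟨c, hc, hlt⟩ := hacc.exists_norm_lt
  set T : ℂ → Matrix ι ι ℂ := fun z => 1 - ((c⁻¹ : ℝ) : ℂ) • A z with hT
  have hTd : DifferentiableOn ℂ T U := (differentiableOn_const _).fun_sub (hA.fun_const_smul _)
  obtain ⟨q, hq1, hq2⟩ := exists_between hlt
  have hq0 : 0 ≤ q := (norm_nonneg _).trans hq1.le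
  have hVo : IsOpen (U ∩ (fun z => ‖T z‖) ⁻¹' Set.Iio q) :=
    hTd.continuousOn.norm.isOpen_inter_preimage hU isOpen_Iio
  refine ⟨_, hVo, ⟨hz₀, hq1⟩, Set.inter_subset_left, ?_⟩
  obtain ⟨u, hu, hu2⟩ := exists_differentiableOn_sqrt_one_sub hVo
    (hTd.mono Set.inter_subset_left) hq0 hq2 (fun z hz => hz.2.le)
  refine ⟨fun z => ((√c : ℝ) : ℂ) • (1 - (2 : ℂ) • u z),
    ((differentiableOn_const _).fun_sub (hu.fun_const_smul _)).fun_const_smul _, fun z hz => ⟨?_, ?_⟩⟩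
  · rw [smul_mul_smul_comm, (hu2 z hz).1, ← Complex.ofReal_mul, Real.mul_self_sqrt hc.le, hT]
    simp only [sub_sub_cancel]
    rw [smul_smul, ← Complex.ofReal_mul, mul_inv_cancel₀ hc.ne']
    simp
  · exact (accretive_one_sub (hu2 z hz).2).smul_ofReal (Real.sqrt_pos.2 hc)

end Accretive

/-! ### Existence and analyticity of the principal square root -/

section PrincipalSqrt

variable {d : ℕ}

theorem Accretive.isPrincipalSqrt {A : Matrix (Fin d) (Fin d) ℂ} (hA : Accretive A) :
    IsPrincipalSqrt (A * A) A :=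
  ⟨rfl, fun _ hc => hA.re_pos_of_mem_spectrum hc⟩

theorem Accretive.principalSqrt_spec {A : Matrix (Fin d) (Fin d) ℂ} (hA : Accretive A) :
    principalSqrt A * principalSqrt A = A ∧ Accretive (principalSqrt A) := by
  obtain ⟨V, -, hV, -, Y, -, hY⟩ := exists_local_accretive_sqrt (A := fun _ => A) (z₀ := 0)
    isOpen_univ (differentiableOn_const _) trivial hA
  have h1 : IsPrincipalSqrt A (Y 0) := by
    have := (hY 0 hV).2.isPrincipalSqrt
    rwa [(hY 0 hV).1] at this
  rw [h1.principalSqrt_eq]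
  exact hY 0 hV

theorem differentiableOn_principalSqrt {U : Set ℂ} (hU : IsOpen U)
    {A : ℂ → Matrix (Fin d) (Fin d) ℂ} (hA : DifferentiableOn ℂ A U)
    (hacc : ∀ z ∈ U, Accretive (A z)) :
    DifferentiableOn ℂ (fun z => principalSqrt (A z)) U := by
  intro z hz
  obtain ⟨V, hVo, hzV, -, Y, hYd, hY⟩ := exists_local_accretive_sqrt hU hA hz (hacc z hz)
  refine ((hYd.differentiableAt (hVo.mem_nhds hzV)).congr_of_eventuallyEq ?_).differentiableWithinAt
  filter_upwards [hVo.mem_nhds hzV] with x hx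
  have := (hY x hx).2.isPrincipalSqrt
  rw [(hY x hx).1] at this
  exact this.principalSqrt_eq

end PrincipalSqrt

/-! ### Weak limits of positive functionals -/

section Riesz

variable {X : Type*} [TopologicalSpace X] [CompactSpace X] [T2Space X] [MeasurableSpace X]
  [BorelSpace X]

theorem exists_measure_of_positive (L : C(X, ℝ) →ₗ[ℝ] ℝ) (hL : ∀ f : C(X, ℝ), 0 ≤ f → 0 ≤ L f) :
    ∃ σ : Measure X, IsFiniteMeasure σ ∧ ∀ f : C(X, ℝ), ∫ x, f x ∂σ = L f := by
  let L' : CompactlySupportedContinuousMap X ℝ →ₗ[ℝ] ℝ :=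
    { toFun := fun f => L f.toContinuousMap
      map_add' := fun f g => L.map_add f.toContinuousMap g.toContinuousMap
      map_smul' := fun c f => L.map_smul c f.toContinuousMap }
  let P : CompactlySupportedContinuousMap X ℝ →ₚ[ℝ] ℝ :=
    PositiveLinearMap.mk₀ L' (fun f hf => hL _ (fun x => hf x))
  refine ⟨RealRMK.rieszMeasure P, ⟨isCompact_univ.measure_lt_top⟩, fun f => ?_⟩
  exact RealRMK.integral_rieszMeasure P (CompactlySupportedContinuousMap.continuousMapEquiv f)

/-- Positivity gives `|L n f| ≤ ‖f‖ C`, and bounded sequences converge along an ultrafilter. Fixing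
one ultrafilter avoids subsequences and lets limits of different families of functionals inherit the
linear relations between them. -/
theorem exists_measure_of_bounded_functionals (U : Ultrafilter ℕ) (L : ℕ → C(X, ℝ) →ₗ[ℝ] ℝ)
    (hL : ∀ n, ∀ f : C(X, ℝ), 0 ≤ f → 0 ≤ L n f) {C : ℝ} (hC : ∀ n, L n 1 ≤ C) :
    ∃ σ : Measure X, IsFiniteMeasure σ ∧
      ∀ f : C(X, ℝ), Tendsto (fun n => L n f) U (𝓝 (∫ x, f x ∂σ)) := by
  have hb : ∀ n f, L n f ∈ Set.Icc (-(‖f‖ * C)) (‖f‖ * C) := by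
    intro n f
    have h1 : 0 ≤ L n (‖f‖ • 1 - f) := hL n _ fun x => by
      simpa using (le_abs_self _).trans (f.norm_coe_le_norm x)
    have h2 : 0 ≤ L n (‖f‖ • 1 + f) := hL n _ fun x => by
      have := (neg_le_abs _).trans (f.norm_coe_le_norm x)
      simp; linarith
    have h3 : ‖f‖ * L n 1 ≤ ‖f‖ * C := by gcongr; exact hC n
    rw [map_sub, map_smul, smul_eq_mul] at h1
    rw [map_add, map_smul, smul_eq_mul] at h2
    constructor <;> linarith
  have hlim : ∀ f, ∃ l, Tendsto (fun n => L n f) U (𝓝 l) := by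
    intro f
    obtain ⟨l, -, hl⟩ := isCompact_Icc.ultrafilter_le_nhds (U.map fun n => L n f)
      (by
        rw [le_principal_iff]
        exact Filter.mem_map.2 (univ_mem' fun n => hb n f))
    exact ⟨l, hl⟩
  choose l hl using hlim
  obtain ⟨σ, hσ, h⟩ := exists_measure_of_positive
    { toFun := l
      map_add' := fun f g => tendsto_nhds_unique (hl _) (by
        simpa using (hl f).add (hl g))
      map_smul' := fun c f => tendsto_nhds_unique (hl _) (by
        simpa using (hl f).const_mul c) }
    (fun f hf => ge_of_tendsto (hl f) (Eventually.of_forall fun n => hL n f hf))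
  exact ⟨σ, hσ, fun f => by rw [h f]; exact hl f⟩

end Riesz

/-! ### The Hausdorff moment problem -/

section Hausdorff

open Polynomial

theorem X_mul_one_sub_X_mul_derivative_bernsteinPolynomial (N j : ℕ) :
    (X : ℝ[X]) * (1 - X) * derivative (bernsteinPolynomial ℝ N j) =
      ((j : ℝ[X]) - (N : ℝ[X]) * X) * bernsteinPolynomial ℝ N j := by
  rcases lt_or_ge N j with h | h
  · simp [bernsteinPolynomial.eq_zero_of_lt ℝ h]
  obtain ⟨i, rfl⟩ := Nat.exists_eq_add_of_le h
  have h1 : (X : ℝ[X]) * derivative (X ^ j) = (j : ℝ[X]) * X ^ j := by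
    cases j with
    | zero => simp
    | succ j => rw [derivative_X_pow]; simp; ring
  have h2 : (1 - X : ℝ[X]) * derivative ((1 - X) ^ i) = -(i : ℝ[X]) * (1 - X) ^ i := by
    cases i with
    | zero => simp
    | succ i => rw [derivative_pow]; simp; ring
  rw [bernsteinPolynomial, Nat.add_sub_cancel_left, derivative_mul, derivative_mul,
    derivative_natCast, zero_mul, zero_add]
  push_cast
  linear_combination ((j + i).choose j : ℝ[X]) * (1 - X) * (1 - X) ^ i * h1 +
    ((j + i).choose j : ℝ[X]) * X * X ^ j * h2

/-- The Bernstein approximation of order `N` to the monomial `x ^ k`. -/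
noncomputable def bernsteinMonomial (N k : ℕ) : ℝ[X] :=
  ∑ j : Fin (N + 1), C (((j : ℝ) / N) ^ k) * bernsteinPolynomial ℝ N j

theorem bernsteinMonomial_zero (N : ℕ) : bernsteinMonomial N 0 = 1 := by
  rw [← bernsteinPolynomial.sum ℝ N, Finset.sum_range, bernsteinMonomial]
  simp

theorem bernsteinMonomial_succ {N : ℕ} (hN : N ≠ 0) (k : ℕ) :
    bernsteinMonomial N (k + 1) = X * bernsteinMonomial N k +
      C (1 / (N : ℝ)) * (X * (1 - X) * derivative (bernsteinMonomial N k)) := by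
  have hN' : (N : ℝ) ≠ 0 := Nat.cast_ne_zero.2 hN
  simp only [bernsteinMonomial, derivative_sum, Finset.mul_sum, ← Finset.sum_add_distrib]
  refine Finset.sum_congr rfl fun j _ => ?_
  rw [derivative_C_mul, pow_succ, C_mul, mul_left_comm (X * (1 - X)),
    X_mul_one_sub_X_mul_derivative_bernsteinPolynomial]
  have h1 : C (1 / (N : ℝ)) * (N : ℝ[X]) = 1 := by
    rw [← C_eq_natCast, ← C_mul, one_div_mul_cancel hN', C_1]
  have h2 : C ((j : ℝ) / N) = C (1 / (N : ℝ)) * ((j : ℕ) : ℝ[X]) := by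
    rw [← C_eq_natCast, ← C_mul]; congr 1; ring
  rw [h2]
  linear_combination (C (((j : ℝ) / N) ^ k) * X * bernsteinPolynomial ℝ N j) * h1

/-- No continuity of `L` is available. The recursion `B_{k+1} = X B_k + N⁻¹ X (1 - X) B_k'` allows
induction on `k` over all functionals at once: both terms are other linear functionals evaluated at
`B_k`, the second one damped by `1 / N`. -/
theorem tendsto_linearMap_bernsteinMonomial (k : ℕ) (L : ℝ[X] →ₗ[ℝ] ℝ) :
    Tendsto (fun n : ℕ => L (bernsteinMonomial (n + 1) k)) atTop (𝓝 (L (X ^ k))) := by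
  induction k generalizing L with
  | zero => simp [bernsteinMonomial_zero]
  | succ k ih =>
    have h1 := ih (L.comp (LinearMap.mulLeft ℝ X))
    have h2 := ih (L.comp ((LinearMap.mulLeft ℝ (X * (1 - X))).comp derivative))
    have h3 := h1.add (tendsto_one_div_add_atTop_nhds_zero_nat.mul h2)
    simp only [LinearMap.comp_apply, LinearMap.mulLeft_apply, zero_mul, add_zero] at h3
    rw [pow_succ']
    refine h3.congr fun n => ?_
    rw [bernsteinMonomial_succ n.succ_ne_zero, map_add, ← smul_eq_C_mul, map_smul]
    simp

/-- **Hausdorff moment theorem.** -/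
theorem exists_measure_moments (L : ℝ[X] →ₗ[ℝ] ℝ)
    (hL : ∀ i j : ℕ, 0 ≤ L (X ^ j * (1 - X) ^ i)) :
    ∃ σ : Measure unitInterval, IsFiniteMeasure σ ∧
      ∀ k : ℕ, ∫ u : unitInterval, (u : ℝ) ^ k ∂σ = L (X ^ k) := by
  have hb : ∀ N j, 0 ≤ L (bernsteinPolynomial ℝ N j) := by
    intro N j
    rw [bernsteinPolynomial, mul_assoc, ← nsmul_eq_mul, map_nsmul]
    exact nsmul_nonneg (hL _ _) _
  -- `S n f` is `L` applied to the Bernstein polynomial of `f` of order `n + 1`; it is positive on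
  -- all continuous functions although `L` is defined on polynomials only.
  let S : ℕ → C(unitInterval, ℝ) →ₗ[ℝ] ℝ := fun n =>
    { toFun := fun f => ∑ j : Fin (n + 1 + 1),
        f (bernstein.z j) * L (bernsteinPolynomial ℝ (n + 1) j)
      map_add' := fun f g => by simp [add_mul, Finset.sum_add_distrib]
      map_smul' := fun c f => by simp [Finset.mul_sum, mul_assoc] }
  have hS : ∀ n f, S n f = ∑ j : Fin (n + 1 + 1),
        f (bernstein.z j) * L (bernsteinPolynomial ℝ (n + 1) j) := fun n f => rfl
  have hSk : ∀ n k, S n ⟨fun u => (u : ℝ) ^ k, by fun_prop⟩ = L (bernsteinMonomial (n + 1) k) := by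
    intro n k
    rw [hS, bernsteinMonomial, map_sum]
    refine Finset.sum_congr rfl fun j _ => ?_
    rw [← smul_eq_C_mul, map_smul, smul_eq_mul]
    rfl
  obtain ⟨σ, hσ, h⟩ := exists_measure_of_bounded_functionals (Filter.hyperfilter ℕ) S
    (fun n f hf => by
      rw [hS]; exact Finset.sum_nonneg fun j _ => mul_nonneg (hf _) (hb _ _)) (C := L 1) (by
      intro n
      have := hSk n 0
      rw [bernsteinMonomial_zero] at this
      rw [← this]
      simp [hS])
  refine ⟨σ, hσ, fun k => ?_⟩
  have h1 := h ⟨fun u => (u : ℝ) ^ k, by fun_prop⟩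
  simp only [hSk] at h1
  exact tendsto_nhds_unique h1
    ((tendsto_linearMap_bernsteinMonomial k L).mono_left Nat.hyperfilter_le_atTop)

end Hausdorff

/-! ### Completely monotone functions and their Gamma moments -/

section LICM

/-- The Gamma density `t ^ N / N! * exp (-t)`. -/
noncomputable def gammaWeight (N : ℕ) (t : ℝ) : ℝ := t ^ N / N.factorial * Real.exp (-t)

theorem continuous_gammaWeight (N : ℕ) : Continuous (gammaWeight N) := by
  unfold gammaWeight; fun_prop

theorem gammaWeight_nonneg (N : ℕ) {t : ℝ} (ht : 0 ≤ t) : 0 ≤ gammaWeight N t := by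
  unfold gammaWeight; positivity

theorem gammaWeight_le (N : ℕ) {t : ℝ} (ht : 0 ≤ t) :
    gammaWeight N t ≤ 2 ^ N * Real.exp (-(1 / 2) * t) := by
  have h := Real.pow_div_factorial_le_exp (t / 2) (by positivity) N
  have h1 : t ^ N / N.factorial = 2 ^ N * ((t / 2) ^ N / N.factorial) := by
    rw [div_pow]; field_simp
  calc gammaWeight N t ≤ 2 ^ N * Real.exp (t / 2) * Real.exp (-t) := by
        rw [gammaWeight, h1]; gcongr
    _ = _ := by rw [mul_assoc, ← Real.exp_add]; ring_nf

theorem hasDerivAt_gammaWeight_succ (N : ℕ) (t : ℝ) :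
    HasDerivAt (gammaWeight (N + 1)) (gammaWeight N t - gammaWeight (N + 1) t) t := by
  have h1 : HasDerivAt (fun t : ℝ => t ^ (N + 1) / (N + 1).factorial)
      (t ^ N / N.factorial) t := by
    convert! (hasDerivAt_pow (N + 1) t).div_const ((N + 1).factorial : ℝ) using 1
    rw [Nat.factorial_succ]; push_cast; field_simp
  have h2 : HasDerivAt (fun t : ℝ => Real.exp (-t)) (-Real.exp (-t)) t := by
    simpa using (hasDerivAt_neg t).exp
  convert! h1.mul h2 using 1
  simp only [gammaWeight]; ring

variable {f : ℝ → ℝ}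

theorem IsLICM.hasDerivAt (hf : IsLICM f) (m : ℕ) {t : ℝ} (ht : 0 < t) :
    HasDerivAt (fun t => (-1 : ℝ) ^ m * iteratedDeriv m f t)
      (-((-1 : ℝ) ^ (m + 1) * iteratedDeriv (m + 1) f t)) t := by
  have h1 : DifferentiableOn ℝ (iteratedDerivWithin m f (Set.Ioi 0)) (Set.Ioi 0) :=
    hf.smooth.differentiableOn_iteratedDerivWithin (by exact_mod_cast ENat.natCast_lt_top m)
      (uniqueDiffOn_Ioi 0)
  have h2 : DifferentiableAt ℝ (iteratedDeriv m f) t := by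
    refine (h1.differentiableAt (Ioi_mem_nhds ht)).congr_of_eventuallyEq ?_
    filter_upwards [Ioi_mem_nhds ht] with s hs
    exact (iteratedDerivWithin_of_isOpen isOpen_Ioi hs).symm
  convert! h2.hasDerivAt.const_mul ((-1 : ℝ) ^ m) using 1
  rw [iteratedDeriv_succ]; ring

theorem IsLICM.antitoneOn (hf : IsLICM f) (m : ℕ) :
    AntitoneOn (fun t => (-1 : ℝ) ^ m * iteratedDeriv m f t) (Set.Ioi 0) := by
  refine antitoneOn_of_deriv_nonpos (convex_Ioi 0)
    (fun t ht => (hf.hasDerivAt m ht).continuousAt.continuousWithinAt)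
    (fun t ht => (hf.hasDerivAt m (interior_subset ht)).differentiableAt.differentiableWithinAt)
    fun t ht => ?_
  rw [(hf.hasDerivAt m (interior_subset ht)).deriv, neg_nonpos]
  exact hf.sign _ _ (interior_subset ht)

theorem IsLICM.nonneg (hf : IsLICM f) {t : ℝ} (ht : 0 < t) : 0 ≤ f t := by
  simpa using hf.sign 0 t ht

theorem IsLICM.antitone (hf : IsLICM f) : AntitoneOn f (Set.Ioi 0) := by
  simpa using hf.antitoneOn 0

theorem IsLICM.continuousOn (hf : IsLICM f) : ContinuousOn f (Set.Ioi 0) := hf.smooth.continuousOn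

theorem integrableOn_exp_neg_mul {b : ℝ} (hb : 0 < b) (a : ℝ) :
    IntegrableOn (fun t : ℝ => Real.exp (-b * t)) (Set.Ioi a) :=
  integrableOn_exp_mul_Ioi (by linarith) a

/-- Near `0` this is local integrability; beyond `1` the decreasing `f` is bounded by `f 1`. -/
theorem IsLICM.integrableOn_exp_mul (hf : IsLICM f) {b : ℝ} (hb : 0 < b) :
    IntegrableOn (fun t => Real.exp (-b * t) * f t) (Set.Ioi 0) := by
  rw [← Set.Ioc_union_Ioi_eq_Ioi (zero_le_one' ℝ), integrableOn_union]
  constructor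
  · have h1 : IntegrableOn f (Set.Icc 0 1) :=
      hf.locInt.integrableOn_compact_subset Set.Icc_subset_Ici_self isCompact_Icc
    refine (h1.mono_set Set.Ioc_subset_Icc_self).bdd_mul (c := 1) (by fun_prop) ?_
    filter_upwards [ae_restrict_mem measurableSet_Ioc] with t ht
    rw [Real.norm_of_nonneg (Real.exp_pos _).le, Real.exp_le_one_iff]
    nlinarith [ht.1]
  · refine ((integrableOn_exp_neg_mul hb 1).mul_const (f 1)).mono' ?_ ?_
    · refine ContinuousOn.aestronglyMeasurable ?_ measurableSet_Ioi
      exact (by fun_prop : Continuous fun t : ℝ => Real.exp (-b * t)).continuousOn.mul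
        (hf.continuousOn.mono (Set.Ioi_subset_Ioi zero_le_one))
    · filter_upwards [ae_restrict_mem measurableSet_Ioi] with t ht
      have ht0 : (0 : ℝ) < t := zero_lt_one.trans ht
      rw [Real.norm_of_nonneg (mul_nonneg (Real.exp_pos _).le (hf.nonneg ht0))]
      gcongr
      exact hf.antitone (Set.mem_Ioi.2 one_pos) ht0 (le_of_lt ht)

theorem IsLICM.integrableOn_cexp_mul (hf : IsLICM f) {p : ℂ} (hp : 0 < p.re) :
    IntegrableOn (fun t : ℝ => Complex.exp (-p * t) * (f t : ℂ)) (Set.Ioi 0) := by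
  refine (hf.integrableOn_exp_mul hp).mono' ?_ ?_
  · refine ContinuousOn.aestronglyMeasurable ?_ measurableSet_Ioi
    exact (by fun_prop : Continuous fun t : ℝ => Complex.exp (-p * t)).continuousOn.mul
      (Complex.continuous_ofReal.comp_continuousOn hf.continuousOn)
  · filter_upwards [ae_restrict_mem measurableSet_Ioi] with t ht
    rw [norm_mul, Complex.norm_exp, Complex.norm_real, Real.norm_of_nonneg (hf.nonneg ht)]
    simp

theorem IsLICM.integrableOn_gammaWeight_mul (hf : IsLICM f) (N : ℕ) :
    IntegrableOn (fun t => gammaWeight N t * f t) (Set.Ioi 0) := by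
  refine ((hf.integrableOn_exp_mul one_half_pos).const_mul (2 ^ N)).mono' ?_ ?_
  · exact ((continuous_gammaWeight N).continuousOn.mul hf.continuousOn).aestronglyMeasurable
      measurableSet_Ioi
  · filter_upwards [ae_restrict_mem measurableSet_Ioi] with t ht
    have ht' : (0 : ℝ) < t := ht
    rw [Real.norm_of_nonneg (mul_nonneg (gammaWeight_nonneg N ht'.le) (hf.nonneg ht)), ← mul_assoc]
    exact mul_le_mul_of_nonneg_right (gammaWeight_le N ht'.le) (hf.nonneg ht)

theorem IsLICM.integrableOn_shift (hf : IsLICM f) (N m : ℕ) {ε : ℝ} (hε : 0 < ε) :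
    IntegrableOn (fun t => gammaWeight N t * ((-1 : ℝ) ^ m * iteratedDeriv m f (t + ε)))
      (Set.Ioi 0) := by
  refine (((integrableOn_exp_neg_mul (one_half_pos (α := ℝ)) 0).const_mul (2 ^ N)).mul_const
    ((-1 : ℝ) ^ m * iteratedDeriv m f ε)).mono' ?_ ?_
  · refine ContinuousOn.aestronglyMeasurable ?_ measurableSet_Ioi
    refine (continuous_gammaWeight N).continuousOn.mul ?_
    have h : ContinuousOn (fun t => (-1 : ℝ) ^ m * iteratedDeriv m f t) (Set.Ioi 0) :=
      fun t ht => (hf.hasDerivAt m ht).continuousAt.continuousWithinAt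
    exact h.comp (by fun_prop) fun t ht => add_pos (Set.mem_Ioi.1 ht) hε
  · filter_upwards [ae_restrict_mem measurableSet_Ioi] with t ht
    have ht' : (0 : ℝ) < t := ht
    rw [Real.norm_of_nonneg (mul_nonneg (gammaWeight_nonneg N ht'.le) (hf.sign m _ (by positivity)))]
    refine mul_le_mul (gammaWeight_le N ht'.le) ?_ (hf.sign m _ (by positivity)) (by positivity)
    exact hf.antitoneOn m (Set.mem_Ioi.2 hε) (Set.mem_Ioi.2 (by positivity)) (by linarith)

/-- Integration by parts from `γ_{N+1}' = γ_N - γ_{N+1}`. The boundary term at `0` vanishes because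
the weight has index `N + 1` and the shift by `ε` keeps the derivatives of `f` bounded there. -/
theorem IsLICM.integral_shift_sub (hf : IsLICM f) (N m : ℕ) {ε : ℝ} (hε : 0 < ε) :
    (∫ t in Set.Ioi 0, gammaWeight N t * ((-1 : ℝ) ^ m * iteratedDeriv m f (t + ε))) -
      (∫ t in Set.Ioi 0, gammaWeight (N + 1) t * ((-1 : ℝ) ^ m * iteratedDeriv m f (t + ε))) =
    ∫ t in Set.Ioi 0,
      gammaWeight (N + 1) t * ((-1 : ℝ) ^ (m + 1) * iteratedDeriv (m + 1) f (t + ε)) := by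
  have i1 := hf.integrableOn_shift N m hε
  have i2 := hf.integrableOn_shift (N + 1) m hε
  have i3 := hf.integrableOn_shift (N + 1) (m + 1) hε
  set g := fun t => (-1 : ℝ) ^ m * iteratedDeriv m f t with hg
  set g' := fun t => (-1 : ℝ) ^ (m + 1) * iteratedDeriv (m + 1) f t with hg'
  have hd : ∀ t, 0 ≤ t → HasDerivAt (fun t => gammaWeight (N + 1) t * g (t + ε))
      (gammaWeight N t * g (t + ε) - gammaWeight (N + 1) t * g (t + ε) -
        gammaWeight (N + 1) t * g' (t + ε)) t := by
    intro t ht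
    have h1 : HasDerivAt (fun t => g (t + ε)) (-g' (t + ε)) t :=
      (hf.hasDerivAt m (by positivity : 0 < t + ε)).comp_add_const t ε
    convert! (hasDerivAt_gammaWeight_succ N t).mul h1 using 1
    ring
  have hlim : Tendsto (fun t => gammaWeight (N + 1) t * g (t + ε)) atTop (𝓝 0) := by
    have h1 : Tendsto (fun t : ℝ => 2 ^ (N + 1) * Real.exp (-(1 / 2) * t) * g ε) atTop (𝓝 0) := by
      have h2 : Tendsto (fun t : ℝ => Real.exp (-(1 / 2) * t)) atTop (𝓝 0) :=
        Real.tendsto_exp_atBot.comp (tendsto_id.const_mul_atTop_of_neg (by norm_num))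
      simpa using (h2.const_mul (2 ^ (N + 1))).mul_const (g ε)
    refine squeeze_zero' ?_ ?_ h1
    · filter_upwards [eventually_ge_atTop 0] with t ht
      exact mul_nonneg (gammaWeight_nonneg _ ht) (hf.sign m _ (by positivity))
    · filter_upwards [eventually_ge_atTop 0] with t ht
      refine mul_le_mul (gammaWeight_le _ ht) ?_ (hf.sign m _ (by positivity)) (by positivity)
      exact hf.antitoneOn m (Set.mem_Ioi.2 hε) (Set.mem_Ioi.2 (by positivity)) (by linarith)
  have h := integral_Ioi_of_hasDerivAt_of_tendsto' (fun t ht => hd t ht) ((i1.sub i2).sub i3) hlim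
  have h0 : gammaWeight (N + 1) 0 = 0 := by simp [gammaWeight]
  rw [integral_sub (f := fun t => gammaWeight N t * g (t + ε) - gammaWeight (N + 1) t * g (t + ε))
    (i1.sub i2) i3, integral_sub i1 i2, h0] at h
  linarith

/-- The linear functional on polynomials with prescribed moments. -/
noncomputable def momentFunctional (m : ℕ → ℝ) : Polynomial ℝ →ₗ[ℝ] ℝ :=
  Polynomial.lsum fun k => m k • LinearMap.id

theorem momentFunctional_X_pow (m : ℕ → ℝ) (k : ℕ) :
    momentFunctional m (Polynomial.X ^ k) = m k := by
  rw [momentFunctional, Polynomial.lsum_apply, Polynomial.X_pow_eq_monomial,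
    Polynomial.sum_monomial_index] <;> simp

theorem tendsto_momentFunctional {m : ℕ → ℕ → ℝ} {l : ℕ → ℝ}
    (h : ∀ k, Tendsto (fun n => m n k) atTop (𝓝 (l k))) (p : Polynomial ℝ) :
    Tendsto (fun n => momentFunctional (m n) p) atTop (𝓝 (momentFunctional l p)) := by
  simp only [momentFunctional, Polynomial.lsum_apply, Polynomial.sum]
  exact tendsto_finsetSum _ fun k _ => (h k).mul_const _

/-- A factor `1 - X` takes the difference of consecutive moments, which is one integration by parts,
hence one more derivative with its sign. Complete monotonicity thereby becomes exactly the
positivity condition of Hausdorff. -/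
theorem IsLICM.momentFunctional_shift (hf : IsLICM f) {ε : ℝ} (hε : 0 < ε) (i j : ℕ) :
    momentFunctional (fun k => ∫ t in Set.Ioi 0, gammaWeight k t * f (t + ε))
      (Polynomial.X ^ j * (1 - Polynomial.X) ^ i) =
    ∫ t in Set.Ioi 0, gammaWeight (i + j) t * ((-1 : ℝ) ^ i * iteratedDeriv i f (t + ε)) := by
  induction i generalizing j with
  | zero => simp [momentFunctional_X_pow]
  | succ i ih =>
    have h1 : (Polynomial.X ^ j * (1 - Polynomial.X) ^ (i + 1) : Polynomial ℝ) =
        Polynomial.X ^ j * (1 - Polynomial.X) ^ i -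
          Polynomial.X ^ (j + 1) * (1 - Polynomial.X) ^ i := by ring
    rw [h1, map_sub, ih, ih, ← add_assoc, hf.integral_shift_sub _ _ hε]
    rw [add_right_comm]

/-- Removes the shift: since `f` is decreasing, the unshifted integrand dominates. -/
theorem IsLICM.tendsto_integral_shift (hf : IsLICM f) (k : ℕ) :
    Tendsto (fun n : ℕ => ∫ t in Set.Ioi 0, gammaWeight k t * f (t + 1 / ((n : ℝ) + 1))) atTop
      (𝓝 (∫ t in Set.Ioi 0, gammaWeight k t * f t)) := by
  refine tendsto_integral_of_dominated_convergence (fun t => gammaWeight k t * f t) ?_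
    (hf.integrableOn_gammaWeight_mul k) ?_ ?_
  · intro n
    have := (hf.integrableOn_shift k 0 (ε := 1 / ((n : ℝ) + 1)) (by positivity)).aestronglyMeasurable
    simpa using this
  · intro n
    filter_upwards [ae_restrict_mem measurableSet_Ioi] with t ht
    have ht' : (0 : ℝ) < t := ht
    have h2 : 0 < t + 1 / ((n : ℝ) + 1) := by positivity
    rw [Real.norm_of_nonneg (mul_nonneg (gammaWeight_nonneg k ht'.le) (hf.nonneg h2))]
    refine mul_le_mul_of_nonneg_left ?_ (gammaWeight_nonneg k ht'.le)
    exact hf.antitone ht (Set.mem_Ioi.2 h2) (le_add_of_nonneg_right (by positivity))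
  · filter_upwards [ae_restrict_mem measurableSet_Ioi] with t ht
    refine Tendsto.const_mul _ ?_
    have h1 : Tendsto (fun n : ℕ => t + 1 / ((n : ℝ) + 1)) atTop (𝓝 t) := by
      simpa using tendsto_one_div_add_atTop_nhds_zero_nat.const_add t
    exact ((hf.continuousOn.continuousAt (Ioi_mem_nhds ht)).tendsto).comp h1

theorem IsLICM.exists_measure_moments (hf : IsLICM f) :
    ∃ σ : Measure unitInterval, IsFiniteMeasure σ ∧ ∀ k : ℕ,
      ∫ u : unitInterval, (u : ℝ) ^ k ∂σ = ∫ t in Set.Ioi 0, gammaWeight k t * f t := by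
  obtain ⟨σ, hσ, h⟩ := Viscoelastic.exists_measure_moments
    (momentFunctional fun k => ∫ t in Set.Ioi 0, gammaWeight k t * f t) (by
      intro i j
      refine ge_of_tendsto (tendsto_momentFunctional (fun k => hf.tendsto_integral_shift k) _)
        (Eventually.of_forall fun n => ?_)
      rw [hf.momentFunctional_shift (by positivity)]
      refine setIntegral_nonneg measurableSet_Ioi fun t ht => ?_
      have ht' : (0 : ℝ) < t := ht
      exact mul_nonneg (gammaWeight_nonneg _ ht'.le) (hf.sign _ _ (by positivity)))
  exact ⟨σ, hσ, fun k => by rw [h, momentFunctional_X_pow]⟩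

end LICM

/-! ### The Stieltjes kernel on the unit interval -/

section Kernel

/-- The Stieltjes kernel `(1 + r) / (z + r)` in the variable `u = 1 / (1 + r) ∈ [0, 1]`. -/
noncomputable def stieltjesKernel (z : ℂ) (u : unitInterval) : ℂ := (1 + (u : ℂ) * (z - 1))⁻¹

theorem one_add_mul_mem_slitPlane {z : ℂ} (hz : z ∈ Complex.slitPlane) (u : unitInterval) :
    1 + (u : ℂ) * (z - 1) ∈ Complex.slitPlane := by
  have h := Complex.starConvex_one_slitPlane hz (a := 1 - (u : ℝ)) (b := (u : ℝ))
    (sub_nonneg.2 u.2.2) u.2.1 (by ring)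
  convert! h using 1
  rw [Complex.real_smul, Complex.real_smul]
  push_cast; ring

theorem one_add_mul_ne_zero {z : ℂ} (hz : z ∈ Complex.slitPlane) (u : unitInterval) :
    1 + (u : ℂ) * (z - 1) ≠ 0 :=
  Complex.slitPlane_ne_zero (one_add_mul_mem_slitPlane hz u)

theorem continuous_stieltjesKernel {z : ℂ} (hz : z ∈ Complex.slitPlane) :
    Continuous (stieltjesKernel z) := by
  unfold stieltjesKernel
  exact Continuous.inv₀ (by fun_prop) (one_add_mul_ne_zero hz)

theorem integrable_stieltjesKernel (σ : Measure unitInterval) [IsFiniteMeasure σ] {z : ℂ}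
    (hz : z ∈ Complex.slitPlane) : Integrable (stieltjesKernel z) σ :=
  (continuous_stieltjesKernel hz).integrable_of_hasCompactSupport
    (HasCompactSupport.of_compactSpace _)

theorem differentiableOn_integral_stieltjesKernel (σ : Measure unitInterval) [IsFiniteMeasure σ] :
    DifferentiableOn ℂ (fun z => ∫ u, stieltjesKernel z u ∂σ) Complex.slitPlane := by
  intro z hz
  obtain ⟨r, hr, hball⟩ := Metric.nhds_basis_closedBall.mem_iff.1
    (Complex.isOpen_slitPlane.mem_nhds hz)
  have hcont : ContinuousOn (fun q : ℂ × unitInterval => -(q.2 : ℂ) / (1 + (q.2 : ℂ) * (q.1 - 1)) ^ 2)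
      (Metric.closedBall z r ×ˢ Set.univ) := by
    refine ContinuousOn.div (by fun_prop) (by fun_prop) fun q hq => ?_
    exact pow_ne_zero 2 (one_add_mul_ne_zero (hball hq.1) q.2)
  obtain ⟨C, hC⟩ := ((isCompact_closedBall z r).prod isCompact_univ).exists_bound_of_continuousOn
    hcont
  refine (hasDerivAt_integral_of_dominated_loc_of_deriv_le (bound := fun _ => C)
    (F' := fun z u => -(u : ℂ) / (1 + (u : ℂ) * (z - 1)) ^ 2)
    (Metric.closedBall_mem_nhds z hr) ?_ (integrable_stieltjesKernel σ hz) ?_ ?_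
    (integrable_const C) ?_).2.differentiableAt.differentiableWithinAt
  · filter_upwards [Complex.isOpen_slitPlane.mem_nhds hz] with w hw
    exact (continuous_stieltjesKernel hw).aestronglyMeasurable
  · refine Continuous.aestronglyMeasurable ?_
    exact Continuous.div (by fun_prop) (by fun_prop) fun u => pow_ne_zero 2 (one_add_mul_ne_zero hz u)
  · exact ae_of_all _ fun u w hw => hC (w, u) ⟨hw, trivial⟩
  · refine ae_of_all _ fun u w hw => ?_
    have h1 : HasDerivAt (fun w : ℂ => 1 + (u : ℂ) * (w - 1)) (u : ℂ) w := by
      simpa using (((hasDerivAt_id w).sub_const 1).const_mul (u : ℂ)).const_add 1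
    exact h1.inv (one_add_mul_ne_zero (hball hw) u)

/-- The geometric series of the kernel in powers of `1 - z`: the moments of `σ` are, up to sign, its
Taylor coefficients at `z = 1`. -/
theorem hasSum_integral_stieltjesKernel (σ : Measure unitInterval) [IsFiniteMeasure σ] {z : ℂ}
    (hz : ‖z - 1‖ < 1) :
    HasSum (fun k : ℕ => (1 - z) ^ k * ((∫ u : unitInterval, (u : ℝ) ^ k ∂σ : ℝ) : ℂ))
      (∫ u, stieltjesKernel z u ∂σ) := by
  have hi : ∀ k : ℕ, Integrable (fun u : unitInterval => (1 - z) ^ k * (((u : ℝ) ^ k : ℝ) : ℂ)) σ :=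
    fun k => (by fun_prop : Continuous _).integrable_of_hasCompactSupport
      (HasCompactSupport.of_compactSpace _)
  have h := hasSum_integral_of_summable_integral_norm hi ?_
  · convert! h using 2 with k
    · rw [integral_const_mul, integral_complex_ofReal]
    · ext u
      have h1 : ‖(1 - z) * (u : ℂ)‖ < 1 := by
        rw [norm_mul, norm_sub_rev]
        have h2 : ‖(u : ℂ)‖ ≤ 1 := by
          rw [Complex.norm_real, Real.norm_of_nonneg u.2.1]; exact u.2.2
        calc ‖z - 1‖ * ‖(u : ℂ)‖ ≤ ‖z - 1‖ * 1 := by gcongr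
          _ < 1 := by simpa using hz
      have h3 := tsum_geometric_of_norm_lt_one h1
      simp only [mul_pow] at h3
      push_cast
      rw [h3, stieltjesKernel]
      congr 1; ring
  · refine Summable.of_nonneg_of_le (fun k => integral_nonneg fun u => norm_nonneg _) (fun k => ?_)
      ((summable_geometric_of_lt_one (norm_nonneg _) hz).mul_right (σ.real Set.univ))
    rw [← smul_eq_mul, smul_eq_mul, mul_comm, ← smul_eq_mul, ← integral_const]
    refine integral_mono (hi k).norm (integrable_const _) fun u => ?_
    simp only [norm_mul, norm_pow, norm_sub_rev 1 z, Complex.norm_real]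
    refine mul_le_of_le_one_right (by positivity) (pow_le_one₀ (norm_nonneg _) ?_)
    rw [Real.norm_of_nonneg u.2.1]; exact u.2.2

end Kernel

/-! ### The Laplace transform as a Stieltjes function -/

section LICM

variable {f : ℝ → ℝ}

/-- Expanding `exp ((1 - z) t)` against `exp (-t)` makes the Gamma moments the coefficients at `z =
1`. Their uniform bound `C` justifies summing under the integral in the whole disc. -/
theorem IsLICM.hasSum_laplace (hf : IsLICM f) {z : ℂ} (hz : ‖z - 1‖ < 1) {C : ℝ}
    (hC : ∀ k, ∫ t in Set.Ioi 0, gammaWeight k t * f t ≤ C) :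
    HasSum (fun k : ℕ => (1 - z) ^ k * ((∫ t in Set.Ioi 0, gammaWeight k t * f t : ℝ) : ℂ))
      (∫ t in Set.Ioi (0 : ℝ), Complex.exp (-z * t) * (f t : ℂ)) := by
  have hi : ∀ k : ℕ, IntegrableOn (fun t => (1 - z) ^ k * ((gammaWeight k t * f t : ℝ) : ℂ))
      (Set.Ioi 0) := fun k => ((hf.integrableOn_gammaWeight_mul k).ofReal).const_mul _
  have h := hasSum_integral_of_summable_integral_norm hi ?_
  · convert! h using 2 with k
    · rw [integral_const_mul, integral_complex_ofReal]
    · ext t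
      have h3 := (NormedSpace.expSeries_div_hasSum_exp ((1 - z) * (t : ℂ))).mul_right
        (Complex.exp (-t) * (f t : ℂ))
      rw [← Complex.exp_eq_exp_ℂ] at h3
      have h4 : Complex.exp ((1 - z) * t) * (Complex.exp (-t) * (f t : ℂ)) =
          Complex.exp (-z * t) * (f t : ℂ) := by
        rw [← mul_assoc, ← Complex.exp_add]; ring_nf
      rw [← h4, ← h3.tsum_eq]
      congr 1; ext k
      simp only [gammaWeight]
      push_cast
      rw [mul_pow]; ring
  · refine Summable.of_nonneg_of_le (fun k => integral_nonneg fun u => norm_nonneg _) (fun k => ?_)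
      ((summable_geometric_of_lt_one (norm_nonneg _) hz).mul_right C)
    have h1 : ∫ t in Set.Ioi 0, ‖(1 - z) ^ k * ((gammaWeight k t * f t : ℝ) : ℂ)‖ =
        ‖z - 1‖ ^ k * ∫ t in Set.Ioi 0, gammaWeight k t * f t := by
      rw [← integral_const_mul]
      refine setIntegral_congr_fun measurableSet_Ioi fun t ht => ?_
      have ht' : (0 : ℝ) < t := ht
      simp only [norm_mul, norm_pow, norm_sub_rev 1 z, Complex.norm_real]
      rw [Real.norm_of_nonneg (gammaWeight_nonneg k ht'.le), Real.norm_of_nonneg (hf.nonneg ht')]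
    rw [h1]
    gcongr
    exact hC k

theorem IsLICM.differentiableOn_laplace (hf : IsLICM f) :
    DifferentiableOn ℂ (fun p : ℂ => ∫ t in Set.Ioi (0 : ℝ), Complex.exp (-p * t) * (f t : ℂ))
      {p | 0 < p.re} := by
  intro p hp
  have hp' : 0 < p.re := hp
  refine (hasDerivAt_integral_of_dominated_loc_of_deriv_le
    (μ := volume.restrict (Set.Ioi (0 : ℝ)))
    (F := fun (q : ℂ) (t : ℝ) => Complex.exp (-q * t) * (f t : ℂ))
    (bound := fun t => (4 / p.re) * (Real.exp (-(p.re / 4) * t) * f t))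
    (F' := fun (q : ℂ) (t : ℝ) => (-(t : ℂ)) * Complex.exp (-q * t) * (f t : ℂ))
    -- On this ball `Re q ≥ Re p / 2`. One half of that decay absorbs the factor `t`, the other half
    -- stays with `f`, whence `Re p / 4` in the bound.
    (Metric.ball_mem_nhds p (half_pos hp')) ?_ (hf.integrableOn_cexp_mul hp) ?_ ?_
    ((hf.integrableOn_exp_mul (by positivity)).const_mul _) ?_).2.differentiableAt.differentiableWithinAt
  · filter_upwards [(isOpen_lt continuous_const Complex.continuous_re).mem_nhds hp] with q hq
    exact (hf.integrableOn_cexp_mul hq).aestronglyMeasurable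
  · refine ContinuousOn.aestronglyMeasurable ?_ measurableSet_Ioi
    exact (by fun_prop : Continuous fun t : ℝ => (-(t : ℂ)) * Complex.exp (-p * t)).continuousOn.mul
      (Complex.continuous_ofReal.comp_continuousOn hf.continuousOn)
  · filter_upwards [ae_restrict_mem measurableSet_Ioi] with t ht q hq
    have ht' : (0 : ℝ) < t := ht
    have h1 : p.re / 2 ≤ q.re := by
      have := (Complex.abs_re_le_norm (q - p)).trans (mem_ball_iff_norm.1 hq).le
      rw [Complex.sub_re, abs_le] at this
      linarith [this.1]
    rw [norm_mul, norm_mul, norm_neg, Complex.norm_real, Complex.norm_real, Complex.norm_exp,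
      Real.norm_of_nonneg ht'.le, Real.norm_of_nonneg (hf.nonneg ht'), ← mul_assoc]
    refine mul_le_mul_of_nonneg_right ?_ (hf.nonneg ht')
    have h2 : p.re / 4 * t ≤ Real.exp (p.re / 4 * t) :=
      (by linarith [Real.add_one_le_exp (p.re / 4 * t)])
    have h3 : (-q * t).re ≤ -(p.re / 4) * t + -(p.re / 4 * t) := by
      simp; nlinarith
    calc t * Real.exp (-q * t).re
        ≤ t * (Real.exp (-(p.re / 4) * t) * Real.exp (-(p.re / 4 * t))) := by
          rw [← Real.exp_add]; gcongr
      _ = (4 / p.re) * Real.exp (-(p.re / 4) * t) *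
          ((p.re / 4 * t) * Real.exp (-(p.re / 4 * t))) := by field_simp
      _ ≤ (4 / p.re) * Real.exp (-(p.re / 4) * t) * 1 := by
          gcongr
          rw [Real.exp_neg, ← div_eq_mul_inv, div_le_one (Real.exp_pos _)]
          exact h2
      _ = _ := mul_one _
  · refine ae_of_all _ fun t q _ => ?_
    have h1 : HasDerivAt (fun q : ℂ => -q * (t : ℂ)) (-(t : ℂ)) q := by
      simpa using (hasDerivAt_neg q).mul_const (t : ℂ)
    convert! h1.cexp.mul_const (f t : ℂ) using 1
    ring

/-- The Laplace transform of a locally integrable completely monotone function is a Stieltjes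
function. -/
theorem IsLICM.exists_laplace_eq (hf : IsLICM f) :
    ∃ σ : Measure unitInterval, IsFiniteMeasure σ ∧ ∀ p : ℂ, 0 < p.re →
      ∫ t in Set.Ioi (0 : ℝ), Complex.exp (-p * t) * (f t : ℂ) = ∫ u, stieltjesKernel p u ∂σ := by
  obtain ⟨σ, hσ, hm⟩ := hf.exists_measure_moments
  refine ⟨σ, hσ, ?_⟩
  have hopen : IsOpen {p : ℂ | 0 < p.re} := isOpen_lt continuous_const Complex.continuous_re
  have hC : ∀ k, ∫ t in Set.Ioi 0, gammaWeight k t * f t ≤ σ.real Set.univ := by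
    intro k
    rw [← hm k]
    calc ∫ u : unitInterval, (u : ℝ) ^ k ∂σ ≤ ∫ _ : unitInterval, (1 : ℝ) ∂σ := by
          refine integral_mono ((by fun_prop : Continuous _).integrable_of_hasCompactSupport
            (HasCompactSupport.of_compactSpace _)) (integrable_const _) fun u => ?_
          exact pow_le_one₀ u.2.1 u.2.2
      _ = _ := by simp
  -- Both sides are analytic for `Re p > 0` and have the same power series at `1`.
  have h := AnalyticOnNhd.eqOn_of_preconnected_of_eventuallyEq
    (hf.differentiableOn_laplace.analyticOnNhd hopen)
    (((differentiableOn_integral_stieltjesKernel σ).mono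
      fun p hp => Or.inl hp).analyticOnNhd hopen)
    (convex_halfSpace_re_gt 0).isPreconnected (z₀ := 1) (by simp) ?_
  · exact fun p hp => h hp
  · filter_upwards [Metric.ball_mem_nhds (1 : ℂ) one_pos] with z hz
    have hz' : ‖z - 1‖ < 1 := mem_ball_iff_norm.1 hz
    refine (hf.hasSum_laplace hz' hC).unique ?_
    simpa only [hm] using hasSum_integral_stieltjesKernel σ hz'

end LICM

/-! ### Quadratic forms on real vectors and polarization -/

section QuadraticForms

variable {ι : Type*} [Fintype ι]

/-- The bilinear quadratic form of a complex matrix on real vectors. -/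
noncomputable def realForm (A : Matrix ι ι ℂ) (a : ι → ℝ) : ℂ :=
  ∑ i, ∑ j, (a i : ℂ) * A i j * (a j : ℂ)

theorem realForm_smul (c : ℂ) (A : Matrix ι ι ℂ) (a : ι → ℝ) :
    realForm (c • A) a = c * realForm A a := by
  simp only [realForm, Finset.mul_sum, Matrix.smul_apply, smul_eq_mul]
  exact Finset.sum_congr rfl fun i _ => Finset.sum_congr rfl fun j _ => by ring

/-- For a complex symmetric matrix the mixed terms between real and imaginary parts of `v` cancel.
Accretivity can therefore be tested on real vectors, where scalar Stieltjes theory applies. -/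
theorem star_dotProduct_mulVec_of_isSymm {A : Matrix ι ι ℂ} (hA : A.IsSymm) (v : ι → ℂ) :
    star v ⬝ᵥ A.mulVec v =
      realForm A (fun i => (v i).re) + realForm A (fun i => (v i).im) := by
  have h1 : star v ⬝ᵥ A.mulVec v = ∑ i, ∑ j, star (v i) * A i j * v j := by
    simp only [dotProduct, Matrix.mulVec, Finset.mul_sum, Pi.star_apply, mul_assoc]
  have h2 : ∑ i, ∑ j, ((v i).re * A i j * (v j).im : ℂ) =
      ∑ i, ∑ j, ((v i).im * A i j * (v j).re : ℂ) := by
    rw [Finset.sum_comm]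
    refine Finset.sum_congr rfl fun i _ => Finset.sum_congr rfl fun j _ => ?_
    rw [hA.apply i j]; ring
  have h3 : ∀ i j, star (v i) * A i j * v j =
      ((v i).re * A i j * (v j).re : ℂ) + ((v i).im * A i j * (v j).im : ℂ) +
        Complex.I * (((v i).re * A i j * (v j).im : ℂ) - ((v i).im * A i j * (v j).re : ℂ)) := by
    intro i j
    have h4 : star (v i) = (v i).re - Complex.I * (v i).im := by
      apply Complex.ext <;> simp
    have h5 : v j = (v j).re + Complex.I * (v j).im := by
      apply Complex.ext <;> simp
    rw [h4]
    nth_rewrite 1 [h5]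
    linear_combination -((v i).im * A i j * (v j).im : ℂ) * Complex.I_sq
  rw [h1]
  simp only [h3, Finset.sum_add_distrib, ← Finset.mul_sum, Finset.sum_sub_distrib, h2, sub_self,
    mul_zero, add_zero]
  rfl

theorem accretive_of_isSymm {A : Matrix ι ι ℂ} (hA : A.IsSymm)
    (h : ∀ a : ι → ℝ, a ≠ 0 → 0 < (realForm A a).re) : Accretive A := by
  have h0 : ∀ a : ι → ℝ, 0 ≤ (realForm A a).re := by
    intro a
    by_cases ha : a = 0
    · simp [ha, realForm]
    · exact (h a ha).le
  intro v hv
  rw [star_dotProduct_mulVec_of_isSymm hA, Complex.add_re]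
  by_cases hr : (fun i => (v i).re) = 0
  · refine add_pos_of_nonneg_of_pos (h0 _) (h _ fun hi => hv ?_)
    ext i
    exact Complex.ext (congrFun hr i) (congrFun hi i)
  · exact add_pos_of_pos_of_nonneg (h _ hr) (h0 _)

theorem realForm_eq_star_dotProduct (A : Matrix ι ι ℂ) (a : ι → ℝ) :
    realForm A a = star (fun i => (a i : ℂ)) ⬝ᵥ A.mulVec fun i => (a i : ℂ) := by
  simp only [realForm, dotProduct, Matrix.mulVec, Finset.mul_sum, Pi.star_apply, Complex.star_def,
    Complex.conj_ofReal, mul_assoc]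

variable [DecidableEq ι]

/-- The polarization `(q(eᵢ + eⱼ) - q(eᵢ) - q(eⱼ)) / 2` of a function on real vectors. -/
noncomputable def polarize (q : (ι → ℝ) → ℂ) : Matrix ι ι ℂ :=
  Matrix.of fun i j => (q (Pi.single i 1 + Pi.single j 1) - q (Pi.single i 1) - q (Pi.single j 1)) / 2

theorem polarize_isSymm {ι : Type*} [DecidableEq ι] (q : (ι → ℝ) → ℂ) : (polarize q).IsSymm := by
  ext i j
  simp only [polarize, Matrix.transpose_apply, Matrix.of_apply, add_comm (Pi.single (M := fun _ : ι => ℝ) i 1)]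
  ring

theorem polarize_realForm {A : Matrix ι ι ℂ} (hA : A.IsSymm) : polarize (realForm A) = A := by
  ext i j
  have hb : ∀ a b : ι → ℝ, realForm A (a + b) =
      realForm A a + realForm A b + 2 * ∑ i, ∑ j, (a i : ℂ) * A i j * (b j : ℂ) := by
    intro a b
    have h1 : ∑ i, ∑ j, ((b i : ℂ) * A i j * (a j : ℂ)) = ∑ i, ∑ j, (a i : ℂ) * A i j * (b j : ℂ) := by
      rw [Finset.sum_comm]
      refine Finset.sum_congr rfl fun i _ => Finset.sum_congr rfl fun j _ => ?_
      rw [hA.apply]; ring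
    rw [two_mul]
    nth_rewrite 1 [← h1]
    simp only [realForm, ← Finset.sum_add_distrib]
    refine Finset.sum_congr rfl fun i _ => Finset.sum_congr rfl fun j _ => ?_
    simp only [Pi.add_apply]; push_cast; ring
  have h2 : ∑ k, ∑ l, (((Pi.single i 1 : ι → ℝ) k : ℝ) : ℂ) * A k l *
      (((Pi.single j 1 : ι → ℝ) l : ℝ) : ℂ) = A i j := by
    rw [Finset.sum_eq_single i, Finset.sum_eq_single j]
    · simp
    · intro l _ hl; simp [hl]
    · simp
    · intro k _ hk; simp [hk]
    · simp
  rw [polarize, Matrix.of_apply, hb, h2]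
  ring

end QuadraticForms

/-! ### The fourth root on the cut plane -/

section FourthRoot

theorem cpow_quarter_pow_four (z : ℂ) : (z ^ (1 / 4 : ℂ)) ^ 4 = z := by
  rw [one_div]
  exact_mod_cast Complex.cpow_nat_inv_pow z four_ne_zero

theorem abs_im_lt_re_cpow_quarter {z : ℂ} (hz : z ∈ Complex.slitPlane) :
    |(z ^ (1 / 4 : ℂ)).im| < (z ^ (1 / 4 : ℂ)).re := by
  have hz0 := Complex.slitPlane_ne_zero hz
  have h1 : z ^ (1 / 4 : ℂ) = Complex.exp (Complex.log z / 4) := by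
    rw [Complex.cpow_def_of_ne_zero hz0]; ring_nf
  set θ := z.arg / 4 with hθ
  have hθ1 : -(Real.pi / 4) < θ := by
    have := Complex.neg_pi_lt_arg z; rw [hθ]; linarith
  have hθ2 : θ < Real.pi / 4 := by
    have := lt_of_le_of_ne (Complex.arg_le_pi z) (Complex.slitPlane_arg_ne_pi hz)
    rw [hθ]; linarith
  have him : (Complex.log z / 4).im = θ := by
    rw [show (4 : ℂ) = ((4 : ℝ) : ℂ) by norm_num, Complex.div_ofReal_im, Complex.log_im]
  rw [h1, Complex.exp_re, Complex.exp_im, him, abs_mul, abs_of_pos (Real.exp_pos _)]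
  refine mul_lt_mul_of_pos_left ?_ (Real.exp_pos _)
  have hc : 0 < Real.cos θ := Real.cos_pos_of_mem_Ioo ⟨by linarith, by linarith⟩
  have hc2 : 0 < Real.cos (2 * θ) := Real.cos_pos_of_mem_Ioo ⟨by linarith, by linarith⟩
  rw [Real.cos_two_mul'] at hc2
  exact abs_lt_of_sq_lt_sq (by linarith) hc.le

theorem re_cpow_quarter_pos {z : ℂ} (hz : z ∈ Complex.slitPlane) : 0 < (z ^ (1 / 4 : ℂ)).re :=
  (abs_nonneg _).trans_lt (abs_im_lt_re_cpow_quarter hz)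

theorem re_cpow_quarter_sq_pos {z : ℂ} (hz : z ∈ Complex.slitPlane) :
    0 < ((z ^ (1 / 4 : ℂ)) ^ 2).re := by
  have h1 := re_cpow_quarter_pos hz
  have h := sq_lt_sq' (by linarith [abs_nonneg (z ^ (1 / 4 : ℂ)).im]) (abs_im_lt_re_cpow_quarter hz)
  rw [sq_abs] at h
  rw [sq, Complex.mul_re]
  nlinarith

theorem differentiableOn_cpow_quarter :
    DifferentiableOn ℂ (fun z : ℂ => z ^ (1 / 4 : ℂ)) Complex.slitPlane :=
  fun _ hz => (differentiableAt_id.cpow_const hz).differentiableWithinAt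

theorem mem_slitPlane_sq {w : ℂ} (hw : 0 < w.re) : w ^ 2 ∈ Complex.slitPlane := by
  rw [Complex.mem_slitPlane_iff, sq, Complex.mul_re, Complex.mul_im]
  by_cases h : w.im = 0
  · left; rw [h]; nlinarith
  · right
    have : w.re * w.im + w.im * w.re = 2 * (w.re * w.im) := by ring
    rw [this]
    exact mul_ne_zero two_ne_zero (mul_ne_zero hw.ne' h)

theorem cpow_quarter_sq_of_sq {w : ℂ} (hw : 0 < w.re) : ((w ^ 2) ^ (1 / 4 : ℂ)) ^ 2 = w := by
  have h1 := re_cpow_quarter_sq_pos (mem_slitPlane_sq hw)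
  have h2 : (((w ^ 2) ^ (1 / 4 : ℂ)) ^ 2) ^ 2 = w ^ 2 := by
    rw [← pow_mul]; exact cpow_quarter_pow_four _
  rcases sq_eq_sq_iff_eq_or_eq_neg.1 h2 with h | h
  · exact h
  · rw [h, Complex.neg_re] at h1; linarith

end FourthRoot

/-! ### Positivity of `w S(w²)` for Stieltjes functions -/

section StieltjesPositivity

/-- The quantity is the inverse of `(1 - u) w⁻¹ + u w`, a convex combination of two points of the
right half-plane. -/
theorem re_mul_stieltjesKernel_pos {w : ℂ} (hw : 0 < w.re) (u : unitInterval) :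
    0 < (w * stieltjesKernel (w ^ 2) u).re := by
  have hw0 : w ≠ 0 := by intro h; simp [h] at hw
  have h1 : w * stieltjesKernel (w ^ 2) u = (((1 - (u : ℝ) : ℝ) : ℂ) * w⁻¹ + ((u : ℝ) : ℂ) * w)⁻¹ := by
    rw [stieltjesKernel, ← inv_inj, inv_inv, mul_inv, inv_inv]
    push_cast
    field_simp
    ring
  have h2 : 0 < (((1 - (u : ℝ) : ℝ) : ℂ) * w⁻¹ + ((u : ℝ) : ℂ) * w).re := by
    rw [Complex.add_re, Complex.re_ofReal_mul, Complex.re_ofReal_mul, Complex.inv_re]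
    have h3 : 0 < w.re / Complex.normSq w := div_pos hw (Complex.normSq_pos.2 hw0)
    have h4 : 0 ≤ (u : ℝ) := u.2.1
    have h5 : 0 ≤ 1 - (u : ℝ) := sub_nonneg.2 u.2.2
    rcases h4.eq_or_lt with h6 | h6
    · rw [← h6]; simpa using h3
    · exact add_pos_of_nonneg_of_pos (mul_nonneg h5 h3.le) (mul_pos h6 hw)
  rw [h1, Complex.inv_re]
  refine div_pos h2 (Complex.normSq_pos.2 fun h => ?_)
  rw [h] at h2; simp at h2

theorem re_mul_integral_stieltjesKernel_pos {σ : Measure unitInterval} [IsFiniteMeasure σ]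
    (hσ : σ ≠ 0) {w : ℂ} (hw : 0 < w.re) : 0 < (w * ∫ u, stieltjesKernel (w ^ 2) u ∂σ).re := by
  have hi := (integrable_stieltjesKernel σ (mem_slitPlane_sq hw)).const_mul w
  rw [← integral_const_mul, ← RCLike.re_eq_complex_re, ← integral_re hi,
    integral_pos_iff_support_of_nonneg (fun u => by
      simpa using (re_mul_stieltjesKernel_pos hw u).le) hi.re]
  have : (Function.support fun u => RCLike.re (w * stieltjesKernel (w ^ 2) u)) = Set.univ := by
    ext u
    simpa using (re_mul_stieltjesKernel_pos hw u).ne'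
  rw [this]
  exact Measure.measure_univ_pos.2 hσ

theorem stieltjesKernel_conj (z : ℂ) (u : unitInterval) :
    stieltjesKernel (star z) u = star (stieltjesKernel z u) := by
  simp [stieltjesKernel]

theorem integral_stieltjesKernel_conj (σ : Measure unitInterval) (z : ℂ) :
    ∫ u, stieltjesKernel (star z) u ∂σ = star (∫ u, stieltjesKernel z u ∂σ) := by
  simp only [stieltjesKernel_conj]
  exact integral_conj

end StieltjesPositivity

theorem isPreconnected_slitPlane : IsPreconnected Complex.slitPlane :=
  (Complex.starConvex_one_slitPlane.isPathConnected Complex.one_mem_slitPlane).isConnected.isPreconnected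

/-! ### Analytic continuation of a matrix Laplace transform -/

section LICMMatrix

variable {ι : Type*} [Fintype ι]

theorem realForm_map_ofReal (A : Matrix ι ι ℝ) (a : ι → ℝ) :
    realForm (A.map Complex.ofReal) a = ((∑ i, ∑ j, a i * A i j * a j : ℝ) : ℂ) := by
  simp [realForm]

/-- A matrix-valued function on `]0, ∞[` with real symmetric values whose quadratic forms are
LICM. -/
structure IsLICMMatrix (g : ℝ → Matrix ι ι ℝ) : Prop where
  symm : ∀ t, 0 < t → (g t).IsSymm
  licm : ∀ a : ι → ℝ, ∃ f, IsLICM f ∧ ∀ t, 0 < t → f t = ∑ i, ∑ j, a i * g t i j * a j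

variable {g : ℝ → Matrix ι ι ℝ}

theorem IsLICMMatrix.integrableOn_realForm (hg : IsLICMMatrix g) (a : ι → ℝ) {p : ℂ}
    (hp : 0 < p.re) :
    IntegrableOn (fun t : ℝ => Complex.exp (-p * t) * realForm ((g t).map Complex.ofReal) a)
      (Set.Ioi 0) := by
  obtain ⟨f, hf, hfg⟩ := hg.licm a
  refine (hf.integrableOn_cexp_mul hp).congr_fun (fun t ht => ?_) measurableSet_Ioi
  simp only [realForm_map_ofReal, hfg t ht]

/-- The entrywise Laplace transform. -/
noncomputable def laplaceMatrix (g : ℝ → Matrix ι ι ℝ) (p : ℂ) : Matrix ι ι ℂ :=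
  Matrix.of fun i j => ∫ t in Set.Ioi (0 : ℝ), Complex.exp (-p * t) * (g t i j : ℂ)

theorem IsLICMMatrix.laplaceMatrix_isSymm (hg : IsLICMMatrix g) (p : ℂ) :
    (laplaceMatrix g p).IsSymm := by
  ext i j
  refine setIntegral_congr_fun measurableSet_Ioi fun t ht => ?_
  simp only [(hg.symm t ht).apply i j]

variable [DecidableEq ι]

theorem IsLICMMatrix.integrableOn_entry (hg : IsLICMMatrix g) {p : ℂ} (hp : 0 < p.re) (i j : ι) :
    IntegrableOn (fun t : ℝ => Complex.exp (-p * t) * (g t i j : ℂ)) (Set.Ioi 0) := by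
  have h := (((hg.integrableOn_realForm (Pi.single i 1 + Pi.single j 1) hp).sub
    (hg.integrableOn_realForm (Pi.single i 1) hp)).sub
    (hg.integrableOn_realForm (Pi.single j 1) hp)).div_const 2
  refine IntegrableOn.congr_fun h (fun t ht => ?_) measurableSet_Ioi
  have h1 : (polarize (realForm ((g t).map Complex.ofReal))) i j = (g t i j : ℂ) := by
    rw [polarize_realForm ((hg.symm t ht).map _)]; rfl
  simp only [Pi.sub_apply]
  rw [← h1, polarize, Matrix.of_apply]
  ring

theorem IsLICMMatrix.realForm_laplaceMatrix (hg : IsLICMMatrix g) {p : ℂ} (hp : 0 < p.re)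
    (a : ι → ℝ) : realForm (laplaceMatrix g p) a =
      ∫ t in Set.Ioi (0 : ℝ), Complex.exp (-p * t) * realForm ((g t).map Complex.ofReal) a := by
  simp only [realForm, laplaceMatrix, Matrix.of_apply, Finset.mul_sum, Matrix.map_apply]
  have hi : ∀ i j, Integrable (fun t : ℝ => Complex.exp (-p * t) * ((a i : ℂ) * (g t i j : ℂ) * a j))
      (volume.restrict (Set.Ioi 0)) := by
    intro i j
    refine (((hg.integrableOn_entry hp i j).const_mul (a i : ℂ)).mul_const (a j : ℂ)).congr
      (ae_of_all _ fun t => ?_)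
    simp only; ring
  rw [integral_finsetSum _ fun i _ => integrable_finsetSum _ fun j _ => hi i j]
  refine Finset.sum_congr rfl fun i _ => ?_
  rw [integral_finsetSum _ fun j _ => hi i j]
  refine Finset.sum_congr rfl fun j _ => ?_
  rw [← integral_const_mul, ← integral_mul_const]
  congr 1; ext t; ring

/-- Each quadratic form continues by its Stieltjes measure and the matrix is recovered by
polarization. The constant `g₀` plays the part of the limit at infinity: since `x ∫ exp (-x t) dt =
1`, it bounds the continuation from below on the positive axis. -/
theorem IsLICMMatrix.exists_continuation (hg : IsLICMMatrix g) {g₀ : Matrix ι ι ℝ}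
    (hle : ∀ a : ι → ℝ, ∀ t, 0 < t →
      ∑ i, ∑ j, a i * g₀ i j * a j ≤ ∑ i, ∑ j, a i * g t i j * a j)
    (hpos : ∀ a : ι → ℝ, a ≠ 0 → 0 < ∑ i, ∑ j, a i * g₀ i j * a j) :
    ∃ Q : ℂ → Matrix ι ι ℂ, (∀ i j, DifferentiableOn ℂ (fun z => Q z i j) Complex.slitPlane) ∧
      (∀ p : ℂ, 0 < p.re → Q p = p • laplaceMatrix g p) ∧
      (∀ z, (Q z).IsSymm) ∧ (∀ z, Q (star z) = (Q z).map star) ∧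
      (∀ a : ι → ℝ, a ≠ 0 → ∀ w : ℂ, 0 < w.re → 0 < (w⁻¹ * realForm (Q (w ^ 2)) a).re) ∧
      (∀ x : ℝ, 0 < x → ∀ a : ι → ℝ, ∑ i, ∑ j, a i * g₀ i j * a j ≤ (realForm (Q x) a).re) := by
  have hex : ∀ a : ι → ℝ, ∃ σ : Measure unitInterval, IsFiniteMeasure σ ∧ ∀ p : ℂ, 0 < p.re →
      realForm (laplaceMatrix g p) a = ∫ u, stieltjesKernel p u ∂σ := by
    intro a
    obtain ⟨f, hf, hfg⟩ := hg.licm a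
    obtain ⟨σ, hσ, h⟩ := hf.exists_laplace_eq
    refine ⟨σ, hσ, fun p hp => ?_⟩
    rw [hg.realForm_laplaceMatrix hp, ← h p hp]
    refine setIntegral_congr_fun measurableSet_Ioi fun t ht => ?_
    simp only [realForm_map_ofReal, hfg t ht]
  choose σ hσ hσp using hex
  set Q : ℂ → Matrix ι ι ℂ := fun z => z • polarize fun a => ∫ u, stieltjesKernel z u ∂(σ a) with hQ
  have hQd : ∀ i j, DifferentiableOn ℂ (fun z => Q z i j) Complex.slitPlane := by
    intro i j
    simp only [hQ, Matrix.smul_apply, polarize, Matrix.of_apply, smul_eq_mul]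
    exact differentiableOn_id.mul ((((differentiableOn_integral_stieltjesKernel _).sub
      (differentiableOn_integral_stieltjesKernel _)).sub
      (differentiableOn_integral_stieltjesKernel _)).div_const 2)
  have hQp : ∀ p : ℂ, 0 < p.re → Q p = p • laplaceMatrix g p := by
    intro p hp
    have h1 : (fun a => ∫ u, stieltjesKernel p u ∂(σ a)) = realForm (laplaceMatrix g p) :=
      funext fun a => (hσp a p hp).symm
    simp only [hQ]
    rw [h1, polarize_realForm (hg.laplaceMatrix_isSymm p)]
  -- The measures are chosen separately for each `a`, so quadratic dependence on `a` is known only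
  -- where the Laplace integral converges; the identity theorem carries it to the cut plane.
  have hQf : ∀ z ∈ Complex.slitPlane, ∀ a, realForm (Q z) a = z * ∫ u, stieltjesKernel z u ∂(σ a) := by
    intro z hz a
    have h1 : DifferentiableOn ℂ (fun z => realForm (Q z) a) Complex.slitPlane := by
      unfold realForm
      exact DifferentiableOn.fun_sum fun i _ => DifferentiableOn.fun_sum fun j _ =>
        ((hQd i j).const_mul _).mul_const _
    have h2 := differentiableOn_id.mul (differentiableOn_integral_stieltjesKernel (σ a))
    refine AnalyticOnNhd.eqOn_of_preconnected_of_eventuallyEq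
      (h1.analyticOnNhd Complex.isOpen_slitPlane) (h2.analyticOnNhd Complex.isOpen_slitPlane)
      isPreconnected_slitPlane
      (z₀ := 1) (by simp) ?_ hz
    filter_upwards [(isOpen_lt continuous_const Complex.continuous_re).mem_nhds
      (by simp : (0 : ℝ) < (1 : ℂ).re)] with p hp
    rw [hQp p hp, realForm_smul, hσp a p hp]
    rfl
  have hlow : ∀ x : ℝ, 0 < x → ∀ a : ι → ℝ,
      ∑ i, ∑ j, a i * g₀ i j * a j ≤ (realForm (Q x) a).re := by
    intro x hx a
    have hx' : 0 < (x : ℂ).re := by simpa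
    obtain ⟨f, hf, hfg⟩ := hg.licm a
    rw [hQp _ hx', realForm_smul, hg.realForm_laplaceMatrix hx', Complex.re_ofReal_mul]
    have h1 : ∫ t in Set.Ioi (0 : ℝ), Complex.exp (-(x : ℂ) * t) *
        realForm ((g t).map Complex.ofReal) a =
        ((∫ t in Set.Ioi (0 : ℝ), Real.exp (-x * t) * f t : ℝ) : ℂ) := by
      rw [← integral_complex_ofReal]
      refine setIntegral_congr_fun measurableSet_Ioi fun t ht => ?_
      simp only [realForm_map_ofReal, hfg t ht]
      push_cast; rfl
    rw [h1, Complex.ofReal_re]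
    set c := ∑ i, ∑ j, a i * g₀ i j * a j
    have h2 : ∫ t in Set.Ioi (0 : ℝ), Real.exp (-x * t) * c = x⁻¹ * c := by
      rw [integral_mul_const, integral_exp_mul_Ioi (by linarith) 0]
      simp
    calc c = x * (x⁻¹ * c) := by field_simp
      _ ≤ _ := by
        rw [← h2]
        refine mul_le_mul_of_nonneg_left ?_ hx.le
        refine setIntegral_mono_on ((integrableOn_exp_neg_mul hx 0).mul_const c)
          (hf.integrableOn_exp_mul hx) measurableSet_Ioi fun t ht => ?_
        rw [hfg t ht]
        exact mul_le_mul_of_nonneg_left (hle a t ht) (Real.exp_pos _).le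
  refine ⟨Q, hQd, hQp, fun z => (polarize_isSymm _).smul z, ?_, ?_, hlow⟩
  · intro z
    ext i j
    simp only [hQ, Matrix.smul_apply, polarize, Matrix.of_apply, smul_eq_mul, Matrix.map_apply,
      integral_stieltjesKernel_conj]
    simp
  · intro a ha w hw
    -- A vanishing measure would contradict the positive lower bound at `x = 1`.
    have hne : σ a ≠ 0 := by
      intro h0
      have h1 := hlow 1 one_pos a
      rw [hQf _ (by simp), h0] at h1
      simp at h1
      linarith [hpos a ha]
    have hw0 : w ≠ 0 := by intro h; simp [h] at hw
    rw [hQf _ (mem_slitPlane_sq hw), ← mul_assoc, sq, inv_mul_cancel_left₀ hw0, ← sq]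
    exact re_mul_integral_stieltjesKernel_pos hne hw

end LICMMatrix

/-! ### The inverse square root of a sectorial family -/

section Sectorial

variable {d : ℕ}

theorem IsPrincipalSqrt.transpose {B Y : Matrix (Fin d) (Fin d) ℂ} (h : IsPrincipalSqrt B Y) :
    IsPrincipalSqrt B.transpose Y.transpose := by
  refine ⟨by rw [← Matrix.transpose_mul, h.1], fun c hc => h.2 c ?_⟩
  rwa [Matrix.mem_spectrum_iff_isRoot_charpoly, Matrix.charpoly_transpose,
    ← Matrix.mem_spectrum_iff_isRoot_charpoly] at hc

theorem IsPrincipalSqrt.conjTranspose {B Y : Matrix (Fin d) (Fin d) ℂ} (h : IsPrincipalSqrt B Y) :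
    IsPrincipalSqrt B.conjTranspose Y.conjTranspose := by
  refine ⟨by rw [← Matrix.conjTranspose_mul, h.1], fun c hc => ?_⟩
  rw [← Matrix.star_eq_conjTranspose, spectrum.map_star, Set.mem_star] at hc
  simpa using h.2 _ hc

/-- A symmetric matrix-valued analytic function on the cut plane, real on the positive half-line,
such that `w⁻¹ Q(w²)` has positive real part for `Re w > 0`. -/
structure IsSectorial (Q : ℂ → Matrix (Fin d) (Fin d) ℂ) : Prop where
  differentiableOn : ∀ i j, DifferentiableOn ℂ (fun z => Q z i j) Complex.slitPlane
  symm : ∀ z, (Q z).IsSymm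
  conj : ∀ z, Q (star z) = (Q z).map star
  pos : ∀ a : Fin d → ℝ, a ≠ 0 → ∀ w : ℂ, 0 < w.re → 0 < (w⁻¹ * realForm (Q (w ^ 2)) a).re

variable {Q : ℂ → Matrix (Fin d) (Fin d) ℂ}

theorem IsSectorial.accretive (hQ : IsSectorial Q) {z : ℂ} (hz : z ∈ Complex.slitPlane) :
    Accretive (((z ^ (1 / 4 : ℂ)) ^ 2)⁻¹ • Q z) := by
  refine accretive_of_isSymm ((hQ.symm z).smul _) fun a ha => ?_
  have h := hQ.pos a ha _ (re_cpow_quarter_sq_pos hz)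
  rwa [← pow_mul, cpow_quarter_pow_four, ← realForm_smul] at h

/-- The principal square root of the accretive matrix `z^(-1/2) Q(z)`. -/
noncomputable def rotatedSqrt (Q : ℂ → Matrix (Fin d) (Fin d) ℂ) (z : ℂ) :
    Matrix (Fin d) (Fin d) ℂ :=
  principalSqrt (((z ^ (1 / 4 : ℂ)) ^ 2)⁻¹ • Q z)

theorem IsSectorial.rotatedSqrt_mul_self (hQ : IsSectorial Q) {z : ℂ}
    (hz : z ∈ Complex.slitPlane) :
    rotatedSqrt Q z * rotatedSqrt Q z = ((z ^ (1 / 4 : ℂ)) ^ 2)⁻¹ • Q z :=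
  (hQ.accretive hz).principalSqrt_spec.1

theorem IsSectorial.accretive_rotatedSqrt (hQ : IsSectorial Q) {z : ℂ}
    (hz : z ∈ Complex.slitPlane) : Accretive (rotatedSqrt Q z) :=
  (hQ.accretive hz).principalSqrt_spec.2

theorem cpow_quarter_ne_zero {z : ℂ} (hz : z ∈ Complex.slitPlane) : z ^ (1 / 4 : ℂ) ≠ 0 := by
  intro h
  have := re_cpow_quarter_pos hz
  rw [h] at this
  simp at this

theorem IsSectorial.isPrincipalSqrt_smul (hQ : IsSectorial Q) {z : ℂ}
    (hz : z ∈ Complex.slitPlane) :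
    IsPrincipalSqrt (Q z) (z ^ (1 / 4 : ℂ) • rotatedSqrt Q z) := by
  have h : Accretive (z ^ (1 / 4 : ℂ) • rotatedSqrt Q z) :=
    (hQ.accretive_rotatedSqrt hz).smul_sqrt
      (by rw [hQ.rotatedSqrt_mul_self hz]; exact hQ.accretive hz)
      (re_cpow_quarter_pos hz) (abs_im_lt_re_cpow_quarter hz).le
  refine ⟨?_, fun c hc => h.re_pos_of_mem_spectrum hc⟩
  rw [smul_mul_smul_comm, hQ.rotatedSqrt_mul_self hz, smul_smul, ← sq,
    mul_inv_cancel₀ (pow_ne_zero 2 (cpow_quarter_ne_zero hz)), one_smul]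

theorem IsSectorial.principalSqrt_eq (hQ : IsSectorial Q) {z : ℂ} (hz : z ∈ Complex.slitPlane) :
    principalSqrt (Q z) = z ^ (1 / 4 : ℂ) • rotatedSqrt Q z :=
  (hQ.isPrincipalSqrt_smul hz).principalSqrt_eq

theorem IsSectorial.isPrincipalSqrt (hQ : IsSectorial Q) {z : ℂ} (hz : z ∈ Complex.slitPlane) :
    IsPrincipalSqrt (Q z) (principalSqrt (Q z)) := by
  rw [hQ.principalSqrt_eq hz]
  exact hQ.isPrincipalSqrt_smul hz

theorem IsSectorial.isUnit_principalSqrt (hQ : IsSectorial Q) {z : ℂ}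
    (hz : z ∈ Complex.slitPlane) : IsUnit (principalSqrt (Q z)) := by
  by_contra h
  rw [← spectrum.zero_mem_iff ℂ] at h
  simpa using (hQ.isPrincipalSqrt hz).2 0 h

theorem IsSectorial.differentiableOn_inv (hQ : IsSectorial Q) :
    DifferentiableOn ℂ (fun z => (principalSqrt (Q z))⁻¹) Complex.slitPlane := by
  open scoped Matrix.Norms.L2Operator in
  have hA : DifferentiableOn ℂ (fun z : ℂ => ((z ^ (1 / 4 : ℂ)) ^ 2)⁻¹ • Q z)
      Complex.slitPlane := by
    refine ((differentiableOn_cpow_quarter.pow 2).inv fun z hz =>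
      pow_ne_zero 2 (cpow_quarter_ne_zero hz)).smul ?_
    exact differentiableOn_pi.2 fun i => differentiableOn_pi.2 fun j => hQ.differentiableOn i j
  have hP : DifferentiableOn ℂ (fun z => z ^ (1 / 4 : ℂ) • rotatedSqrt Q z) Complex.slitPlane :=
    differentiableOn_cpow_quarter.smul
      (differentiableOn_principalSqrt Complex.isOpen_slitPlane hA fun z hz => hQ.accretive hz)
  have hY : DifferentiableOn ℂ (fun z => principalSqrt (Q z)) Complex.slitPlane :=
    hP.congr fun z hz => hQ.principalSqrt_eq hz
  simp only [Matrix.nonsing_inv_eq_ringInverse]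
  intro z hz
  have h1 : DifferentiableAt ℂ Ring.inverse (principalSqrt (Q z)) := by
    exact differentiableAt_inverse (hQ.isUnit_principalSqrt hz)
  exact h1.comp_differentiableWithinAt z (hY z hz)

theorem IsSectorial.inv_isSymm (hQ : IsSectorial Q) {z : ℂ} (hz : z ∈ Complex.slitPlane) :
    ((principalSqrt (Q z))⁻¹).IsSymm := by
  have h := (hQ.isPrincipalSqrt hz).transpose
  rw [(hQ.symm z).eq] at h
  rw [Matrix.IsSymm, Matrix.transpose_nonsing_inv, h.unique (hQ.isPrincipalSqrt hz)]

theorem IsSectorial.inv_conj (hQ : IsSectorial Q) {z : ℂ} (hz : z ∈ Complex.slitPlane) :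
    (principalSqrt (Q (star z)))⁻¹ = ((principalSqrt (Q z))⁻¹).map star := by
  have h := (hQ.isPrincipalSqrt hz).conjTranspose
  have h1 : (Q z).conjTranspose = Q (star z) := by
    rw [hQ.conj, Matrix.conjTranspose, (hQ.symm z).eq]
  rw [h1] at h
  rw [h.principalSqrt_eq, ← Matrix.conjTranspose_nonsing_inv, Matrix.conjTranspose,
    (hQ.inv_isSymm hz).eq]

/-- With `r = w^(1/2)` and `P` the rotated root, `w Q^(-1/2) = r P⁻¹`. Putting `a = P y` turns its
form into the conjugate of `⟨y, r̄ P y⟩`, and `r̄` also has argument below `π/4` in modulus. -/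
theorem IsSectorial.re_mul_realForm_inv_pos (hQ : IsSectorial Q) {a : Fin d → ℝ} (ha : a ≠ 0)
    {w : ℂ} (hw : 0 < w.re) : 0 < (w * realForm (principalSqrt (Q (w ^ 2)))⁻¹ a).re := by
  have hz := mem_slitPlane_sq hw
  set r := (w ^ 2) ^ (1 / 4 : ℂ) with hr
  have hr0 : r ≠ 0 := cpow_quarter_ne_zero hz
  set P := rotatedSqrt Q (w ^ 2) with hP
  have hPa : Accretive P := hQ.accretive_rotatedSqrt hz
  have hPu := (Matrix.isUnit_iff_isUnit_det P).1 hPa.isUnit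
  have hc : Accretive (star r • P) :=
    hPa.smul_sqrt (by rw [hP, hQ.rotatedSqrt_mul_self hz]; exact hQ.accretive hz)
      (by rw [Complex.star_def, Complex.conj_re]; exact re_cpow_quarter_pos hz) (by
        rw [Complex.star_def, Complex.conj_re, Complex.conj_im, abs_neg]
        exact (abs_im_lt_re_cpow_quarter hz).le)
  set v : Fin d → ℂ := fun i => (a i : ℂ) with hv
  set y := P⁻¹.mulVec v with hy
  have hPy : P.mulVec y = v := by
    rw [hy, Matrix.mulVec_mulVec, Matrix.mul_nonsing_inv _ hPu, Matrix.one_mulVec]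
  have hy0 : y ≠ 0 := by
    intro h
    rw [h, Matrix.mulVec_zero] at hPy
    apply ha
    ext i
    have := congrFun hPy i
    simpa [hv] using this.symm
  have h1 := hc y hy0
  have h2 : w * realForm (principalSqrt (Q (w ^ 2)))⁻¹ a = star (star y ⬝ᵥ (star r • P).mulVec y) := by
    have h3 : (principalSqrt (Q (w ^ 2)))⁻¹ = r⁻¹ • P⁻¹ := by
      rw [hQ.principalSqrt_eq hz]
      refine Matrix.inv_eq_left_inv ?_
      rw [smul_mul_smul_comm, inv_mul_cancel₀ hr0, Matrix.nonsing_inv_mul _ hPu, one_smul]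
    rw [h3, realForm_smul, realForm_eq_star_dotProduct, ← mul_assoc]
    have h4 : w * r⁻¹ = r := by
      rw [← cpow_quarter_sq_of_sq hw]
      rw [← hr]; field_simp
    rw [h4, Matrix.smul_mulVec, dotProduct_smul, hPy, smul_eq_mul, star_mul', star_star]
    congr 1
    rw [Matrix.star_dotProduct, dotProduct_comm]
  rw [h2]
  simpa using h1

/-- For `v = Q^(-1/2) a`, which is real by conjugation symmetry, `⟨v, Q v⟩ = |a|²`. Hence `δ |v|² ≤
|a|²`, and Cauchy–Schwarz bounds `⟨a, v⟩`. -/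
theorem IsSectorial.re_realForm_inv_le (hQ : IsSectorial Q) {δ x : ℝ} (hδ : 0 < δ) (hx : 0 < x)
    (hle : ∀ a : Fin d → ℝ, δ * ∑ i, a i ^ 2 ≤ (realForm (Q x) a).re) (a : Fin d → ℝ) :
    (realForm (principalSqrt (Q x))⁻¹ a).re ≤ (∑ i, a i ^ 2) / √δ := by
  have hz : (x : ℂ) ∈ Complex.slitPlane := by simpa
  set Y := principalSqrt (Q x) with hY
  have hYu := (Matrix.isUnit_iff_isUnit_det Y).1 (hQ.isUnit_principalSqrt hz)
  have hreal : ∀ i j, ((Y⁻¹ i j).re : ℂ) = Y⁻¹ i j := by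
    intro i j
    have h := hQ.inv_conj hz
    have hx' : star (x : ℂ) = x := Complex.conj_ofReal x
    rw [hx'] at h
    have h1 := congrFun (congrFun h i) j
    exact Complex.conj_eq_iff_re.1 h1.symm
  set v : Fin d → ℝ := fun i => ∑ j, (Y⁻¹ i j).re * a j with hv
  have hv' : (fun i => (v i : ℂ)) = Y⁻¹.mulVec fun i => (a i : ℂ) := by
    ext i
    simp only [hv, Matrix.mulVec, dotProduct]
    push_cast
    simp only [hreal]
  have hYv : Y.mulVec (fun i => (v i : ℂ)) = fun i => (a i : ℂ) := by
    rw [hv', Matrix.mulVec_mulVec, Matrix.mul_nonsing_inv _ hYu, Matrix.one_mulVec]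
  have hYsymm : Y.transpose = Y := by
    have h := (hQ.isPrincipalSqrt hz).transpose
    rw [(hQ.symm _).eq] at h
    exact h.unique (hQ.isPrincipalSqrt hz)
  have h1 : realForm (Q x) v = ((∑ i, a i ^ 2 : ℝ) : ℂ) := by
    have h2 : star (fun i => (v i : ℂ)) = fun i => (v i : ℂ) := by
      ext i; simp
    rw [realForm_eq_star_dotProduct, ← (hQ.isPrincipalSqrt hz).1, ← Matrix.mulVec_mulVec,
      Matrix.dotProduct_mulVec, hYv, h2, ← Matrix.mulVec_transpose, hYsymm, hYv]
    simp [dotProduct, sq]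
  have h3 : realForm Y⁻¹ a = ((∑ i, a i * v i : ℝ) : ℂ) := by
    rw [realForm_eq_star_dotProduct, ← hv']
    simp [dotProduct]
  have h4 := hle v
  rw [h1, Complex.ofReal_re] at h4
  rw [h3, Complex.ofReal_re]
  have h5 := Finset.sum_mul_sq_le_sq_mul_sq Finset.univ a v
  set A := ∑ i, a i ^ 2
  have hA : 0 ≤ A := Finset.sum_nonneg fun i _ => sq_nonneg _
  refine le_of_sq_le_sq ?_ (by positivity)
  rw [div_pow, Real.sq_sqrt hδ.le, le_div_iff₀ hδ]
  calc (∑ i, a i * v i) ^ 2 * δ ≤ (A * ∑ i, v i ^ 2) * δ := by gcongr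
    _ = A * (δ * ∑ i, v i ^ 2) := by ring
    _ ≤ A * A := by gcongr
    _ = A ^ 2 := by ring

end Sectorial

theorem eqOn_slitPlane_of_forall_pos {f g : ℂ → ℂ} (hf : DifferentiableOn ℂ f Complex.slitPlane)
    (hg : DifferentiableOn ℂ g Complex.slitPlane) (h : ∀ x : ℝ, 0 < x → f x = g x) :
    Set.EqOn f g Complex.slitPlane := by
  refine AnalyticOnNhd.eqOn_of_preconnected_of_frequently_eq
    (hf.analyticOnNhd Complex.isOpen_slitPlane) (hg.analyticOnNhd Complex.isOpen_slitPlane)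
    isPreconnected_slitPlane Complex.one_mem_slitPlane ?_
  have h1 : Tendsto (fun n : ℕ => ((1 + 1 / ((n : ℝ) + 1) : ℝ) : ℂ)) atTop (𝓝[≠] 1) := by
    refine tendsto_nhdsWithin_iff.2 ⟨?_, Eventually.of_forall fun n => ?_⟩
    · have := (tendsto_one_div_add_atTop_nhds_zero_nat (𝕜 := ℝ)).const_add 1
      rw [add_zero] at this
      exact_mod_cast (Complex.continuous_ofReal.tendsto 1).comp this
    · have h2 : (1 + 1 / ((n : ℝ) + 1) : ℝ) ≠ 1 := by
        have : 0 < 1 / ((n : ℝ) + 1) := by positivity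
        linarith
      exact Complex.ofReal_ne_one.2 h2
  refine h1.frequently (Eventually.frequently (Eventually.of_forall fun n => h _ ?_))
  positivity

/-! ### Cayley transform and Poisson kernel -/

section Disc

/-- The conformal map of the unit disc onto the right half-plane. -/
noncomputable def cayley (ζ : ℂ) : ℂ := (1 + ζ) / (1 - ζ)

theorem one_sub_ne_zero_of_norm_lt {ζ : ℂ} (h : ‖ζ‖ < 1) : 1 - ζ ≠ 0 := by
  intro h0
  rw [← sub_eq_zero.1 h0] at h
  simp at h

theorem re_cayley_pos {ζ : ℂ} (h : ‖ζ‖ < 1) : 0 < (cayley ζ).re := by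
  have h1 := one_sub_ne_zero_of_norm_lt h
  have h2 : (cayley ζ).re = (1 - ‖ζ‖ ^ 2) / Complex.normSq (1 - ζ) := by
    rw [cayley, Complex.div_re, ← add_div, Complex.sq_norm, Complex.normSq_apply ζ]
    congr 1
    simp; ring
  rw [h2]
  exact div_pos (by nlinarith [norm_nonneg ζ]) (Complex.normSq_pos.2 h1)

theorem differentiableOn_cayley : DifferentiableOn ℂ cayley (Metric.ball 0 1) := by
  unfold cayley
  refine DifferentiableOn.div (by fun_prop) (by fun_prop) fun ζ hζ => ?_
  exact one_sub_ne_zero_of_norm_lt (by simpa using hζ)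

/-- The point `(1 - cos θ) / 2` of the unit interval. -/
noncomputable def arcPoint (θ : ℝ) : unitInterval :=
  ⟨(1 - Real.cos θ) / 2, by linarith [Real.cos_le_one θ], by linarith [Real.neg_one_le_cos θ]⟩

theorem continuous_arcPoint : Continuous arcPoint := by
  unfold arcPoint; fun_prop

/-- The Stieltjes kernel at a positive real point, as a real continuous function. -/
noncomputable def realKernel {y : ℝ} (hy : 0 < y) : C(unitInterval, ℝ) where
  toFun u := (1 + (u : ℝ) * (y - 1))⁻¹
  continuous_toFun := by
    refine Continuous.inv₀ (by fun_prop) fun u => ?_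
    have := one_add_mul_ne_zero (z := (y : ℂ)) (by simpa) u
    exact_mod_cast this

theorem ofReal_realKernel {y : ℝ} (hy : 0 < y) (u : unitInterval) :
    ((realKernel hy u : ℝ) : ℂ) = stieltjesKernel y u := by
  simp [realKernel, stieltjesKernel]

theorem cos_kernel_pos {x : ℝ} (hx : |x| < 1) (θ : ℝ) : 0 < 1 - 2 * x * Real.cos θ + x ^ 2 := by
  have h1 : x * Real.cos θ ≤ |x| := by
    refine (le_abs_self _).trans ?_
    rw [abs_mul]
    exact mul_le_of_le_one_right (abs_nonneg x) (Real.abs_cos_le_one θ)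
  have h2 : 0 < (1 - |x|) ^ 2 := pow_pos (by linarith) 2
  rw [sub_sq, sq_abs] at h2
  linarith

/-- At real points of the disc the Poisson kernel depends on `θ` only through `cos θ`. In the
variable `u = (1 - cos θ) / 2` it is a multiple of the Stieltjes kernel at `y = ((1 + x) / (1 -
x))²`, so the circle folds onto `[0,1]`. -/
theorem poissonKernel_circleMap {r x : ℝ} (hr : 0 < r) (hx : |x| < 1) (θ : ℝ)
    (hy : 0 < ((1 + x) / (1 - x)) ^ 2) :
    poissonKernel 0 ((r * x : ℝ) : ℂ) (circleMap 0 r θ) =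
      (1 + x) / (1 - x) * realKernel hy (arcPoint θ) := by
  have hpos := cos_kernel_pos hx θ
  have hx1 : 1 - x ≠ 0 := by rw [abs_lt] at hx; linarith
  have h1 : ‖circleMap 0 r θ‖ ^ 2 = r ^ 2 := by simp
  have h2 : ‖circleMap 0 r θ - ((r * x : ℝ) : ℂ)‖ ^ 2 = r ^ 2 * (1 - 2 * x * Real.cos θ + x ^ 2) := by
    rw [Complex.sq_norm, Complex.normSq_apply]
    simp [circleMap, Complex.exp_re, Complex.exp_im]
    nlinarith [Real.sin_sq_add_cos_sq θ]
  rw [poissonKernel_def, sub_zero, sub_zero, h1, h2, Complex.norm_real, Real.norm_eq_abs, sq_abs]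
  have h3 : realKernel hy (arcPoint θ) = (1 - x) ^ 2 / (1 - 2 * x * Real.cos θ + x ^ 2) := by
    simp only [realKernel, ContinuousMap.coe_mk, arcPoint]
    rw [eq_div_iff hpos.ne', inv_mul_eq_iff_eq_mul₀]
    · field_simp; ring
    · have : 1 + (1 - Real.cos θ) / 2 * (((1 + x) / (1 - x)) ^ 2 - 1) =
          (1 - 2 * x * Real.cos θ + x ^ 2) / (1 - x) ^ 2 := by
        field_simp; ring
      rw [this]
      positivity
  rw [h3]
  field_simp
  ring

end Disc

/-! ### Herglotz representation by a quadratic family of measures -/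

section Herglotz

variable {ι : Type*} [Fintype ι]

/-- A symmetric matrix-valued analytic function on the cut plane, real on the positive half-line,
such that `w S(w²)` has non-negative real part for `Re w > 0`. -/
structure IsStieltjesType (S : ℂ → Matrix ι ι ℂ) : Prop where
  differentiableOn : ∀ i j, DifferentiableOn ℂ (fun z => S z i j) Complex.slitPlane
  symm : ∀ z ∈ Complex.slitPlane, (S z).IsSymm
  conj : ∀ z ∈ Complex.slitPlane, S (star z) = (S z).map star
  nonneg : ∀ a : ι → ℝ, ∀ w : ℂ, 0 < w.re → 0 ≤ (w * realForm (S (w ^ 2)) a).re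

variable {S : ℂ → Matrix ι ι ℂ}

theorem IsStieltjesType.differentiableOn_realForm (hS : IsStieltjesType S) (a : ι → ℝ) :
    DifferentiableOn ℂ (fun z => realForm (S z) a) Complex.slitPlane := by
  unfold realForm
  exact DifferentiableOn.fun_sum fun i _ => DifferentiableOn.fun_sum fun j _ =>
    ((hS.differentiableOn i j).const_mul _).mul_const _

theorem IsStieltjesType.im_realForm (hS : IsStieltjesType S) (a : ι → ℝ) {x : ℝ} (hx : 0 < x) :
    (realForm (S x) a).im = 0 := by
  have h := hS.conj x (by simpa)
  rw [Complex.star_def, Complex.conj_ofReal] at h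
  rw [← Complex.conj_eq_iff_im]
  nth_rewrite 2 [h]
  simp [realForm]

/-- The quadratic form of `S`, transplanted to the unit disc. -/
noncomputable def discForm (S : ℂ → Matrix ι ι ℂ) (a : ι → ℝ) (ζ : ℂ) : ℂ :=
  cayley ζ * realForm (S (cayley ζ ^ 2)) a

theorem IsStieltjesType.differentiableOn_discForm (hS : IsStieltjesType S) (a : ι → ℝ) :
    DifferentiableOn ℂ (discForm S a) (Metric.ball 0 1) := by
  refine differentiableOn_cayley.mul ((hS.differentiableOn_realForm a).comp
    (differentiableOn_cayley.pow 2) fun ζ hζ => ?_)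
  exact mem_slitPlane_sq (re_cayley_pos (by simpa using hζ))

/-- Radii increasing to `1`. -/
noncomputable def discRadius (n : ℕ) : ℝ := 1 - 1 / ((n : ℝ) + 2)

theorem discRadius_pos (n : ℕ) : 0 < discRadius n := by
  have : 1 / ((n : ℝ) + 2) < 1 := by rw [div_lt_one (by positivity)]; linarith [n.cast_nonneg (α := ℝ)]
  unfold discRadius; linarith

theorem discRadius_lt_one (n : ℕ) : discRadius n < 1 := by
  have : 0 < 1 / ((n : ℝ) + 2) := by positivity
  unfold discRadius; linarith

theorem tendsto_discRadius : Tendsto discRadius atTop (𝓝 1) := by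
  have h := (tendsto_one_div_add_atTop_nhds_zero_nat (𝕜 := ℝ)).comp (tendsto_add_atTop_nat 1)
  have h1 := h.const_sub 1
  rw [sub_zero] at h1
  refine h1.congr fun n => ?_
  simp only [discRadius, Function.comp_apply]
  push_cast; ring_nf

theorem IsStieltjesType.continuous_discForm_circleMap (hS : IsStieltjesType S) (a : ι → ℝ) (n : ℕ) :
    Continuous fun θ => (discForm S a (circleMap 0 (discRadius n) θ)).re := by
  refine Complex.continuous_re.comp
    ((hS.differentiableOn_discForm a).continuousOn.comp_continuous (continuous_circleMap _ _) ?_)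
  intro θ
  simpa [abs_of_pos (discRadius_pos n)] using discRadius_lt_one n

/-- The positive functionals approximating the representing measure. -/
noncomputable def discFunctional (hS : IsStieltjesType S) (a : ι → ℝ) (n : ℕ) :
    C(unitInterval, ℝ) →ₗ[ℝ] ℝ where
  toFun f := (2 * Real.pi)⁻¹ * ∫ θ in 0..2 * Real.pi,
    f (arcPoint θ) * (discForm S a (circleMap 0 (discRadius n) θ)).re
  map_add' f g := by
    have hc := hS.continuous_discForm_circleMap a n
    have ha := continuous_arcPoint
    rw [← mul_add, ← intervalIntegral.integral_add
      (Continuous.intervalIntegrable (by fun_prop) _ _)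
      (Continuous.intervalIntegrable (by fun_prop) _ _)]
    simp only [ContinuousMap.add_apply, add_mul]
  map_smul' c f := by
    simp only [ContinuousMap.smul_apply, smul_eq_mul, mul_assoc, intervalIntegral.integral_const_mul,
      RingHom.id_apply]
    ring

theorem discFunctional_apply (hS : IsStieltjesType S) (a : ι → ℝ) (n : ℕ) (f : C(unitInterval, ℝ)) :
    discFunctional hS a n f = (2 * Real.pi)⁻¹ * ∫ θ in 0..2 * Real.pi,
      f (arcPoint θ) * (discForm S a (circleMap 0 (discRadius n) θ)).re := rfl

theorem norm_circleMap_discRadius_lt (n : ℕ) (θ : ℝ) : ‖circleMap 0 (discRadius n) θ‖ < 1 := by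
  simpa [abs_of_pos (discRadius_pos n)] using discRadius_lt_one n

theorem discFunctional_nonneg (hS : IsStieltjesType S) (a : ι → ℝ) (n : ℕ) (f : C(unitInterval, ℝ))
    (hf : 0 ≤ f) : 0 ≤ discFunctional hS a n f := by
  rw [discFunctional_apply]
  refine mul_nonneg (by positivity) (intervalIntegral.integral_nonneg (by positivity) fun θ _ => ?_)
  exact mul_nonneg (hf _) (hS.nonneg a _ (re_cayley_pos (norm_circleMap_discRadius_lt n θ)))

/-- Poisson's formula for the harmonic real part on the circle of radius `discRadius n`, at the
point `discRadius n * x`. -/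
theorem discFunctional_realKernel (hS : IsStieltjesType S) (a : ι → ℝ) (n : ℕ) {x : ℝ}
    (hx : |x| < 1) (hy : 0 < ((1 + x) / (1 - x)) ^ 2) :
    (1 + x) / (1 - x) * discFunctional hS a n (realKernel hy) =
      (discForm S a ((discRadius n * x : ℝ) : ℂ)).re := by
  have hr := discRadius_pos n
  have hharm : InnerProductSpace.HarmonicOnNhd (fun ζ => (discForm S a ζ).re)
      (Metric.closedBall 0 (discRadius n)) := by
    intro ζ hζ
    refine AnalyticAt.harmonicAt_re ((hS.differentiableOn_discForm a).analyticAt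
      (Metric.isOpen_ball.mem_nhds ?_))
    exact Metric.closedBall_subset_ball (discRadius_lt_one n) hζ
  have hw : ((discRadius n * x : ℝ) : ℂ) ∈ Metric.ball (0 : ℂ) (discRadius n) := by
    rw [mem_ball_zero_iff, Complex.norm_real, Real.norm_eq_abs, abs_mul, abs_of_pos hr]
    nlinarith
  rw [← hharm.circleAverage_poissonKernel_smul hw, Real.circleAverage_def, discFunctional_apply,
    smul_eq_mul, mul_left_comm, ← intervalIntegral.integral_const_mul]
  congr 2
  ext θ
  rw [Pi.smul_apply', poissonKernel_circleMap hr hx θ hy, smul_eq_mul, mul_assoc]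

/-- Polarization identity for functions on real vectors. -/
def IsQuadratic [DecidableEq ι] (q : (ι → ℝ) → ℝ) : Prop :=
  ∀ a, q a = ∑ i, ∑ j,
    a i * ((q (Pi.single i 1 + Pi.single j 1) - q (Pi.single i 1) - q (Pi.single j 1)) / 2) * a j

variable [DecidableEq ι]

theorem isQuadratic_re_mul_realForm {A : Matrix ι ι ℂ} (hA : A.IsSymm) (c : ℂ) :
    IsQuadratic fun a => (c * realForm A a).re := by
  intro a
  have h0 : realForm A a = realForm (polarize (realForm A)) a := by rw [polarize_realForm hA]
  change (c * realForm A a).re = _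
  rw [h0, realForm, Finset.mul_sum, Complex.re_sum]
  refine Finset.sum_congr rfl fun i _ => ?_
  rw [Finset.mul_sum, Complex.re_sum]
  refine Finset.sum_congr rfl fun j _ => ?_
  simp only [polarize, Matrix.of_apply]
  set p := realForm A (Pi.single i 1 + Pi.single j 1)
  set q := realForm A (Pi.single i 1)
  set r := realForm A (Pi.single j 1)
  have h : c * ((a i : ℂ) * ((p - q - r) / 2) * (a j : ℂ)) =
      ((a i * a j / 2 : ℝ) : ℂ) * (c * p - c * q - c * r) := by
    push_cast; ring
  rw [h, Complex.re_ofReal_mul, Complex.sub_re, Complex.sub_re]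
  ring

theorem IsQuadratic.of_tendsto {q : ℕ → (ι → ℝ) → ℝ} {l : (ι → ℝ) → ℝ} {F : Filter ℕ} [F.NeBot]
    (hq : ∀ n, IsQuadratic (q n)) (h : ∀ a, Tendsto (fun n => q n a) F (𝓝 (l a))) :
    IsQuadratic l := by
  intro a
  refine tendsto_nhds_unique (h a) ?_
  simp only [fun n => hq n a]
  exact tendsto_finsetSum _ fun i _ => tendsto_finsetSum _ fun j _ =>
    (((((h _).sub (h _)).sub (h _)).div_const 2).const_mul _).mul_const _

theorem IsQuadratic.intervalIntegral {q : ℝ → (ι → ℝ) → ℝ} (hq : ∀ θ, IsQuadratic (q θ))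
    (hc : ∀ a, Continuous fun θ => q θ a) (s t : ℝ) :
    IsQuadratic fun a => ∫ θ in s..t, q θ a := by
  intro a
  have hi : ∀ b, IntervalIntegrable (fun θ => q θ b) volume s t :=
    fun b => (hc b).intervalIntegrable _ _
  simp only [fun θ => hq θ a]
  rw [intervalIntegral.integral_finsetSum fun i _ => Continuous.intervalIntegrable (by fun_prop) _ _]
  refine Finset.sum_congr rfl fun i _ => ?_
  rw [intervalIntegral.integral_finsetSum fun i _ => Continuous.intervalIntegrable (by fun_prop) _ _]
  refine Finset.sum_congr rfl fun j _ => ?_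
  rw [intervalIntegral.integral_mul_const, intervalIntegral.integral_const_mul,
    intervalIntegral.integral_div, intervalIntegral.integral_sub ((hi _).sub (hi _)) (hi _),
    intervalIntegral.integral_sub (hi _) (hi _)]

theorem isQuadratic_discFunctional (hS : IsStieltjesType S) (n : ℕ) (f : C(unitInterval, ℝ)) :
    IsQuadratic fun a => discFunctional hS a n f := by
  simp only [discFunctional_apply, ← intervalIntegral.integral_const_mul]
  refine IsQuadratic.intervalIntegral (fun θ => ?_) (fun a => ?_) _ _
  · have h := isQuadratic_re_mul_realForm
      (hS.symm _ (mem_slitPlane_sq (re_cayley_pos (norm_circleMap_discRadius_lt n θ))))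
      (((2 * Real.pi)⁻¹ * f (arcPoint θ) : ℝ) * cayley (circleMap 0 (discRadius n) θ))
    simp only [mul_assoc, Complex.re_ofReal_mul] at h
    exact h
  · have hc := hS.continuous_discForm_circleMap a n
    have ha := continuous_arcPoint
    fun_prop

/-- A matrix Stieltjes-type function is represented by a quadratic family of finite measures. -/
theorem IsStieltjesType.exists_measure (hS : IsStieltjesType S) :
    ∃ σ : (ι → ℝ) → Measure unitInterval, (∀ a, IsFiniteMeasure (σ a)) ∧
      (∀ a, ∀ z ∈ Complex.slitPlane, realForm (S z) a = ∫ u, stieltjesKernel z u ∂(σ a)) ∧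
      ∀ f : C(unitInterval, ℝ), IsQuadratic fun a => ∫ u, f u ∂(σ a) := by
  -- Mean value property: the total masses do not depend on `n`, which supplies the bound for the
  -- weak limit.
  have hone : ∀ a n, discFunctional hS a n 1 = (discForm S a 0).re := by
    intro a n
    have h := discFunctional_realKernel hS a n (x := 0) (by simp) (by simp)
    simp only [add_zero, sub_zero, div_one, one_mul, mul_zero, Complex.ofReal_zero] at h
    rw [← h]
    congr 1
    ext u
    simp [realKernel]
  have hex := fun a => exists_measure_of_bounded_functionals (Filter.hyperfilter ℕ)
    (discFunctional hS a) (discFunctional_nonneg hS a) (fun n => (hone a n).le)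
  choose σ hσ hlim using hex
  refine ⟨σ, hσ, fun a => ?_, fun f => ?_⟩
  -- It suffices to compare on the positive axis, where both sides are real; `x` is the inverse
  -- Cayley transform of `√y`.
  · refine eqOn_slitPlane_of_forall_pos (hS.differentiableOn_realForm a)
      (differentiableOn_integral_stieltjesKernel (σ a)) fun y hy => ?_
    obtain ⟨w, hw0, hyw⟩ : ∃ w : ℝ, 0 < w ∧ y = w ^ 2 :=
      ⟨√y, Real.sqrt_pos.2 hy, (Real.sq_sqrt hy.le).symm⟩
    obtain ⟨x, hx1, hxw⟩ : ∃ x : ℝ, |x| < 1 ∧ (1 + x) / (1 - x) = w := by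
      have hw1 : w + 1 ≠ 0 := by positivity
      refine ⟨(w - 1) / (w + 1), ?_, by field_simp; ring⟩
      rw [abs_lt]
      constructor
      · rw [lt_div_iff₀ (by positivity)]; linarith
      · rw [div_lt_one (by positivity)]; linarith
    rw [← hxw] at hyw
    have hcay : cayley (x : ℂ) = (w : ℂ) := by
      rw [cayley, ← hxw]; push_cast; rfl
    subst hyw
    have h1 := (hlim a (realKernel hy)).const_mul ((1 + x) / (1 - x))
    simp only [discFunctional_realKernel hS a _ hx1 hy] at h1
    have h2 : Tendsto (fun n => (discForm S a ((discRadius n * x : ℝ) : ℂ)).re) atTop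
        (𝓝 (discForm S a x).re) := by
      have h3 : ContinuousAt (discForm S a) (x : ℂ) :=
        ((hS.differentiableOn_discForm a).continuousOn).continuousAt
          (Metric.isOpen_ball.mem_nhds (by simpa using hx1))
      have h4 : Tendsto (fun n => ((discRadius n * x : ℝ) : ℂ)) atTop (𝓝 (x : ℂ)) := by
        have := (Complex.continuous_ofReal.tendsto _).comp (tendsto_discRadius.mul_const x)
        rwa [one_mul] at this
      exact (Complex.continuous_re.tendsto _).comp (h3.tendsto.comp h4)
    have h5 := tendsto_nhds_unique h1 (h2.mono_left Nat.hyperfilter_le_atTop)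
    have h6 : (discForm S a x).re =
        (1 + x) / (1 - x) * (realForm (S ((((1 + x) / (1 - x)) ^ 2 : ℝ) : ℂ)) a).re := by
      rw [discForm, hcay, Complex.re_ofReal_mul, ← hxw]
      push_cast; rfl
    rw [h6] at h5
    have h7 := mul_left_cancel₀ (hxw.trans_ne hw0.ne') h5
    have h8 : ∫ u, stieltjesKernel ((((1 + x) / (1 - x)) ^ 2 : ℝ) : ℂ) u ∂(σ a) =
        ((∫ u, realKernel hy u ∂(σ a) : ℝ) : ℂ) := by
      rw [← integral_complex_ofReal]
      simp only [ofReal_realKernel]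
    rw [h8]
    refine Complex.ext ?_ ?_
    · rw [Complex.ofReal_re, h7]
    · rw [Complex.ofReal_im, hS.im_realForm a hy]
  · exact IsQuadratic.of_tendsto (fun n => isQuadratic_discFunctional hS n f) fun a => hlim a f

end Herglotz

/-! ### Signs of densities -/

section Measure

variable {X : Type*} [TopologicalSpace X] [CompactSpace X] [MeasurableSpace X] [BorelSpace X]

theorem integrable_continuousMap (σ : Measure X) [IsFiniteMeasure σ] (f : C(X, ℝ)) :
    Integrable f σ :=
  f.continuous.integrable_of_hasCompactSupport (HasCompactSupport.of_compactSpace _)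

theorem measure_ext_of_integral_eq {X : Type*} [TopologicalSpace X] [MeasurableSpace X]
    [BorelSpace X] [HasOuterApproxClosed X] {σ τ : Measure X}
    [IsFiniteMeasure σ] [IsFiniteMeasure τ] (h : ∀ f : C(X, ℝ), ∫ x, f x ∂σ = ∫ x, f x ∂τ) : σ = τ :=
  ext_of_forall_integral_eq_of_IsFiniteMeasure fun f => h f.toContinuousMap

/-- The hypothesis says `h⁺ τ = σ + h⁻ τ` as measures. The left side does not charge `{h < 0}`,
hence neither does `h⁻ τ`. -/
theorem ae_nonneg_of_integral_eq [HasOuterApproxClosed X] {σ τ : Measure X}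
    [IsFiniteMeasure σ] [IsFiniteMeasure τ] {h : X → ℝ} (hm : Measurable h) (hi : Integrable h τ)
    (heq : ∀ f : C(X, ℝ), ∫ x, f x * h x ∂τ = ∫ x, f x ∂σ) : ∀ᵐ x ∂τ, 0 ≤ h x := by
  have hmp : Measurable fun x => ENNReal.ofReal (h x) := hm.ennreal_ofReal
  have hmn : Measurable fun x => ENNReal.ofReal (-h x) := hm.neg.ennreal_ofReal
  have : IsFiniteMeasure (τ.withDensity fun x => ENNReal.ofReal (h x)) :=
    isFiniteMeasure_withDensity_ofReal hi.2
  have : IsFiniteMeasure (τ.withDensity fun x => ENNReal.ofReal (-h x)) :=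
    isFiniteMeasure_withDensity_ofReal hi.neg.2
  have h1 : τ.withDensity (fun x => ENNReal.ofReal (h x)) =
      σ + τ.withDensity fun x => ENNReal.ofReal (-h x) := by
    refine measure_ext_of_integral_eq fun f => ?_
    rw [integral_add_measure (integrable_continuousMap _ f) (integrable_continuousMap _ f), ← heq f,
      integral_withDensity_eq_integral_toReal_smul hmp (by simp),
      integral_withDensity_eq_integral_toReal_smul hmn (by simp), ← integral_add]
    · refine integral_congr_ae (ae_of_all _ fun x => ?_)
      simp only [ENNReal.toReal_ofReal', smul_eq_mul]
      rcases le_total 0 (h x) with hx | hx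
      · rw [max_eq_left hx, max_eq_right (by linarith)]; ring
      · rw [max_eq_right hx, max_eq_left (by linarith)]; ring
    · exact hi.bdd_mul (c := ‖f‖) f.continuous.aestronglyMeasurable
        (ae_of_all _ fun x => f.norm_coe_le_norm x)
    · refine Integrable.mul_bdd (c := ‖f‖) ?_ f.continuous.aestronglyMeasurable
        (ae_of_all _ fun x => f.norm_coe_le_norm x)
      simp only [ENNReal.toReal_ofReal']
      exact hi.neg.pos_part
  have hE : MeasurableSet {x | h x < 0} := measurableSet_lt hm measurable_const
  have h2 : τ.withDensity (fun x => ENNReal.ofReal (h x)) {x | h x < 0} = 0 := by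
    rw [withDensity_apply _ hE]
    refine (setLIntegral_congr_fun hE fun x hx => ?_).trans lintegral_zero
    exact ENNReal.ofReal_of_nonpos (le_of_lt hx)
  have h3 : τ.withDensity (fun x => ENNReal.ofReal (-h x)) {x | h x < 0} = 0 := by
    rw [h1, Measure.add_apply, add_eq_zero] at h2
    exact h2.2
  rw [withDensity_apply_eq_zero hmn] at h3
  rw [ae_iff]
  refine measure_mono_null (fun x hx => ?_) h3
  have hx' : h x < 0 := not_le.1 hx
  exact ⟨by simpa using hx', hx'⟩

end Measure

/-! ### Entry bounds for positive semi-definite matrices -/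

section RealPosSemidef

variable {ι : Type*} [Fintype ι]

theorem posSemidef_of_sum_nonneg {A : Matrix ι ι ℝ} (hA : A.IsSymm)
    (h : ∀ a : ι → ℝ, 0 ≤ ∑ i, ∑ j, a i * A i j * a j) : A.PosSemidef := by
  refine Matrix.PosSemidef.of_dotProduct_mulVec_nonneg ?_ fun a => ?_
  · rw [Matrix.IsHermitian, Matrix.conjTranspose_eq_transpose_of_trivial]; exact hA
  · simpa [dotProduct, Matrix.mulVec, Finset.mul_sum, mul_assoc] using h a

theorem sum_nonneg_of_posSemidef {A : Matrix ι ι ℝ} (hA : A.PosSemidef) (a : ι → ℝ) :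
    0 ≤ ∑ i, ∑ j, a i * A i j * a j := by
  simpa [dotProduct, Matrix.mulVec, Finset.mul_sum, mul_assoc] using hA.dotProduct_mulVec_nonneg a

theorem sq_le_mul_of_posSemidef [DecidableEq ι] {A : Matrix ι ι ℝ} (hA : A.PosSemidef) (i j : ι) :
    A i j ^ 2 ≤ A i i * A j j := by
  have hs : A j i = A i j := by simpa using hA.1.apply i j
  have h : ∀ x : ℝ, 0 ≤ A i i * (x * x) + 2 * A i j * x + A j j := by
    intro x
    have h1 := hA.dotProduct_mulVec_nonneg (Pi.single i x + Pi.single j 1)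
    simp only [star_trivial, Matrix.mulVec_add, add_dotProduct, dotProduct_add,
      Matrix.mulVec_single, single_dotProduct] at h1
    simp only [Pi.smul_apply, Matrix.col_apply, MulOpposite.smul_eq_mul_unop, MulOpposite.unop_op,
      hs] at h1
    linarith
  have h2 := discrim_le_zero h
  rw [discrim] at h2
  linarith

theorem sum_sq_le_trace_sq [DecidableEq ι] {A : Matrix ι ι ℝ} (hA : A.PosSemidef) :
    ∑ i, ∑ j, A i j ^ 2 ≤ A.trace ^ 2 := by
  rw [sq, Matrix.trace, Finset.sum_mul_sum]
  exact Finset.sum_le_sum fun i _ => Finset.sum_le_sum fun j _ => sq_le_mul_of_posSemidef hA i j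

end RealPosSemidef

/-! ### Matrix density with respect to the trace measure -/

section Density

variable {ι : Type*} [Fintype ι] [DecidableEq ι]

theorem IsQuadratic.parallelogram {q : (ι → ℝ) → ℝ} (hq : IsQuadratic q) (a b : ι → ℝ) :
    q (a + b) + q (a - b) = 2 * q a + 2 * q b := by
  rw [hq (a + b), hq (a - b), hq a, hq b]
  simp only [Finset.mul_sum, ← Finset.sum_add_distrib]
  refine Finset.sum_congr rfl fun i _ => Finset.sum_congr rfl fun j _ => ?_
  simp only [Pi.add_apply, Pi.sub_apply]
  ring

theorem IsQuadratic.zero {q : (ι → ℝ) → ℝ} (hq : IsQuadratic q) : q 0 = 0 := by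
  rw [hq 0]; simp

theorem IsQuadratic.single {q : (ι → ℝ) → ℝ} (hq : IsQuadratic q) (i : ι) :
    q (Pi.single i 1) =
      (q (Pi.single i 1 + Pi.single i 1) - q (Pi.single i 1) - q (Pi.single i 1)) / 2 := by
  have h := hq.parallelogram (Pi.single i 1) (Pi.single i 1)
  rw [sub_self, hq.zero] at h
  linarith

theorem integral_sub_sub_div_two {X : Type*} [MeasurableSpace X] {τ : Measure X} {f g h : X → ℂ}
    (hf : Integrable f τ) (hg : Integrable g τ) (hh : Integrable h τ) :
    ∫ u, (f u - g u - h u) / 2 ∂τ = (∫ u, f u ∂τ - ∫ u, g u ∂τ - ∫ u, h u ∂τ) / 2 := by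
  rw [integral_div, integral_sub (f := fun u => f u - g u) (hf.sub hg) hh, integral_sub hf hg]

variable {X : Type*} [TopologicalSpace X] [CompactSpace X] [HasOuterApproxClosed X]
  [MeasurableSpace X] [BorelSpace X]

/-- A quadratic family of finite measures has a matrix density of trace one with respect to its
trace measure. -/
theorem exists_matrix_density {σ : (ι → ℝ) → Measure X} (hσ : ∀ a, IsFiniteMeasure (σ a))
    (hq : ∀ f : C(X, ℝ), IsQuadratic fun a => ∫ u, f u ∂(σ a)) :
    ∃ (τ : Measure X) (N : X → Matrix ι ι ℝ), IsFiniteMeasure τ ∧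
      (∀ i j, Measurable fun u => N u i j) ∧ (∀ᵐ u ∂τ, (N u).PosSemidef ∧ (N u).trace = 1) ∧
      ∀ k : C(X, ℂ), ∀ i j, polarize (fun a => ∫ u, k u ∂(σ a)) i j =
        ∫ u, k u * (N u i j : ℂ) ∂τ := by
  set τ : Measure X := ∑ i, σ (Pi.single i 1) with hτ
  have hτf : IsFiniteMeasure τ := inferInstance
  have hle : ∀ i, σ (Pi.single i 1) ≪ τ := by
    intro i s hs
    rw [hτ, Measure.finsetSum_apply, Finset.sum_eq_zero_iff] at hs
    exact hs i (Finset.mem_univ i)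
  -- The parallelogram law, read as an identity of measures, dominates `σ (eᵢ + eⱼ)` by `2 σ eᵢ + 2
  -- σ eⱼ`.
  have hac : ∀ i j, σ (Pi.single i 1 + Pi.single j 1) ≪ τ := by
    intro i j
    have h1 : σ (Pi.single i 1 + Pi.single j 1) + σ (Pi.single i 1 - Pi.single j 1) =
        (2 : ENNReal) • σ (Pi.single i 1) + (2 : ENNReal) • σ (Pi.single j 1) := by
      have : IsFiniteMeasure ((2 : ENNReal) • σ (Pi.single i 1)) := (σ _).smul_finite (by simp)
      have : IsFiniteMeasure ((2 : ENNReal) • σ (Pi.single j 1)) := (σ _).smul_finite (by simp)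
      refine measure_ext_of_integral_eq fun f => ?_
      rw [integral_add_measure (integrable_continuousMap _ f) (integrable_continuousMap _ f),
        integral_add_measure (integrable_continuousMap _ f) (integrable_continuousMap _ f),
        integral_smul_measure, integral_smul_measure]
      simpa using (hq f).parallelogram (Pi.single i 1) (Pi.single j 1)
    refine (Measure.absolutelyContinuous_of_le (Measure.le_add_right le_rfl)).trans
      (h1 ▸ Measure.AbsolutelyContinuous.add_left ((hle i).smul_left 2) ((hle j).smul_left 2))
  set D : (ι → ℝ) → X → ℝ := fun a u => ((σ a).rnDeriv τ u).toReal with hD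
  have hDm : ∀ a, Measurable (D a) := fun a => (Measure.measurable_rnDeriv _ _).ennreal_toReal
  have hDi : ∀ a, Integrable (D a) τ := fun a => Measure.integrable_toReal_rnDeriv
  have hDint : ∀ a, σ a ≪ τ → ∀ k : C(X, ℂ), ∫ u, k u ∂(σ a) = ∫ u, k u * (D a u : ℂ) ∂τ := by
    intro a ha k
    rw [← integral_rnDeriv_smul ha]
    refine integral_congr_ae (ae_of_all _ fun u => ?_)
    simp only [hD, Complex.real_smul]
    ring
  have hkD : ∀ a, ∀ k : C(X, ℂ), Integrable (fun u => k u * (D a u : ℂ)) τ := fun a k =>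
    (hDi a).ofReal.bdd_mul (c := ‖k‖) k.continuous.aestronglyMeasurable
      (ae_of_all _ fun x => k.norm_coe_le_norm x)
  set N : X → Matrix ι ι ℝ := fun u => Matrix.of fun i j =>
    (D (Pi.single i 1 + Pi.single j 1) u - D (Pi.single i 1) u - D (Pi.single j 1) u) / 2 with hN
  have hNm : ∀ i j, Measurable fun u => N u i j := fun i j =>
    (((hDm _).sub (hDm _)).sub (hDm _)).div_const 2
  have hNi : ∀ i j, Integrable (fun u => N u i j) τ := fun i j =>
    (((hDi _).sub (hDi _)).sub (hDi _)).div_const 2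
  have hNs : ∀ u, (N u).IsSymm := by
    intro u
    ext i j
    simp only [hN, Matrix.transpose_apply, Matrix.of_apply, add_comm (Pi.single (M := fun _ : ι => ℝ) i 1)]
    ring
  have hpol : ∀ k : C(X, ℂ), ∀ i j, polarize (fun a => ∫ u, k u ∂(σ a)) i j =
      ∫ u, k u * (N u i j : ℂ) ∂τ := by
    intro k i j
    rw [polarize, Matrix.of_apply, hDint _ (hac i j), hDint _ (hle i), hDint _ (hle j),
      ← integral_sub_sub_div_two (hkD _ k) (hkD _ k) (hkD _ k)]
    refine integral_congr_ae (ae_of_all _ fun u => ?_)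
    simp only [hN, Matrix.of_apply]
    push_cast; ring
  have hpolr : ∀ f : C(X, ℝ), ∀ i j, ((∫ u, f u ∂(σ (Pi.single i 1 + Pi.single j 1))) -
      (∫ u, f u ∂(σ (Pi.single i 1))) - ∫ u, f u ∂(σ (Pi.single j 1))) / 2 =
      ∫ u, f u * N u i j ∂τ := by
    intro f i j
    have h := hpol ⟨fun u => (f u : ℂ), by fun_prop⟩ i j
    simp only [polarize, Matrix.of_apply, ContinuousMap.coe_mk, integral_complex_ofReal,
      ← Complex.ofReal_mul] at h
    exact_mod_cast h
  have hfN : ∀ f : C(X, ℝ), ∀ i j, Integrable (fun u => f u * N u i j) τ := fun f i j =>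
    (hNi i j).bdd_mul (c := ‖f‖) f.continuous.aestronglyMeasurable
      (ae_of_all _ fun x => f.norm_coe_le_norm x)
  refine ⟨τ, N, hτf, hNm, ?_, hpol⟩
  have hpos : ∀ a : ι → ℝ, ∀ᵐ u ∂τ, 0 ≤ ∑ i, ∑ j, a i * N u i j * a j := by
    intro a
    refine ae_nonneg_of_integral_eq (σ := σ a)
      (Finset.measurable_sum _ fun i _ => Finset.measurable_sum _ fun j _ =>
        ((hNm i j).const_mul _).mul_const _)
      (integrable_finsetSum _ fun i _ => integrable_finsetSum _ fun j _ =>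
        ((hNi i j).const_mul _).mul_const _) fun f => ?_
    refine Eq.trans ?_ (hq f a).symm
    simp only [hpolr, Finset.mul_sum]
    have hi : ∀ i j, Integrable (fun u => f u * (a i * N u i j * a j)) τ := fun i j =>
      (((hfN f i j).const_mul (a i)).mul_const (a j)).congr (ae_of_all _ fun u => by
        simp only; ring)
    rw [integral_finsetSum _ fun i _ => integrable_finsetSum _ fun j _ => hi i j]
    refine Finset.sum_congr rfl fun i _ => ?_
    rw [integral_finsetSum _ fun j _ => hi i j]
    refine Finset.sum_congr rfl fun j _ => ?_
    rw [← integral_const_mul, ← integral_mul_const]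
    congr 1; ext u; ring
  have htr : ∀ f : C(X, ℝ), ∫ u, f u * (N u).trace ∂τ = ∫ u, f u ∂τ := by
    intro f
    simp only [Matrix.trace, Matrix.diag_apply, Finset.mul_sum]
    rw [integral_finsetSum _ fun i _ => hfN f i i, hτ,
      integral_finsetSum_measure fun i _ => integrable_continuousMap _ f]
    refine Finset.sum_congr rfl fun i _ => ?_
    rw [(hq f).single i, hpolr]
  have htrm : Measurable fun u => (N u).trace := Finset.measurable_sum _ fun i _ => hNm i i
  have htri : Integrable (fun u => (N u).trace) τ := integrable_finsetSum _ fun i _ => hNi i i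
  have hftr : ∀ f : C(X, ℝ), Integrable (fun u => f u * (N u).trace) τ := fun f =>
    htri.bdd_mul (c := ‖f‖) f.continuous.aestronglyMeasurable
      (ae_of_all _ fun x => f.norm_coe_le_norm x)
  -- Trace one follows from the sign criterion with the zero measure, applied to `trace - 1` and to
  -- its negative.
  have h1 : ∀ᵐ u ∂τ, 0 ≤ (N u).trace - 1 := by
    refine ae_nonneg_of_integral_eq (σ := 0) (htrm.sub_const 1) (htri.sub (integrable_const 1))
      fun f => ?_
    simp only [mul_sub, mul_one]
    rw [integral_sub (hftr f) (integrable_continuousMap τ f), htr]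
    simp
  have h2 : ∀ᵐ u ∂τ, 0 ≤ 1 - (N u).trace := by
    refine ae_nonneg_of_integral_eq (σ := 0) (htrm.const_sub 1) ((integrable_const 1).sub htri)
      fun f => ?_
    simp only [mul_sub, mul_one]
    rw [integral_sub (integrable_continuousMap τ f) (hftr f), htr]
    simp
  -- The exceptional null set depends on `a`; a countable dense set of vectors and continuity in `a`
  -- give a common one.
  obtain ⟨s, hsc, hsd⟩ := TopologicalSpace.exists_countable_dense (ι → ℝ)
  have h3 : ∀ᵐ u ∂τ, ∀ a ∈ s, 0 ≤ ∑ i, ∑ j, a i * N u i j * a j :=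
    (ae_ball_iff hsc).2 fun a _ => hpos a
  filter_upwards [h1, h2, h3] with u hu1 hu2 hu3
  refine ⟨posSemidef_of_sum_nonneg (hNs u) fun a => ?_, by linarith⟩
  have hcl : IsClosed {a : ι → ℝ | 0 ≤ ∑ i, ∑ j, a i * N u i j * a j} :=
    isClosed_le continuous_const (by fun_prop)
  exact hcl.closure_subset_iff.2 hu3 (hsd a)

end Density

/-! ### Matrix Stieltjes density and integrability at frequency zero -/

section StieltjesDensity

variable {ι : Type*} [Fintype ι] [DecidableEq ι] {S : ℂ → Matrix ι ι ℂ}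

theorem abs_apply_le_one {A : Matrix ι ι ℝ} (hA : A.PosSemidef) (htr : A.trace ≤ 1) (i j : ι) :
    |A i j| ≤ 1 := by
  have h0 : 0 ≤ A.trace := hA.trace_nonneg
  refine abs_le_one_iff_mul_self_le_one.2 ?_
  rw [← sq]
  calc A i j ^ 2 ≤ ∑ j, A i j ^ 2 :=
        Finset.single_le_sum (f := fun j => A i j ^ 2) (fun _ _ => sq_nonneg _) (Finset.mem_univ j)
    _ ≤ ∑ i, ∑ j, A i j ^ 2 := Finset.single_le_sum (f := fun i => ∑ j, A i j ^ 2)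
        (fun _ _ => Finset.sum_nonneg fun _ _ => sq_nonneg _) (Finset.mem_univ i)
    _ ≤ A.trace ^ 2 := sum_sq_le_trace_sq hA
    _ ≤ 1 := pow_le_one₀ h0 htr

theorem IsStieltjesType.exists_density (hS : IsStieltjesType S) :
    ∃ (τ : Measure unitInterval) (N : unitInterval → Matrix ι ι ℝ), IsFiniteMeasure τ ∧
      (∀ i j, Measurable fun u => N u i j) ∧ (∀ u, (N u).PosSemidef ∧ (N u).trace ≤ 1) ∧
      (∀ᵐ u ∂τ, (N u).trace = 1) ∧
      ∀ z ∈ Complex.slitPlane, ∀ i j, S z i j = ∫ u, stieltjesKernel z u * (N u i j : ℂ) ∂τ := by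
  obtain ⟨σ, hσ, hrep, hquad⟩ := hS.exists_measure
  obtain ⟨τ, N, hτ, hNm, hN, hpol⟩ := exists_matrix_density hσ hquad
  obtain ⟨t, ht, htm, ht0⟩ := exists_measurable_superset_of_null (ae_iff.1 hN)
  have htN : ∀ u, u ∉ t → (N u).PosSemidef ∧ (N u).trace = 1 := fun u hu => by
    by_contra h
    exact hu (ht h)
  have hT : ∀ᵐ u ∂τ, u ∈ tᶜ := measure_eq_zero_iff_ae_notMem.1 ht0
  -- Setting the density to `0` on a null set makes positivity hold everywhere, at the price of
  -- trace `≤ 1` instead of `= 1`.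
  refine ⟨τ, tᶜ.indicator N, hτ, fun i j => ?_, fun u => ?_, ?_, fun z hz i j => ?_⟩
  · have hind : (fun u => tᶜ.indicator N u i j) = tᶜ.indicator (fun u => N u i j) := by
      ext u
      by_cases hu : u ∈ t <;> simp [hu]
    rw [hind]
    exact (hNm i j).indicator htm.compl
  · by_cases hu : u ∈ t
    · rw [Set.indicator_of_notMem (by simpa using hu)]
      exact ⟨Matrix.PosSemidef.zero, by simp⟩
    · rw [Set.indicator_of_mem (by exact hu)]
      exact ⟨(htN u hu).1, (htN u hu).2.le⟩
  · filter_upwards [hT] with u hu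
    rw [Set.indicator_of_mem hu]
    exact (htN u hu).2
  · have h := hpol ⟨stieltjesKernel z, continuous_stieltjesKernel hz⟩ i j
    simp only [ContinuousMap.coe_mk, ← hrep _ z hz] at h
    have h2 : polarize (fun a => realForm (S z) a) = S z := polarize_realForm (hS.symm z hz)
    rw [h2] at h
    rw [h]
    refine integral_congr_ae ?_
    filter_upwards [hT] with u hu
    rw [Set.indicator_of_mem hu]

/-- Fatou's lemma along `x = 1 / (n + 1)`, where the kernel tends to `1 / (1 - u)`. The limit is `∞`
at `u = 1`, so a finite bound also excludes an atom there, that is, at frequency `0`. -/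
theorem lintegral_inv_one_sub_le {τ : Measure unitInterval} [IsFiniteMeasure τ] {C : ℝ}
    (hC : ∀ x : ℝ, ∀ hx : 0 < x, ∫ u, realKernel hx u ∂τ ≤ C) :
    ∫⁻ u : unitInterval, (ENNReal.ofReal (1 - u))⁻¹ ∂τ ≤ ENNReal.ofReal C := by
  have hx : ∀ n : ℕ, 0 < 1 / ((n : ℝ) + 1) := fun n => by positivity
  have hpos : ∀ (n : ℕ) (u : unitInterval), 0 < 1 + (u : ℝ) * (1 / ((n : ℝ) + 1) - 1) := by
    intro n u
    rcases eq_or_lt_of_le u.2.2 with h | h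
    · rw [h]; linarith [hx n]
    · nlinarith [hx n, u.2.1, mul_nonneg u.2.1 (hx n).le]
  have hlim : ∀ u : unitInterval, Tendsto (fun n : ℕ => ENNReal.ofReal (realKernel (hx n) u)) atTop
      (𝓝 (ENNReal.ofReal (1 - u))⁻¹) := by
    intro u
    have h1 : Tendsto (fun n : ℕ => 1 + (u : ℝ) * (1 / ((n : ℝ) + 1) - 1)) atTop
        (𝓝 (1 + (u : ℝ) * (0 - 1))) :=
      ((tendsto_one_div_add_atTop_nhds_zero_nat.sub_const 1).const_mul _).const_add 1
    have h2 := ((continuous_inv (G := ENNReal)).tendsto _).comp ((ENNReal.continuous_ofReal.tendsto _).comp h1)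
    have h3 : (1 : ℝ) + (u : ℝ) * (0 - 1) = 1 - u := by ring
    rw [h3] at h2
    refine h2.congr fun n => ?_
    simp only [Function.comp_apply, realKernel, ContinuousMap.coe_mk]
    rw [ENNReal.ofReal_inv_of_pos (hpos n u)]
  have hle : ∀ n : ℕ, ∫⁻ u, ENNReal.ofReal (realKernel (hx n) u) ∂τ ≤ ENNReal.ofReal C := by
    intro n
    rw [← ofReal_integral_eq_lintegral_ofReal (integrable_continuousMap τ _)
      (ae_of_all _ fun u => inv_nonneg.2 (hpos n u).le)]
    exact ENNReal.ofReal_le_ofReal (hC _ _)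
  calc ∫⁻ u : unitInterval, (ENNReal.ofReal (1 - u))⁻¹ ∂τ
      = ∫⁻ u, liminf (fun n : ℕ => ENNReal.ofReal (realKernel (hx n) u)) atTop ∂τ :=
        lintegral_congr fun u => (hlim u).liminf_eq.symm
    _ ≤ liminf (fun n : ℕ => ∫⁻ u, ENNReal.ofReal (realKernel (hx n) u) ∂τ) atTop :=
        lintegral_liminf_le fun n => (realKernel (hx n)).continuous.measurable.ennreal_ofReal
    _ ≤ ENNReal.ofReal C := liminf_le_of_le (by isBoundedDefault) fun b hb => by
        obtain ⟨n, hn⟩ := hb.exists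
        exact hn.trans (hle n)

end StieltjesDensity

/-! ### Transfer from the unit interval to frequencies -/

section HalfLine

/-- The frequency `u⁻¹ - 1` attached to a point of the unit interval. -/
noncomputable def frequency (u : unitInterval) : ℝ := (u : ℝ)⁻¹ - 1

theorem measurable_frequency : Measurable frequency := by
  unfold frequency; fun_prop

/-- The point `(1 + r)⁻¹` of the unit interval, for `r ≥ 0`. -/
noncomputable def ofFrequency (r : ℝ) : unitInterval := Set.projIcc 0 1 zero_le_one (1 + r)⁻¹

theorem measurable_ofFrequency : Measurable ofFrequency := by
  unfold ofFrequency
  exact continuous_projIcc.measurable.comp (by fun_prop)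

theorem ofFrequency_frequency (u : unitInterval) : ofFrequency (frequency u) = u := by
  rw [ofFrequency, frequency, add_sub_cancel, inv_inv, Set.projIcc_val]

theorem frequency_pos {u : unitInterval} (hu : u ∈ Set.Ioo (0 : unitInterval) 1) :
    0 < frequency u := by
  have h0 : (0 : ℝ) < u := hu.1
  have h1 : (u : ℝ) < 1 := hu.2
  exact sub_pos.2 ((one_lt_inv₀ h0).2 h1)

/-- The measure `(1 + r) (frequency_* τ)(dr)` on the open half-line. -/
noncomputable def frequencyMeasure (τ : Measure unitInterval) : Measure ℝ :=
  ((τ.restrict (Set.Ioo 0 1)).map frequency).withDensity fun r => ENNReal.ofReal (1 + r)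

variable {τ : Measure unitInterval}

instance isLocallyFiniteMeasure_frequencyMeasure [IsFiniteMeasure τ] :
    IsLocallyFiniteMeasure (frequencyMeasure τ) :=
  IsLocallyFiniteMeasure.withDensity_ofReal (by fun_prop)

theorem frequencyMeasure_Iic : frequencyMeasure τ (Set.Iic 0) = 0 := by
  refine withDensity_absolutelyContinuous _ _ ?_
  rw [Measure.map_apply measurable_frequency measurableSet_Iic,
    Measure.restrict_apply (measurable_frequency measurableSet_Iic)]
  convert! measure_empty (μ := τ)
  ext u
  simp only [Set.mem_inter_iff, Set.mem_preimage, Set.mem_Iic, Set.mem_empty_iff_false, iff_false]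
  exact fun h => absurd (frequency_pos h.2) (not_lt.2 h.1)

theorem frequencyMeasure_restrict :
    (frequencyMeasure τ).restrict (Set.Ioi 0) = frequencyMeasure τ := by
  refine Measure.restrict_eq_self_of_ae_mem ?_
  have h := measure_eq_zero_iff_ae_notMem.1 (frequencyMeasure_Iic (τ := τ))
  filter_upwards [h] with r hr
  exact (not_le.1 fun h => hr (Set.mem_Iic.2 h) : 0 < r)

theorem lintegral_frequencyMeasure {f : ℝ → ENNReal} (hf : Measurable f) :
    ∫⁻ r, f r ∂(frequencyMeasure τ) =
      ∫⁻ u in Set.Ioo 0 1, ENNReal.ofReal (u : ℝ)⁻¹ * f (frequency u) ∂τ := by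
  rw [frequencyMeasure, lintegral_withDensity_eq_lintegral_mul _ (by fun_prop) hf,
    lintegral_map (by fun_prop) measurable_frequency]
  refine lintegral_congr fun u => ?_
  simp only [Pi.mul_apply, frequency, add_sub_cancel]

theorem integral_frequencyMeasure {f : ℝ → ℂ} (hf : Measurable f) :
    ∫ r, f r ∂(frequencyMeasure τ) =
      ∫ u in Set.Ioo 0 1, ((u : ℝ)⁻¹ : ℂ) * f (frequency u) ∂τ := by
  rw [frequencyMeasure, integral_withDensity_eq_integral_toReal_smul (by fun_prop) (by simp),
    integral_map measurable_frequency.aemeasurable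
      (by exact (by fun_prop : Measurable _).aestronglyMeasurable)]
  refine integral_congr_ae (ae_of_all _ fun u => ?_)
  simp only [frequency, add_sub_cancel]
  rw [ENNReal.toReal_ofReal (inv_nonneg.2 u.2.1), Complex.real_smul]
  push_cast; rfl

theorem integrable_inv_frequencyMeasure [IsFiniteMeasure τ] {C : ℝ}
    (hC : ∀ x : ℝ, ∀ hx : 0 < x, ∫ u, realKernel hx u ∂τ ≤ C) :
    IntegrableOn (fun r : ℝ => r⁻¹) (Set.Ioi 0) (frequencyMeasure τ) := by
  refine ⟨by exact (by fun_prop : Measurable _).aestronglyMeasurable, ?_⟩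
  rw [hasFiniteIntegral_iff_ofReal
    ((ae_restrict_mem measurableSet_Ioi).mono fun r (hr : 0 < r) => inv_nonneg.2 hr.le),
    frequencyMeasure_restrict, lintegral_frequencyMeasure (by fun_prop)]
  refine lt_of_le_of_lt ?_ ((lintegral_inv_one_sub_le hC).trans_lt ENNReal.ofReal_lt_top)
  refine le_trans (le_of_eq ?_) (setLIntegral_le_lintegral (Set.Ioo 0 1) _)
  refine setLIntegral_congr_fun measurableSet_Ioo fun u hu => ?_
  have h0 : (0 : ℝ) < u := hu.1
  have h1 : (0 : ℝ) < 1 - u := sub_pos.2 hu.2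
  rw [← ENNReal.ofReal_mul (inv_nonneg.2 h0.le), ← ENNReal.ofReal_inv_of_pos h1, frequency]
  congr 1
  field_simp

theorem exists_norm_inv_add_le {z : ℂ} (hz : z ∈ Complex.slitPlane) :
    ∃ C : ℝ, ∀ r : ℝ, 0 < r → ‖(z + r)⁻¹‖ ≤ C * (1 + r)⁻¹ := by
  obtain ⟨C, hC⟩ := isCompact_univ.exists_bound_of_continuousOn
    (continuous_stieltjesKernel hz).continuousOn
  refine ⟨C, fun r hr => ?_⟩
  have h1 : 0 < 1 + r := by linarith
  have h2 : (1 + (r : ℂ)) ≠ 0 := by exact_mod_cast h1.ne'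
  have hu : (1 + r)⁻¹ ∈ Set.Icc (0 : ℝ) 1 :=
    ⟨inv_nonneg.2 h1.le, inv_le_one_of_one_le₀ (by linarith)⟩
  have h3 : (z + r)⁻¹ = stieltjesKernel z ⟨(1 + r)⁻¹, hu⟩ * (((1 + r)⁻¹ : ℝ) : ℂ) := by
    rw [stieltjesKernel]
    push_cast
    rw [← mul_inv]
    congr 1
    field_simp
    ring
  rw [h3, norm_mul, Complex.norm_real, Real.norm_of_nonneg hu.1]
  exact mul_le_mul_of_nonneg_right (hC _ trivial) hu.1

end HalfLine

/-! ### The matrix Stieltjes representation -/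

section Representation

variable {ι : Type*} [Fintype ι] [DecidableEq ι] {S : ℂ → Matrix ι ι ℂ}

theorem stieltjesKernel_eq {z : ℂ} {u : unitInterval} (hu : 0 < u) :
    stieltjesKernel z u = ((u : ℝ)⁻¹ : ℂ) * (z + frequency u)⁻¹ := by
  have h : (u : ℂ) ≠ 0 := by exact_mod_cast (show (0 : ℝ) < u from hu).ne'
  rw [stieltjesKernel, frequency, ← mul_inv]
  congr 1
  push_cast
  field_simp
  ring

/-- The kernel equals `1` at `u = 0`, so the atom there (infinite frequency) yields the constant
term; elsewhere `u⁻¹ = 1 + r` is absorbed into the measure. -/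
theorem integral_stieltjesKernel_eq {τ : Measure unitInterval} [IsFiniteMeasure τ]
    (h1 : ∀ᵐ u ∂τ, u ≠ 1) {N : unitInterval → ℝ} (hNm : Measurable N) (hN : ∀ u, |N u| ≤ 1)
    {z : ℂ} (hz : z ∈ Complex.slitPlane) :
    ∫ u, stieltjesKernel z u * (N u : ℂ) ∂τ = ((τ.real {0} * N 0 : ℝ) : ℂ) +
      ∫ r in Set.Ioi (0 : ℝ), (z + r)⁻¹ * (N (ofFrequency r) : ℂ) ∂(frequencyMeasure τ) := by
  have hi : Integrable (fun u => stieltjesKernel z u * (N u : ℂ)) τ :=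
    (integrable_stieltjesKernel τ hz).mul_bdd (c := 1)
      (Complex.measurable_ofReal.comp hNm).aestronglyMeasurable
      (ae_of_all _ fun u => by simpa using hN u)
  rw [← integral_add_compl (measurableSet_singleton (0 : unitInterval)) hi, integral_singleton]
  congr 1
  · simp [stieltjesKernel]
  · have hset : (({0}ᶜ : Set unitInterval)) =ᵐ[τ] Set.Ioo 0 1 := by
      filter_upwards [h1] with u hu
      refine propext ⟨fun h => ⟨lt_of_le_of_ne u.2.1 fun h0 => h h0.symm,
        lt_of_le_of_ne u.2.2 hu⟩, fun h => h.1.ne'⟩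
    rw [setIntegral_congr_set hset, frequencyMeasure_restrict, integral_frequencyMeasure]
    · refine setIntegral_congr_fun measurableSet_Ioo fun u hu => ?_
      simp only [ofFrequency_frequency, stieltjesKernel_eq hu.1, mul_assoc]
    · exact Measurable.mul (by fun_prop)
        (Complex.measurable_ofReal.comp (hNm.comp measurable_ofFrequency))

/-- The data of a matrix Stieltjes representation whose integral is bounded at zero. -/
structure IsStieltjesData (B : Matrix ι ι ℝ) (μ : Measure ℝ) (M : ℝ → Matrix ι ι ℝ) : Prop where
  posSemidef : B.PosSemidef
  isLocallyFinite : IsLocallyFiniteMeasure μ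
  measure_Iic : μ (Set.Iic 0) = 0
  integrable_inv : IntegrableOn (fun r : ℝ => r⁻¹) (Set.Ioi 0) μ
  measurable : ∀ i j, Measurable fun r => M r i j
  density : ∀ r, (M r).PosSemidef ∧ (M r).trace ≤ 1

theorem IsStieltjesType.exists_representation (hS : IsStieltjesType S) {C : ℝ}
    (hC : ∀ x : ℝ, 0 < x → (S x).trace.re ≤ C) :
    ∃ (B : Matrix ι ι ℝ) (μ : Measure ℝ) (M : ℝ → Matrix ι ι ℝ), IsStieltjesData B μ M ∧
      ∀ z ∈ Complex.slitPlane, ∀ i j,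
        S z i j = B i j + ∫ r in Set.Ioi (0 : ℝ), (z + r)⁻¹ * (M r i j : ℂ) ∂μ := by
  obtain ⟨τ, N, hτ, hNm, hN, htr, hrep⟩ := hS.exists_density
  have hC' : ∀ x : ℝ, ∀ hx : 0 < x, ∫ u, realKernel hx u ∂τ ≤ C := by
    intro x hx
    have hs : (x : ℂ) ∈ Complex.slitPlane := Complex.ofReal_mem_slitPlane.2 hx
    refine le_trans (le_of_eq ?_) (hC x hx)
    have h1 : (S x).trace = ((∫ u, realKernel hx u ∂τ : ℝ) : ℂ) := by
      simp only [Matrix.trace, Matrix.diag_apply, hrep x hs]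
      rw [← integral_finsetSum, ← integral_complex_ofReal]
      · refine integral_congr_ae ?_
        filter_upwards [htr] with u hu
        rw [ofReal_realKernel, ← Finset.mul_sum, ← Complex.ofReal_sum]
        rw [Matrix.trace] at hu
        simp only [Matrix.diag_apply] at hu
        rw [hu]; simp
      · intro i _
        exact (integrable_stieltjesKernel τ hs).mul_bdd (c := 1)
          (Complex.measurable_ofReal.comp (hNm i i)).aestronglyMeasurable
          (ae_of_all _ fun u => by simpa using abs_apply_le_one (hN u).1 (hN u).2 i i)
    rw [h1, Complex.ofReal_re]
  have hne : ∀ᵐ u ∂τ, u ≠ 1 := by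
    have h := ae_lt_top (μ := τ) (f := fun u : unitInterval => (ENNReal.ofReal (1 - u))⁻¹)
      (by fun_prop) ((lintegral_inv_one_sub_le hC').trans_lt ENNReal.ofReal_lt_top).ne
    filter_upwards [h] with u hu h1
    simp [h1] at hu
  refine ⟨τ.real {0} • N 0, frequencyMeasure τ, fun r => N (ofFrequency r),
    ⟨(hN 0).1.smul measureReal_nonneg, inferInstance, frequencyMeasure_Iic,
    integrable_inv_frequencyMeasure hC', fun i j => (hNm i j).comp measurable_ofFrequency,
    fun r => hN _⟩, fun z hz i j => ?_⟩
  rw [hrep z hz, integral_stieltjesKernel_eq hne (hNm i j)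
    (fun u => abs_apply_le_one (hN u).1 (hN u).2 i j) hz]
  simp

end Representation

/-! ### Consequences of the representation -/

section StieltjesData

variable {d : ℕ} {B : Matrix (Fin d) (Fin d) ℝ} {μ : Measure ℝ} {M : ℝ → Matrix (Fin d) (Fin d) ℝ}

section Integrability

theorem IsStieltjesData.abs_le_one (h : IsStieltjesData B μ M) (r : ℝ) (i j : Fin d) :
    |M r i j| ≤ 1 :=
  abs_apply_le_one (h.density r).1 (h.density r).2 i j

theorem IsStieltjesData.sum_sq_le_one (h : IsStieltjesData B μ M) (r : ℝ) :
    ∑ i, ∑ j, M r i j ^ 2 ≤ 1 :=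
  (sum_sq_le_trace_sq (h.density r).1).trans
    (pow_le_one₀ (h.density r).1.trace_nonneg (h.density r).2)

theorem IsStieltjesData.integrableOn_mul (h : IsStieltjesData B μ M) {w : ℝ → ℝ}
    (hw : Measurable w) {C : ℝ} (hC : ∀ r, 0 < r → |w r| ≤ C * r⁻¹) (i j : Fin d) :
    IntegrableOn (fun r => w r * M r i j) (Set.Ioi 0) μ := by
  refine Integrable.mono' (h.integrable_inv.const_mul C)
    (hw.mul (h.measurable i j)).aestronglyMeasurable ?_
  filter_upwards [ae_restrict_mem measurableSet_Ioi] with r hr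
  rw [norm_mul, Real.norm_eq_abs, Real.norm_eq_abs]
  exact (mul_le_of_le_one_right (abs_nonneg _) (h.abs_le_one r i j)).trans (hC r hr)

theorem IsStieltjesData.integrableOn_inv_one_add (h : IsStieltjesData B μ M) :
    IntegrableOn (fun r : ℝ => (1 + r)⁻¹) (Set.Ioi 0) μ := by
  refine Integrable.mono' h.integrable_inv (by fun_prop : Measurable _).aestronglyMeasurable ?_
  filter_upwards [ae_restrict_mem measurableSet_Ioi] with r (hr : 0 < r)
  rw [Real.norm_of_nonneg (by positivity)]
  exact inv_anti₀ hr (by linarith)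

theorem IsStieltjesData.integrableOn_inv_add (h : IsStieltjesData B μ M) {z : ℂ}
    (hz : z ∈ Complex.slitPlane) (i j : Fin d) :
    IntegrableOn (fun r : ℝ => (z + r)⁻¹ * (M r i j : ℂ)) (Set.Ioi 0) μ := by
  obtain ⟨C, hC⟩ := exists_norm_inv_add_le hz
  refine Integrable.mono' (h.integrableOn_inv_one_add.const_mul C)
    (Measurable.mul (by fun_prop)
      (Complex.measurable_ofReal.comp (h.measurable i j))).aestronglyMeasurable ?_
  filter_upwards [ae_restrict_mem measurableSet_Ioi] with r hr
  rw [norm_mul]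
  refine (mul_le_of_le_one_right (norm_nonneg _) ?_).trans (hC r hr)
  simpa using h.abs_le_one r i j

theorem IsStieltjesData.integrableOn_dispersion (h : IsStieltjesData B μ M) (ω : ℝ) (i j : Fin d) :
    IntegrableOn (fun r : ℝ => r * M r i j / (r ^ 2 + ω ^ 2)) (Set.Ioi 0) μ := by
  have h1 := h.integrableOn_mul (w := fun r => r / (r ^ 2 + ω ^ 2)) (by fun_prop) (C := 1)
    (fun r hr => ?_) i j
  · exact h1.congr (ae_of_all _ fun r => by simp only; ring)
  · rw [abs_of_nonneg (by positivity), one_mul, div_le_iff₀ (by positivity)]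
    field_simp
    nlinarith [sq_nonneg ω]

theorem IsStieltjesData.integrableOn_attenuation (h : IsStieltjesData B μ M) {ω : ℝ} (hω : ω ≠ 0)
    (i j : Fin d) : IntegrableOn (fun r : ℝ => M r i j / (r ^ 2 + ω ^ 2)) (Set.Ioi 0) μ := by
  have hω' := abs_pos.2 hω
  -- From `r² + ω² ≥ 2 r |ω|`.
  have h1 := h.integrableOn_mul (w := fun r => (r ^ 2 + ω ^ 2)⁻¹) (by fun_prop) (C := (2 * |ω|)⁻¹)
    (fun r hr => ?_) i j
  · exact h1.congr (ae_of_all _ fun r => by simp only; ring)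
  · rw [abs_of_nonneg (by positivity), ← mul_inv]
    refine inv_anti₀ (by positivity) ?_
    nlinarith [sq_nonneg (r - |ω|), sq_abs ω]

end Integrability

section Positivity

theorem IsStieltjesData.posSemidef_integral (h : IsStieltjesData B μ M) {w : ℝ → ℝ}
    (hw : ∀ r, 0 < r → 0 ≤ w r)
    (hi : ∀ i j, IntegrableOn (fun r => w r * M r i j) (Set.Ioi 0) μ) :
    (Matrix.of fun i j => ∫ r in Set.Ioi 0, w r * M r i j ∂μ).PosSemidef := by
  refine posSemidef_of_sum_nonneg ?_ fun a => ?_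
  · ext i j
    have hs : ∀ r, M r j i = M r i j := fun r => by simpa using (h.density r).1.1.apply i j
    simp only [Matrix.transpose_apply, Matrix.of_apply, hs]
  · have h1 : ∑ i, ∑ j, a i * (∫ r in Set.Ioi 0, w r * M r i j ∂μ) * a j =
        ∫ r in Set.Ioi 0, ∑ i, ∑ j, a i * (w r * M r i j) * a j ∂μ := by
      rw [integral_finsetSum _ fun i _ => integrable_finsetSum _ fun j _ =>
        ((hi i j).const_mul (a i)).mul_const (a j)]
      refine Finset.sum_congr rfl fun i _ => ?_
      rw [integral_finsetSum _ fun j _ => ((hi i j).const_mul (a i)).mul_const (a j)]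
      refine Finset.sum_congr rfl fun j _ => ?_
      rw [integral_mul_const, integral_const_mul]
    simp only [Matrix.of_apply, h1]
    refine setIntegral_nonneg measurableSet_Ioi fun r hr => ?_
    have h2 := mul_nonneg (hw r hr) (sum_nonneg_of_posSemidef (h.density r).1 a)
    simp only [Finset.mul_sum] at h2
    refine h2.trans_eq (Finset.sum_congr rfl fun i _ => Finset.sum_congr rfl fun j _ => by ring)

theorem IsStieltjesData.posSemidef_dispersionMatrix (h : IsStieltjesData B μ M) (ω : ℝ) :
    (dispersionMatrix B μ M ω).PosSemidef := by
  have he : ∀ r i j, r * M r i j / (r ^ 2 + ω ^ 2) = r / (r ^ 2 + ω ^ 2) * M r i j := by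
    intros; ring
  have h1 := h.posSemidef_integral (w := fun r => r / (r ^ 2 + ω ^ 2)) (fun r hr => by positivity)
    fun i j => by simpa only [he] using h.integrableOn_dispersion ω i j
  convert! h.posSemidef.add h1 using 1
  ext i j
  simp [dispersionMatrix, he]

theorem IsStieltjesData.posSemidef_attenuationMatrix (h : IsStieltjesData B μ M) (ω : ℝ) :
    (attenuationMatrix μ M ω).PosSemidef := by
  rcases eq_or_ne ω 0 with rfl | hω
  · convert! Matrix.PosSemidef.zero using 1
    ext i j
    simp [attenuationMatrix]
  have he : ∀ r i j, M r i j / (r ^ 2 + ω ^ 2) = (r ^ 2 + ω ^ 2)⁻¹ * M r i j := by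
    intros; ring
  have h1 := h.posSemidef_integral (w := fun r => (r ^ 2 + ω ^ 2)⁻¹) (fun r hr => by positivity)
    fun i j => by simpa only [he] using h.integrableOn_attenuation hω i j
  convert! h1.smul (sq_nonneg ω) using 1
  ext i j
  simp [attenuationMatrix, he]

theorem posSemidef_map_ofReal {A : Matrix (Fin d) (Fin d) ℝ} (hA : A.PosSemidef) :
    (A.map Complex.ofReal).PosSemidef := by
  have hs : A.IsSymm := by
    have h := hA.1
    rwa [Matrix.IsHermitian, Matrix.conjTranspose_eq_transpose_of_trivial] at h
  refine Matrix.PosSemidef.of_dotProduct_mulVec_nonneg ?_ fun v => ?_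
  · ext i j
    simp [hs.apply i j]
  · rw [star_dotProduct_mulVec_of_isSymm (hs.map _), realForm_map_ofReal, realForm_map_ofReal,
      ← Complex.ofReal_add]
    exact Complex.zero_le_real.2
      (add_nonneg (sum_nonneg_of_posSemidef hA _) (sum_nonneg_of_posSemidef hA _))

end Positivity

section CutPlane

/-- The function `z ↦ z S(z)` has the imaginary part of a complete Bernstein function. -/
theorem IsStieltjesData.posSemidef_im_smul_matIm (h : IsStieltjesData B μ M)
    {S : Matrix (Fin d) (Fin d) ℂ} {z : ℂ} (hz : z ∈ Complex.slitPlane)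
    (hS : ∀ i j, S i j = B i j + ∫ r in Set.Ioi (0 : ℝ), (z + r)⁻¹ * (M r i j : ℂ) ∂μ) :
    ((z.im : ℂ) • matIm (z • S)).PosSemidef := by
  have hne : ∀ r : ℝ, 0 < r → z + r ≠ 0 := fun r hr h0 => by
    obtain hz | hz := Complex.mem_slitPlane_iff.1 hz
    · have := congrArg Complex.re h0
      simp at this; linarith
    · have := congrArg Complex.im h0
      simp at this; exact hz this
  have him : ∀ r : ℝ, 0 < r → (z * (z + r)⁻¹).im = z.im * (r * (Complex.normSq (z + r))⁻¹) := by
    intro r hr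
    rw [Complex.mul_im, Complex.inv_re, Complex.inv_im]
    simp
    ring
  have hMs : ∀ r i j, M r j i = M r i j := fun r i j => by simpa using (h.density r).1.1.apply i j
  have hBs : ∀ i j, B j i = B i j := fun i j => by simpa using h.posSemidef.1.apply i j
  have hSs : ∀ i j, S j i = S i j := fun i j => by simp only [hS, hMs, hBs]
  have hi : ∀ i j, IntegrableOn (fun r : ℝ => (r * (Complex.normSq (z + r))⁻¹) * M r i j)
      (Set.Ioi 0) μ := by
    obtain ⟨C, hC⟩ := exists_norm_inv_add_le hz
    intro i j
    refine h.integrableOn_mul (C := C ^ 2) (by fun_prop) (fun r hr => ?_) i j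
    rw [abs_of_nonneg (mul_nonneg hr.le (inv_nonneg.2 (Complex.normSq_nonneg _))),
      Complex.normSq_eq_norm_sq, ← inv_pow, ← norm_inv]
    have h1 : ‖(z + r)⁻¹‖ ^ 2 ≤ (C * (1 + r)⁻¹) ^ 2 := by gcongr; exact hC r hr
    have h2 : ((1 + r)⁻¹) ^ 2 ≤ r⁻¹ * r⁻¹ := by
      rw [← sq]; gcongr; linarith
    calc r * ‖(z + r)⁻¹‖ ^ 2 ≤ r * (C ^ 2 * (r⁻¹ * r⁻¹)) := by
          gcongr
          rw [mul_pow] at h1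
          exact h1.trans (by gcongr)
      _ = C ^ 2 * r⁻¹ := by field_simp
  -- By symmetry `matIm` is the entrywise imaginary part, so the matrix in question is `(Im z)²`
  -- times `B + ∫ r |z + r|⁻² M dμ`.
  have h1 := posSemidef_map_ofReal ((h.posSemidef.add (h.posSemidef_integral
    (fun r hr => mul_nonneg hr.le (inv_nonneg.2 (Complex.normSq_nonneg (z + r)))) hi)).smul
      (mul_self_nonneg z.im))
  convert! h1 using 1
  ext i j
  have h2 : matIm (z • S) i j = ((z * S i j).im : ℂ) := by
    rw [matIm, Matrix.smul_apply, Matrix.sub_apply, Matrix.conjTranspose_apply, Matrix.smul_apply,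
      Matrix.smul_apply, hSs, smul_eq_mul, smul_eq_mul, Complex.star_def, Complex.sub_conj]
    push_cast
    have := Complex.I_ne_zero
    field_simp
  have h3 : (z * S i j).im = z.im * (B i j +
      ∫ r in Set.Ioi 0, (r * (Complex.normSq (z + r))⁻¹) * M r i j ∂μ) := by
    rw [hS, mul_add, Complex.add_im, Complex.im_mul_ofReal, ← integral_const_mul, mul_add,
      ← integral_const_mul]
    congr 1
    have h4 := integral_im ((h.integrableOn_inv_add hz i j).const_mul z)
    refine h4.symm.trans (setIntegral_congr_fun measurableSet_Ioi fun r hr => ?_)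
    simp only [RCLike.im_to_complex]
    rw [← mul_assoc, Complex.im_mul_ofReal, him r hr]
    ring
  simp only [Matrix.smul_apply, h2, h3, Matrix.map_apply, Matrix.add_apply, Matrix.of_apply,
    smul_eq_mul]
  push_cast
  ring

/-- The splitting on the imaginary axis into dispersion and attenuation. -/
theorem IsStieltjesData.smul_eq_dispersion_add_attenuation (h : IsStieltjesData B μ M)
    {S : Matrix (Fin d) (Fin d) ℂ} {ω : ℝ} (hω : ω ≠ 0)
    (hS : ∀ i j, S i j = B i j +
      ∫ r in Set.Ioi (0 : ℝ), (-Complex.I * ω + r)⁻¹ * (M r i j : ℂ) ∂μ) :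
    (-Complex.I * ω) • S = (-Complex.I * ω) • (dispersionMatrix B μ M ω).map Complex.ofReal +
      (attenuationMatrix μ M ω).map Complex.ofReal := by
  ext i j
  have h1 : ∫ r in Set.Ioi (0 : ℝ), (-Complex.I * ω + r)⁻¹ * (M r i j : ℂ) ∂μ =
      ((∫ r in Set.Ioi (0 : ℝ), r * M r i j / (r ^ 2 + ω ^ 2) ∂μ : ℝ) : ℂ) +
        Complex.I * ω * ((∫ r in Set.Ioi (0 : ℝ), M r i j / (r ^ 2 + ω ^ 2) ∂μ : ℝ) : ℂ) := by
    rw [← integral_complex_ofReal, ← integral_complex_ofReal, ← integral_const_mul, ← integral_add]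
    · refine setIntegral_congr_fun measurableSet_Ioi fun r (hr : 0 < r) => ?_
      have h2 : ((r : ℂ) ^ 2 + (ω : ℂ) ^ 2) ≠ 0 := by
        exact_mod_cast (by positivity : r ^ 2 + ω ^ 2 ≠ 0)
      have h3 : (-Complex.I * ω + r) * (r + Complex.I * ω) = (r : ℂ) ^ 2 + (ω : ℂ) ^ 2 := by
        linear_combination -(ω : ℂ) ^ 2 * Complex.I_sq
      have h4 : (-Complex.I * ω + r : ℂ) ≠ 0 := left_ne_zero_of_mul (h3 ▸ h2)
      have h5 : (-Complex.I * ω + r : ℂ)⁻¹ = (r + Complex.I * ω) / ((r : ℂ) ^ 2 + (ω : ℂ) ^ 2) := by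
        rw [eq_div_iff h2, ← h3, inv_mul_cancel_left₀ h4]
      simp only [h5]
      push_cast
      ring
    · exact (h.integrableOn_dispersion ω i j).ofReal
    · exact (h.integrableOn_attenuation hω i j).ofReal.const_mul _
  simp only [Matrix.smul_apply, Matrix.add_apply, Matrix.map_apply, dispersionMatrix,
    attenuationMatrix, Matrix.of_apply, hS, h1, smul_eq_mul]
  push_cast
  linear_combination -(ω : ℂ) ^ 2 *
    ((∫ r in Set.Ioi (0 : ℝ), M r i j / (r ^ 2 + ω ^ 2) ∂μ : ℝ) : ℂ) * Complex.I_sq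

end CutPlane

end StieltjesData

/-! ### Complete Bernstein functions from Stieltjes functions -/

section CompleteBernstein

variable {d : ℕ}

theorem IsStieltjesType.exists_posSemidef {S : ℂ → Matrix (Fin d) (Fin d) ℂ}
    (hS : IsStieltjesType S) {x : ℝ} (hx : 0 < x) :
    ∃ R : Matrix (Fin d) (Fin d) ℝ, R.PosSemidef ∧ S x = R.map Complex.ofReal := by
  have hs : (x : ℂ) ∈ Complex.slitPlane := Complex.ofReal_mem_slitPlane.2 hx
  have hR : S x = ((S x).map Complex.re).map Complex.ofReal := by
    ext i j
    have h := congrFun (congrFun (hS.conj x hs) i) j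
    rw [Complex.star_def, Complex.conj_ofReal] at h
    exact (Complex.conj_eq_iff_re.1 h.symm).symm
  refine ⟨(S x).map Complex.re, posSemidef_of_sum_nonneg ((hS.symm x hs).map _) fun a => ?_, hR⟩
  have h := hS.nonneg a ((√x : ℝ) : ℂ) (by simpa using hx)
  rw [← Complex.ofReal_pow, Real.sq_sqrt hx.le, hR, realForm_map_ofReal, ← Complex.ofReal_mul,
    Complex.ofReal_re] at h
  exact nonneg_of_mul_nonneg_right h (Real.sqrt_pos.2 hx)

theorem IsStieltjesType.norm_apply_le {S : ℂ → Matrix (Fin d) (Fin d) ℂ}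
    (hS : IsStieltjesType S) {x : ℝ} (hx : 0 < x) (i j : Fin d) : ‖S x i j‖ ≤ (S x).trace.re := by
  obtain ⟨R, hR, hSR⟩ := hS.exists_posSemidef hx
  have h1 : (S x).trace.re = R.trace := by
    simp [hSR, Matrix.trace]
  rw [h1, hSR, Matrix.map_apply, Complex.norm_real, Real.norm_eq_abs]
  refine abs_le_of_sq_le_sq ?_ hR.trace_nonneg
  calc R i j ^ 2 ≤ ∑ j, R i j ^ 2 :=
        Finset.single_le_sum (f := fun j => R i j ^ 2) (fun _ _ => sq_nonneg _) (Finset.mem_univ j)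
    _ ≤ ∑ i, ∑ j, R i j ^ 2 := Finset.single_le_sum (f := fun i => ∑ j, R i j ^ 2)
        (fun _ _ => Finset.sum_nonneg fun _ _ => sq_nonneg _) (Finset.mem_univ i)
    _ ≤ R.trace ^ 2 := sum_sq_le_trace_sq hR

/-- On the positive axis `S` is positive semi-definite, so its entries are bounded by the trace and
`x S(x)` tends to `0`. -/
theorem IsStieltjesType.isMvCBF {S : ℂ → Matrix (Fin d) (Fin d) ℂ} (hS : IsStieltjesType S) {C : ℝ}
    (hC : ∀ x : ℝ, 0 < x → (S x).trace.re ≤ C)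
    (him : ∀ z ∈ Complex.slitPlane, ((z.im : ℂ) • matIm (z • S z)).PosSemidef) :
    IsMvCBF fun x : ℝ => (x : ℂ) • S x where
  real x hx := by
    rcases hx.eq_or_lt with rfl | hx
    · exact ⟨0, by ext; simp⟩
    · obtain ⟨R, -, hR⟩ := hS.exists_posSemidef hx
      refine ⟨x • R, ?_⟩
      ext i j
      simp [hR]
  continuation := ⟨fun z => z • S z, fun i j => (differentiableOn_id.mul
    (hS.differentiableOn i j)).analyticOnNhd Complex.isOpen_slitPlane, fun _ _ => rfl, him⟩
  limit_zero := by
    refine tendsto_pi_nhds.2 fun i => tendsto_pi_nhds.2 fun j => ?_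
    have h1 : Tendsto (fun x : ℝ => x * C) (𝓝[>] 0) (𝓝 0) := by
      have h2 : Tendsto (fun x : ℝ => x * C) (𝓝 0) (𝓝 (0 * C)) :=
        (continuous_mul_const C).tendsto 0
      rw [zero_mul] at h2
      exact h2.mono_left nhdsWithin_le_nhds
    have h3 : Tendsto (fun x : ℝ => (x : ℂ) * S x i j) (𝓝[>] 0) (𝓝 0) := by
      refine squeeze_zero_norm' ?_ h1
      filter_upwards [self_mem_nhdsWithin] with x (hx : 0 < x)
      rw [norm_mul, Complex.norm_real, Real.norm_of_nonneg hx.le]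
      exact mul_le_mul_of_nonneg_left ((hS.norm_apply_le hx i j).trans (hC x hx)) hx.le
    simpa using h3
  zero_nonneg := by
    simp only [Complex.ofReal_zero, zero_smul]
    exact Matrix.PosSemidef.zero

theorem IsSectorial.isStieltjesType {Q : ℂ → Matrix (Fin d) (Fin d) ℂ} (hQ : IsSectorial Q)
    {ρ : ℝ} (hρ : 0 ≤ ρ) : IsStieltjesType fun z => (ρ : ℂ) • (principalSqrt (Q z))⁻¹ where
  differentiableOn i j := by
    have h := differentiableOn_pi.1 (differentiableOn_pi.1 hQ.differentiableOn_inv i) j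
    exact h.const_mul (ρ : ℂ)
  symm z hz := (hQ.inv_isSymm hz).smul _
  conj z hz := by
    rw [hQ.inv_conj hz]
    ext i j
    simp
  nonneg a w hw := by
    rw [realForm_smul, mul_left_comm, Complex.re_ofReal_mul]
    refine mul_nonneg hρ ?_
    by_cases ha : a = 0
    · simp [ha, realForm]
    · exact (hQ.re_mul_realForm_inv_pos ha hw).le

theorem waveMatrix_eq_smul (ρ : ℝ) (Q : ℂ → Matrix (Fin d) (Fin d) ℂ) (z : ℂ) :
    waveMatrix ρ Q z = z • ((ρ : ℂ) • (principalSqrt (Q z))⁻¹) := by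
  rw [waveMatrix, smul_smul, mul_comm]

theorem realForm_single (A : Matrix (Fin d) (Fin d) ℂ) (i : Fin d) :
    realForm A (Pi.single i 1) = A i i := by
  rw [realForm, Finset.sum_eq_single i, Finset.sum_eq_single i]
  · simp
  · intro l _ hl; simp [hl]
  · simp
  · intro k _ hk; simp [hk]
  · simp

theorem IsSectorial.re_trace_inv_le {Q : ℂ → Matrix (Fin d) (Fin d) ℂ} (hQ : IsSectorial Q)
    {ρ δ x : ℝ} (hρ : 0 ≤ ρ) (hδ : 0 < δ) (hx : 0 < x)
    (hle : ∀ a : Fin d → ℝ, δ * ∑ i, a i ^ 2 ≤ (realForm (Q x) a).re) :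
    ((ρ : ℂ) • (principalSqrt (Q x))⁻¹).trace.re ≤ ρ * (d * (1 / √δ)) := by
  rw [Matrix.trace_smul, smul_eq_mul, Complex.re_ofReal_mul]
  refine mul_le_mul_of_nonneg_left ?_ hρ
  rw [Matrix.trace, Complex.re_sum]
  calc ∑ i, ((principalSqrt (Q x))⁻¹.diag i).re ≤ ∑ _i : Fin d, 1 / √δ := by
        refine Finset.sum_le_sum fun i _ => ?_
        have h := hQ.re_realForm_inv_le hδ hx hle (Pi.single i 1)
        rw [realForm_single] at h
        refine h.trans_eq ?_
        congr 1
        rw [Finset.sum_eq_single i] <;> simp +contextual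
    _ = d * (1 / √δ) := by simp

end CompleteBernstein

/-! ### The relaxation modulus and its acoustic matrix -/

section Modulus

variable {G : ℝ → Tensor4 ℝ}

/-- Complete monotonicity is assumed for symmetric strains only, whereas the acoustic form uses the
non-symmetric `a ⊗ n`; the minor symmetries bridge the gap. -/
theorem quadForm_symmetrize {T : Tensor4 ℝ} (hT : HasElasticSymmetry T)
    (e : Matrix (Fin 3) (Fin 3) ℝ) : quadForm T ((1 / 2 : ℝ) • (e + e.transpose)) = quadForm T e := by
  have h1 : ∀ i j k l, T j i k l = T i j k l := fun i j k l => hT.minor_left j i k l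
  have h2 : ∀ i j k l, T i j l k = T i j k l := fun i j k l => hT.minor_right i j l k
  have hb : ∀ e f : Matrix (Fin 3) (Fin 3) ℝ,
      ∑ i, ∑ j, ∑ k, ∑ l, e j i * T i j k l * f k l = ∑ i, ∑ j, ∑ k, ∑ l, e i j * T i j k l * f k l := by
    intro e f
    rw [Finset.sum_comm]
    simp only [h1]
  have hc : ∀ e f : Matrix (Fin 3) (Fin 3) ℝ,
      ∑ i, ∑ j, ∑ k, ∑ l, e i j * T i j k l * f l k = ∑ i, ∑ j, ∑ k, ∑ l, e i j * T i j k l * f k l := by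
    intro e f
    refine Finset.sum_congr rfl fun i _ => Finset.sum_congr rfl fun j _ => ?_
    rw [Finset.sum_comm]
    simp only [h2]
  have h4 : ∀ i j k l, ((1 / 2 : ℝ) • (e + e.transpose)) i j * T i j k l *
      ((1 / 2 : ℝ) • (e + e.transpose)) k l = 1 / 4 * (e i j * T i j k l * e k l +
        e j i * T i j k l * e k l + (e i j * T i j k l * e l k + e j i * T i j k l * e l k)) := by
    intro i j k l
    simp only [Matrix.smul_apply, Matrix.add_apply, Matrix.transpose_apply, smul_eq_mul]
    ring
  have h5 := hb e e.transpose
  simp only [Matrix.transpose_apply] at h5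
  simp only [quadForm, h4, ← Finset.mul_sum, Finset.sum_add_distrib, hb, hc, h5]
  ring

theorem isSymm_symmetrize (e : Matrix (Fin 3) (Fin 3) ℝ) :
    ((1 / 2 : ℝ) • (e + e.transpose)).IsSymm :=
  Matrix.IsSymm.smul (Matrix.isSymm_add_transpose_self e) _

theorem IsLICMModulus.exists_licm (hG : IsLICMModulus G) (e : Matrix (Fin 3) (Fin 3) ℝ) :
    ∃ f, IsLICM f ∧ ∀ t, 0 < t → f t = quadForm (G t) e :=
  ⟨_, hG.licm _ (isSymm_symmetrize e), fun t ht => quadForm_symmetrize (hG.symm t ht) e⟩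

/-- Viewing the tensor as a matrix indexed by pairs gives integrability of every single component by
polarization. -/
theorem IsLICMModulus.isLICMMatrix_pair (hG : IsLICMModulus G) :
    IsLICMMatrix fun t => Matrix.of fun (a b : Fin 3 × Fin 3) => G t a.1 a.2 b.1 b.2 where
  symm t ht := by
    ext a b
    exact (hG.symm t ht).major _ _ _ _
  licm a := by
    obtain ⟨f, hf, hfe⟩ := hG.exists_licm (Matrix.of fun i j => a (i, j))
    refine ⟨f, hf, fun t ht => ?_⟩
    rw [hfe t ht]
    simp only [quadForm, Fintype.sum_prod_type, Matrix.of_apply]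

theorem IsLICMModulus.integrableOn (hG : IsLICMModulus G) {p : ℂ} (hp : 0 < p.re)
    (i j k l : Fin 3) :
    IntegrableOn (fun t : ℝ => Complex.exp (-p * t) * (G t i j k l : ℂ)) (Set.Ioi 0) :=
  hG.isLICMMatrix_pair.integrableOn_entry hp (i, j) (k, l)

/-- The real matrix `T_ijrs n_j n_s`, indexed by `i, r`. -/
noncomputable def acoustic (n : Fin 3 → ℝ) (T : Tensor4 ℝ) : Matrix (Fin 3) (Fin 3) ℝ :=
  Matrix.of fun i r => ∑ j, ∑ s, T i j r s * n j * n s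

theorem sum_acoustic (n : Fin 3 → ℝ) (T : Tensor4 ℝ) (a : Fin 3 → ℝ) :
    ∑ i, ∑ r, a i * acoustic n T i r * a r =
      ∑ i, ∑ j, ∑ r, ∑ s, T i j r s * n j * n s * a i * a r := by
  refine Finset.sum_congr rfl fun i _ => ?_
  rw [Finset.sum_comm (γ := Fin 3)]
  refine Finset.sum_congr rfl fun r _ => ?_
  simp only [acoustic, Matrix.of_apply, Finset.mul_sum, Finset.sum_mul]
  refine Finset.sum_congr rfl fun j _ => Finset.sum_congr rfl fun s _ => ?_
  ring

theorem sum_acoustic_eq_quadForm (n : Fin 3 → ℝ) (T : Tensor4 ℝ) (a : Fin 3 → ℝ) :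
    ∑ i, ∑ r, a i * acoustic n T i r * a r = quadForm T (Matrix.of fun i j => a i * n j) := by
  rw [sum_acoustic, quadForm]
  refine Finset.sum_congr rfl fun i _ => Finset.sum_congr rfl fun j _ =>
    Finset.sum_congr rfl fun r _ => Finset.sum_congr rfl fun s _ => ?_
  simp only [Matrix.of_apply]
  ring

theorem IsLICMModulus.isLICMMatrix_acoustic (hG : IsLICMModulus G) (n : Fin 3 → ℝ) :
    IsLICMMatrix fun t => acoustic n (G t) where
  symm t ht := by
    ext i r
    simp only [Matrix.transpose_apply, acoustic, Matrix.of_apply]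
    rw [Finset.sum_comm]
    refine Finset.sum_congr rfl fun j _ => Finset.sum_congr rfl fun s _ => ?_
    rw [(hG.symm t ht).major]
    ring
  licm a := by
    obtain ⟨f, hf, hfe⟩ := hG.exists_licm (Matrix.of fun i j => a i * n j)
    exact ⟨f, hf, fun t ht => by rw [hfe t ht, sum_acoustic_eq_quadForm]⟩

theorem IsLICMModulus.acoustic_le {Ginf : Tensor4 ℝ} (hG : IsLICMModulus G)
    (hlim : Tendsto G atTop (𝓝 Ginf)) (n a : Fin 3 → ℝ) {t : ℝ} (ht : 0 < t) :
    ∑ i, ∑ r, a i * acoustic n Ginf i r * a r ≤ ∑ i, ∑ r, a i * acoustic n (G t) i r * a r := by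
  obtain ⟨f, hf, hfe⟩ := (hG.isLICMMatrix_acoustic n).licm a
  have hcont : Continuous fun T : Tensor4 ℝ => ∑ i, ∑ r, a i * acoustic n T i r * a r := by
    simp only [sum_acoustic]
    fun_prop
  rw [← hfe t ht]
  refine le_of_tendsto ((hcont.tendsto Ginf).comp hlim) ?_
  filter_upwards [eventually_ge_atTop t] with s hs
  have hs0 := ht.trans_le hs
  simp only [Function.comp_apply, ← hfe s hs0]
  exact hf.antitone ht hs0 hs

theorem IsLICMModulus.contract_complexModulus (hG : IsLICMModulus G)
    (n : EuclideanSpace ℝ (Fin 3)) {p : ℂ} (hp : 0 < p.re) :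
    contract n (complexModulus G p) = p • laplaceMatrix (fun t => acoustic n (G t)) p := by
  ext i r
  simp only [contract, complexModulus, laplaceMatrix, acoustic, Matrix.of_apply, Matrix.smul_apply,
    smul_eq_mul]
  have h1 : ∀ t : ℝ, Complex.exp (-p * t) *
      ((∑ j, ∑ s, G t i j r s * n j * n s : ℝ) : ℂ) =
        ∑ j, ∑ s, Complex.exp (-p * t) * (G t i j r s : ℂ) * ((n j : ℂ) * (n s : ℂ)) := by
    intro t
    push_cast
    simp only [Finset.mul_sum]
    exact Finset.sum_congr rfl fun j _ => Finset.sum_congr rfl fun s _ => by ring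
  have hi := fun j s => (hG.integrableOn hp i j r s).mul_const ((n j : ℂ) * (n s : ℂ))
  simp only [h1]
  rw [integral_finsetSum _ fun j _ => integrable_finsetSum _ fun s _ => hi j s, Finset.mul_sum]
  refine Finset.sum_congr rfl fun j _ => ?_
  rw [integral_finsetSum _ fun s _ => hi j s, Finset.mul_sum]
  refine Finset.sum_congr rfl fun s _ => ?_
  rw [integral_mul_const]
  ring

theorem exists_lower_bound_of_pos {ι : Type*} [Fintype ι] {A : Matrix ι ι ℝ} (hA : A.IsSymm)
    (hpos : ∀ a : ι → ℝ, a ≠ 0 → 0 < ∑ i, ∑ j, a i * A i j * a j) :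
    ∃ δ > 0, ∀ a : ι → ℝ, δ * ∑ i, a i ^ 2 ≤ ∑ i, ∑ j, a i * A i j * a j := by
  have hacc : Accretive (A.map Complex.ofReal) :=
    accretive_of_isSymm (hA.map _) fun a ha => by
      rw [realForm_map_ofReal, Complex.ofReal_re]; exact hpos a ha
  obtain ⟨δ, hδ, h⟩ := hacc.exists_lower_bound
  refine ⟨δ, hδ, fun a => ?_⟩
  have h1 := h fun i => (a i : ℂ)
  rw [← realForm_eq_star_dotProduct, realForm_map_ofReal, Complex.ofReal_re] at h1
  simpa using h1

end Modulus

end Viscoelastic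

theorem mainTheorem3
    (ρ : ℝ) (hρ : 0 < ρ)
    (G : ℝ → Viscoelastic.Tensor4 ℝ) (hG : Viscoelastic.IsLICMModulus G)
    (Ginf : Viscoelastic.Tensor4 ℝ) (hlim : Tendsto G atTop (𝓝 Ginf))
    (hell : Viscoelastic.StronglyElliptic Ginf)
    (n : EuclideanSpace ℝ (Fin 3)) (hn : ‖n‖ = 1) :
    -- the Laplace transform of `G` converges for `Re p > 0`
    (∀ p : ℂ, 0 < p.re → ∀ i j k l,
      IntegrableOn (fun t : ℝ => Complex.exp (-p * t) * (G t i j k l : ℂ)) (Set.Ioi 0)) ∧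
    -- `Q` is the analytic continuation of `Q_n(p)` to the cut plane
    ∃ Q : ℂ → Matrix (Fin 3) (Fin 3) ℂ,
      Viscoelastic.AnalyticOnCutPlane Q ∧
      (∀ p : ℂ, 0 < p.re →
        Q p = Viscoelastic.contract n (Viscoelastic.complexModulus G p)) ∧
      -- `Q^{-1/2}`, hence `K_n`, is well defined on the cut plane, and `K_n` is analytic there
      (∀ z ∈ Complex.slitPlane,
        Viscoelastic.IsPrincipalSqrt (Q z) (Viscoelastic.principalSqrt (Q z)) ∧
        IsUnit (Viscoelastic.principalSqrt (Q z))) ∧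
      Viscoelastic.AnalyticOnCutPlane (Viscoelastic.waveMatrix ρ Q) ∧
      -- `K_n` is a matrix-valued complete Bernstein function
      Viscoelastic.IsMvCBF (fun x : ℝ => Viscoelastic.waveMatrix ρ Q x) ∧
      -- its integral representation, and the dispersion and attenuation matrices
      ∃ (B : Matrix (Fin 3) (Fin 3) ℝ) (μ : Measure ℝ) (M : ℝ → Matrix (Fin 3) (Fin 3) ℝ),
        B.PosSemidef ∧
        IsLocallyFiniteMeasure μ ∧ μ (Set.Iic 0) = 0 ∧
        IntegrableOn (fun r : ℝ => (1 + r)⁻¹) (Set.Ioi 0) μ ∧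
        (∀ i j, Measurable fun r => M r i j) ∧
        (∀ᵐ r ∂μ, (M r).PosSemidef ∧ ∑ i, ∑ j, (M r i j) ^ 2 ≤ 1) ∧
        (∀ z ∈ Complex.slitPlane, ∀ i j,
          IntegrableOn (fun r : ℝ => (z + r)⁻¹ * (M r i j : ℂ)) (Set.Ioi 0) μ ∧
          Viscoelastic.waveMatrix ρ Q z i j =
            z * (B i j : ℂ) + z * ∫ r in Set.Ioi (0 : ℝ), (z + r)⁻¹ * (M r i j : ℂ) ∂μ) ∧
        ∀ ω : ℝ,
          (∀ i j, IntegrableOn (fun r : ℝ => r * M r i j / (r ^ 2 + ω ^ 2)) (Set.Ioi 0) μ) ∧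
          (ω ≠ 0 → ∀ i j,
            IntegrableOn (fun r : ℝ => M r i j / (r ^ 2 + ω ^ 2)) (Set.Ioi 0) μ) ∧
          Viscoelastic.waveMatrix ρ Q (-Complex.I * ω) =
            (-Complex.I * ω) •
              (Viscoelastic.dispersionMatrix B μ M ω).map Complex.ofReal +
            (Viscoelastic.attenuationMatrix μ M ω).map Complex.ofReal ∧
          (Viscoelastic.dispersionMatrix B μ M ω).PosSemidef ∧
          (Viscoelastic.attenuationMatrix μ M ω).PosSemidef := by
  have hn0 : (n : Fin 3 → ℝ) ≠ 0 := by
    intro h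
    have : n = 0 := by ext i; exact congrFun h i
    rw [this, norm_zero] at hn
    exact zero_ne_one hn
  have hpos : ∀ a : Fin 3 → ℝ, a ≠ 0 → 0 < ∑ i, ∑ r, a i * Viscoelastic.acoustic n Ginf i r * a r := by
    intro a ha
    rw [Viscoelastic.sum_acoustic]
    exact hell a n ha hn0
  -- No symmetry of `Ginf` is assumed; it is inherited from `G t` in the limit.
  have hsymm : (Viscoelastic.acoustic n Ginf).IsSymm := by
    have hc : Continuous fun T : Viscoelastic.Tensor4 ℝ => Viscoelastic.acoustic n T :=
      continuous_matrix fun i r => by simp only [Viscoelastic.acoustic, Matrix.of_apply]; fun_prop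
    have h1 := (hc.tendsto Ginf).comp hlim
    refine tendsto_nhds_unique ((Continuous.matrix_transpose continuous_id).tendsto _ |>.comp h1)
      (h1.congr' ?_)
    filter_upwards [eventually_gt_atTop 0] with t ht
    exact ((hG.isLICMMatrix_acoustic n).symm t ht).symm
  obtain ⟨Q, hQd, hQp, hQs, hQc, hQpos, hQle⟩ := (hG.isLICMMatrix_acoustic n).exists_continuation
    (fun a t ht => hG.acoustic_le hlim n a ht) hpos
  obtain ⟨δ, hδ, hlow⟩ := Viscoelastic.exists_lower_bound_of_pos hsymm hpos
  have hQ : Viscoelastic.IsSectorial Q := ⟨hQd, hQs, hQc, hQpos⟩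
  have hS := hQ.isStieltjesType hρ.le
  have hC : ∀ x : ℝ, 0 < x → ((ρ : ℂ) • (Viscoelastic.principalSqrt (Q x))⁻¹).trace.re ≤ _ := fun x hx =>
    hQ.re_trace_inv_le hρ.le hδ hx fun a => (hlow a).trans (hQle x hx a)
  obtain ⟨B, μ, M, hD, hrep⟩ := hS.exists_representation hC
  refine ⟨fun p hp i j k l => hG.integrableOn hp i j k l, Q,
    fun i j => (hQd i j).analyticOnNhd Complex.isOpen_slitPlane,
    fun p hp => by rw [hQp p hp, hG.contract_complexModulus n hp],
    fun z hz => ⟨hQ.isPrincipalSqrt hz, hQ.isUnit_principalSqrt hz⟩, fun i j => ?_, ?_,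
    B, μ, M, hD.posSemidef, hD.isLocallyFinite, hD.measure_Iic, hD.integrableOn_inv_one_add,
    hD.measurable, ae_of_all _ fun r => ⟨(hD.density r).1, hD.sum_sq_le_one r⟩,
    fun z hz i j => ⟨hD.integrableOn_inv_add hz i j, ?_⟩,
    fun ω => ⟨hD.integrableOn_dispersion ω, hD.integrableOn_attenuation, ?_,
      hD.posSemidef_dispersionMatrix ω, hD.posSemidef_attenuationMatrix ω⟩⟩
  · simp only [Viscoelastic.waveMatrix_eq_smul]
    exact (differentiableOn_id.mul (hS.differentiableOn i j)).analyticOnNhd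
      Complex.isOpen_slitPlane
  · simp only [Viscoelastic.waveMatrix_eq_smul]
    exact hS.isMvCBF hC fun z hz => hD.posSemidef_im_smul_matIm hz (hrep z hz)
  · rw [Viscoelastic.waveMatrix_eq_smul, Matrix.smul_apply, hrep z hz, smul_eq_mul, mul_add]
  · rw [Viscoelastic.waveMatrix_eq_smul]
    -- The point `0` lies on the cut; there both sides vanish because of the explicit factors,
    -- whatever value the square root takes.
    rcases eq_or_ne ω 0 with rfl | hω
    · ext i j
      simp [Viscoelastic.attenuationMatrix]
    · refine hD.smul_eq_dispersion_add_attenuation hω (hrep _ ?_)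
      exact Complex.mem_slitPlane_iff.2 (Or.inr (by simpa using hω))
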